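/- Let $\Omega=(0,1)^2$, and let $\{\Omega_h\}$ be a shape-regular and quasi-uniform family of conforming triangulations of $\overline\Omega$; that is, with $h_K=\operatorname{diam}K$, $\rho_K$ the diameter of the largest disc inscribed in $K$ and $h=\max_{K\in\Omega_h}h_K$, there are constants $c_0,c>0$ independent of $h$ with $h_K/\rho_K\le c_0$ and $h_K\ge ch$ for every triangle $K$ of every mesh. For a triangle $K$ let $q_K$ be its cubic bubble function (the product of its barycentric coordinates) and $$\tilde P^{(3,2)}_K=\mathcal P_3(K)+q_K\mathcal P_1(K)+q_K^2\mathcal P_1(K).$$ Let $\tilde W_h$ be the space of piecewise polynomials $v_h$ with $v_h|_K\in\tilde P^{(3,2)}_K$ for all $K\in\Omega_h$ whose degrees of freedom $$v(a),\quad \nabla v(a)\quad (a \text{ a vertex}),\qquad \frac1{|e|}\int_e\frac{\partial v}{\partial\nu_e}\,ds,\quad \frac1{|e|}\int_e\frac{\partial^2 v}{\partial\nu_e^2}\,ds\quad (e\text{ an edge})$$ take the same value from all triangles sharing the vertex $a$ or the edge $e$, and let $\tilde V_h\subset\tilde W_h$ be the subspace of those functions whose degrees of freedom at all vertices and edges lying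 on $\partial\Omega$ vanish. For a piecewise polynomial $v_h$ let $\partial_h^{\alpha}v_h$ be the triangle-wise derivative, and let $\|v\|_{3,\Omega_h}^2=\sum_{K\in\Omega_h}\sum_{|\alpha|\le 3}\|\partial^\alpha v\|_{L^2(K)}^2$, summed over components for vector fields. For spaces $X_h$ of piecewise polynomial vector fields over $\Omega_h$ and a space $X\subseteq H^3(\Omega)^2$, call $X_h$ a consistent approximation of $X$ if 1. (approximation) $\lim_{h\to0}\inf_{v_h\in X_h}\|v-v_h\|_{3,\Omega_h}=0$ for every $v\in X$; and 2. (consistency) whenever $h_k\to0$, $v_k\in X_{h_k}$ and, for every $|\alpha|\le3$, $\partial_{h_k}^{\alpha}v_k$ converges weakly in $L^2(\Omega)^2$ to some $v^{\alpha}$, then $v^{0}\in X$ and $v^{\alpha}=\partial^{\alpha}v^{0}$ for all $|\alpha|\le3$. Then $\tilde V_h^2$ is a consistent approximation of $H^3_0(\Omega)^2$, and $\tilde W_h^2$ is a consistent approximation of $H^3(\Omega)^2$. -/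

import Mathlib

open MeasureTheory Filter Topology
open scoped ENNReal ContDiff

noncomputable section

namespace WuXu

/-- The Euclidean plane. -/
abbrev Plane : Type := EuclideanSpace ℝ (Fin 2)

/-- The open unit square. -/
def unitSquare : Set Plane := {x | ∀ i, 0 < x i ∧ x i < 1}

/-! ### Multi-indices and derivatives -/

/-- A two-dimensional multi-index. -/
abbrev MultiIndex : Type := Fin 2 → ℕ

/-- The order `|α| = α₁ + α₂`. -/
def order (α : MultiIndex) : ℕ := ∑ i, α i

/-- All multi-indices of order at most `m`. -/
def multiIndices (m : ℕ) : Finset MultiIndex :=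
  (Fintype.piFinset fun _ : Fin 2 => Finset.range (m + 1)).filter fun α => order α ≤ m

/-- The classical partial derivative in the `i`-th coordinate direction. -/
def partialD (i : Fin 2) (f : Plane → ℝ) : Plane → ℝ :=
  fun x => fderiv ℝ f x (EuclideanSpace.single i 1)

/-- The classical derivative `∂^α`. -/
def multiD (α : MultiIndex) (f : Plane → ℝ) : Plane → ℝ :=
  (partialD 0)^[α 0] ((partialD 1)^[α 1] f)

/-! ### Sobolev spaces -/

/-- Smooth functions with compact support inside `Ω`. -/
def IsTestFunction (Ω : Set Plane) (φ : Plane → ℝ) : Prop :=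
  ContDiff ℝ ∞ φ ∧ HasCompactSupport φ ∧ tsupport φ ⊆ Ω

/-- `g` is the weak derivative `∂^α f` on the open set `Ω`. -/
def HasWeakDeriv (Ω : Set Plane) (α : MultiIndex) (f g : Plane → ℝ) : Prop :=
  LocallyIntegrableOn f Ω ∧ LocallyIntegrableOn g Ω ∧
    ∀ φ, IsTestFunction Ω φ →
      ∫ x in Ω, f x * multiD α φ x = (-1) ^ order α * ∫ x in Ω, g x * φ x

/-- `f ∈ H^k(Ω)`. -/
def MemSobolev (k : ℕ) (Ω : Set Plane) (f : Plane → ℝ) : Prop :=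
  MemLp f 2 (volume.restrict Ω) ∧
    ∀ α, order α ≤ k → ∃ g, MemLp g 2 (volume.restrict Ω) ∧ HasWeakDeriv Ω α f g

open Classical in
/-- The weak derivative `∂^α f` on `Ω` (determined up to null sets), where it exists. -/
def weakDeriv (Ω : Set Plane) (α : MultiIndex) (f : Plane → ℝ) : Plane → ℝ :=
  if h : ∃ g, HasWeakDeriv Ω α f g then h.choose else 0

/-- `f ∈ H^k_0(Ω)`: `f` lies in the closure of the test functions in `H^k(Ω)`. -/
def MemSobolevZero (k : ℕ) (Ω : Set Plane) (f : Plane → ℝ) : Prop :=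
  MemSobolev k Ω f ∧ ∀ ε : ℝ≥0∞, 0 < ε → ∃ φ, IsTestFunction Ω φ ∧
    ∀ α, order α ≤ k →
      eLpNorm (fun x => weakDeriv Ω α f x - multiD α φ x) 2 (volume.restrict Ω) < ε

/-- The vector fields with both components in `H^k(Ω)`. -/
def vectorSobolev (k : ℕ) (Ω : Set Plane) : Set (Fin 2 → Plane → ℝ) :=
  {v | ∀ j, MemSobolev k Ω (v j)}

/-- The vector fields with both components in `H^k_0(Ω)`. -/
def vectorSobolevZero (k : ℕ) (Ω : Set Plane) : Set (Fin 2 → Plane → ℝ) :=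
  {v | ∀ j, MemSobolevZero k Ω (v j)}

/-! ### Triangulations -/

/-- A conforming triangulation of the closure of `Ω`: finitely many distinct nondegenerate
closed triangles, two of which meet in the convex hull of their common vertices
(the empty set, a common vertex or a common edge, if the triangles are distinct). -/
structure Triangulation (Ω : Set Plane) where
  /-- The number of triangles. -/
  numCells : ℕ
  /-- The three vertices of each triangle. -/
  vertex : Fin numCells → Fin 3 → Plane
  indep : ∀ K, AffineIndependent ℝ (vertex K)
  distinct : ∀ K L, Set.range (vertex K) = Set.range (vertex L) → K = L
  conforming : ∀ K L, convexHull ℝ (Set.range (vertex K)) ∩ convexHull ℝ (Set.range (vertex L)) =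
    convexHull ℝ (Set.range (vertex K) ∩ Set.range (vertex L))
  cover : ⋃ K, convexHull ℝ (Set.range (vertex K)) = closure Ω

/-- The inscribed diameter of `S`: the supremum of the diameters of discs contained in `S`. -/
def inscribedDiam (S : Set Plane) : ℝ :=
  sSup {d | ∃ x : Plane, ∃ r : ℝ, 0 ≤ r ∧ d = 2 * r ∧ Metric.closedBall x r ⊆ S}

namespace Triangulation

variable {Ω : Set Plane}

/-- The set of vertices of the triangle `K`. -/
def vertices (T : Triangulation Ω) (K : Fin T.numCells) : Set Plane := Set.range (T.vertex K)

/-- The closed triangle `K`. -/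
def cell (T : Triangulation Ω) (K : Fin T.numCells) : Set Plane := convexHull ℝ (T.vertices K)

/-- `h_K`. -/
def cellDiam (T : Triangulation Ω) (K : Fin T.numCells) : ℝ := Metric.diam (T.cell K)

/-- `h = max_K h_K`. -/
def meshSize (T : Triangulation Ω) : ℝ := ⨆ K, T.cellDiam K

end Triangulation

/-- `h_K / ρ_K` is bounded uniformly over the family of meshes. -/
def ShapeRegular {ι : Type*} {Ω : Set Plane} (T : ι → Triangulation Ω) : Prop :=
  ∃ c₀ : ℝ, 0 < c₀ ∧ ∀ i K, (T i).cellDiam K / inscribedDiam ((T i).cell K) ≤ c₀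

/-- `h_K ≥ c h` uniformly over the family of meshes. -/
def QuasiUniform {ι : Type*} {Ω : Set Plane} (T : ι → Triangulation Ω) : Prop :=
  ∃ c : ℝ, 0 < c ∧ ∀ i K, c * (T i).meshSize ≤ (T i).cellDiam K

/-! ### The element -/

/-- Real polynomials in two variables. -/
abbrev Poly : Type := MvPolynomial (Fin 2) ℝ

/-- The value of a polynomial at a point of the plane. -/
def polyEval (p : Poly) (x : Plane) : ℝ := MvPolynomial.eval (fun i => x i) p

/-- The derivative `∂^α` of a polynomial. -/
def polyD (α : MultiIndex) (p : Poly) : Poly :=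
  (fun q : Poly => MvPolynomial.pderiv 0 q)^[α 0]
    ((fun q : Poly => MvPolynomial.pderiv 1 q)^[α 1] p)

/-- The derivative of a polynomial in the direction `ν`. -/
def dirD (ν : Plane) (p : Poly) : Poly := ∑ i, MvPolynomial.C (ν i) * MvPolynomial.pderiv i p

/-- The barycentric coordinate of the triangle `v` belonging to the vertex `v i`. -/
def barycentric (v : Fin 3 → Plane) (i : Fin 3) : Poly :=
  let a := v i
  let b := v (i + 1)
  let c := v (i + 2)
  MvPolynomial.C ((b 0 - a 0) * (c 1 - a 1) - (b 1 - a 1) * (c 0 - a 0))⁻¹ *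
    ((MvPolynomial.C (b 0) - MvPolynomial.X 0) * (MvPolynomial.C (c 1) - MvPolynomial.X 1) -
      (MvPolynomial.C (b 1) - MvPolynomial.X 1) * (MvPolynomial.C (c 0) - MvPolynomial.X 0))

/-- The cubic bubble function of the triangle `v`. -/
def bubble (v : Fin 3 → Plane) : Poly := ∏ i, barycentric v i

/-- The shape function space `P₃ + q P₁ + q² P₁`, with `q` the bubble function. -/
def shapeSpace (v : Fin 3 → Plane) : Submodule ℝ Poly :=
  MvPolynomial.restrictTotalDegree (Fin 2) ℝ 3 ⊔
    (MvPolynomial.restrictTotalDegree (Fin 2) ℝ 1).map (LinearMap.mulLeft ℝ (bubble v)) ⊔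
    (MvPolynomial.restrictTotalDegree (Fin 2) ℝ 1).map (LinearMap.mulLeft ℝ (bubble v ^ 2))

/-- A unit normal of the segment from `a` to `b`. -/
def unitNormal (a b : Plane) : Plane := (dist a b)⁻¹ • !₂[b 1 - a 1, -(b 0 - a 0)]

/-- The mean `|e|⁻¹ ∫_e p ds` over the segment `e` from `a` to `b`, parametrised affinely. -/
def edgeMean (a b : Plane) (p : Poly) : ℝ :=
  ∫ s in (0 : ℝ)..1, polyEval p (AffineMap.lineMap a b s)

/-- The edge degree of freedom `|e|⁻¹ ∫_e ∂p/∂ν ds`. -/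
def edgeNormal (a b : Plane) (p : Poly) : ℝ := edgeMean a b (dirD (unitNormal a b) p)

/-- The edge degree of freedom `|e|⁻¹ ∫_e ∂²p/∂ν² ds`. -/
def edgeNormalTwo (a b : Plane) (p : Poly) : ℝ :=
  edgeMean a b (dirD (unitNormal a b) (dirD (unitNormal a b) p))

/-! ### The finite element spaces -/

/-- A piecewise polynomial function on a mesh: one polynomial for each triangle. -/
abbrev Triangulation.PiecewisePoly {Ω : Set Plane} (T : Triangulation Ω) : Type :=
  Fin T.numCells → Poly

/-- The broken derivative `∂_h^α`, defined off the mesh skeleton and put to zero elsewhere. -/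
def brokenD {Ω : Set Plane} (T : Triangulation Ω) (α : MultiIndex) (w : T.PiecewisePoly) :
    Plane → ℝ :=
  fun x => ∑ K, (interior (T.cell K)).indicator (polyEval (polyD α (w K))) x

/-- The piecewise polynomials with shape functions in `P₃ + q P₁ + q² P₁` and with single-valued
degrees of freedom: values and gradients at the vertices, means of the first and second normal
derivatives over the edges. -/
def feSpace {Ω : Set Plane} (T : Triangulation Ω) : Set T.PiecewisePoly :=
  {w | (∀ K, w K ∈ shapeSpace (T.vertex K)) ∧
    (∀ K L, ∀ a ∈ T.vertices K ∩ T.vertices L,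
      polyEval (w K) a = polyEval (w L) a ∧
      ∀ i, polyEval (MvPolynomial.pderiv i (w K)) a = polyEval (MvPolynomial.pderiv i (w L)) a) ∧
    (∀ K L, ∀ a ∈ T.vertices K ∩ T.vertices L, ∀ b ∈ T.vertices K ∩ T.vertices L, a ≠ b →
      edgeNormal a b (w K) = edgeNormal a b (w L) ∧
      edgeNormalTwo a b (w K) = edgeNormalTwo a b (w L))}

/-- The functions of `feSpace` whose degrees of freedom vanish at all vertices and edges on the
boundary of `Ω`. -/
def feSpaceZero {Ω : Set Plane} (T : Triangulation Ω) : Set T.PiecewisePoly :=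
  {w | w ∈ feSpace T ∧
    (∀ K, ∀ a ∈ T.vertices K, a ∈ frontier Ω →
      polyEval (w K) a = 0 ∧ ∀ i, polyEval (MvPolynomial.pderiv i (w K)) a = 0) ∧
    (∀ K, ∀ a ∈ T.vertices K, ∀ b ∈ T.vertices K, a ≠ b → segment ℝ a b ⊆ frontier Ω →
      edgeNormal a b (w K) = 0 ∧ edgeNormalTwo a b (w K) = 0)}

/-- Vector fields with both components in `feSpace`. -/
def vectorFE {Ω : Set Plane} (T : Triangulation Ω) : Set (Fin 2 → T.PiecewisePoly) :=
  {w | ∀ j, w j ∈ feSpace T}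

/-- Vector fields with both components in `feSpaceZero`. -/
def vectorFEZero {Ω : Set Plane} (T : Triangulation Ω) : Set (Fin 2 → T.PiecewisePoly) :=
  {w | ∀ j, w j ∈ feSpaceZero T}

/-! ### Consistent approximation -/

/-- The broken norm `‖v - w‖_{m,Ω_h}` for `v ∈ H^m(Ω)²` and a piecewise polynomial `w`. -/
def brokenDist {Ω : Set Plane} (T : Triangulation Ω) (m : ℕ) (v : Fin 2 → Plane → ℝ)
    (w : Fin 2 → T.PiecewisePoly) : ℝ≥0∞ :=
  (∑ j, ∑ K, ∑ α ∈ multiIndices m,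
    eLpNorm (fun x => weakDeriv Ω α (v j) x - polyEval (polyD α (w j K)) x) 2
      (volume.restrict (T.cell K)) ^ 2) ^ (1 / 2 : ℝ)

/-- Weak convergence in `L²(Ω)`. -/
def WeaklyConvergesL2 (Ω : Set Plane) (f : ℕ → Plane → ℝ) (g : Plane → ℝ) : Prop :=
  (∀ k, MemLp (f k) 2 (volume.restrict Ω)) ∧ MemLp g 2 (volume.restrict Ω) ∧
    ∀ φ, MemLp φ 2 (volume.restrict Ω) →
      Tendsto (fun k => ∫ x in Ω, f k x * φ x) atTop (𝓝 (∫ x in Ω, g x * φ x))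

/-- The spaces `V i` of piecewise polynomial vector fields over the meshes `T i` form a consistent
approximation of the space `X` of vector fields with components in `H^m(Ω)`, as the mesh size tends
to zero. -/
structure IsConsistentApproximation {ι : Type*} {Ω : Set Plane} (m : ℕ)
    (T : ι → Triangulation Ω) (V : ∀ i, Set (Fin 2 → (T i).PiecewisePoly))
    (X : Set (Fin 2 → Plane → ℝ)) : Prop where
  approximation : ∀ v ∈ X,
    Tendsto (fun i => ⨅ w ∈ V i, brokenDist (T i) m v w)
      (comap (fun i => (T i).meshSize) (𝓝 0)) (𝓝 0)
  consistency : ∀ (n : ℕ → ι) (w : ∀ k, Fin 2 → (T (n k)).PiecewisePoly)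
    (g : MultiIndex → Fin 2 → Plane → ℝ),
    Tendsto (fun k => (T (n k)).meshSize) atTop (𝓝 0) →
    (∀ k, w k ∈ V (n k)) →
    (∀ α, order α ≤ m → ∀ j,
      WeaklyConvergesL2 Ω (fun k => brokenD (T (n k)) α (w k j)) (g α j)) →
    g 0 ∈ X ∧ ∀ α, order α ≤ m → ∀ j, HasWeakDeriv Ω α (g 0 j) (g α j)

end WuXu

end

open MeasureTheory Filter Topology
open scoped ENNReal ContDiff

noncomputable section

namespace WuXu

/-! ### Calculus of polynomials and of smooth functions -/

/-! The proof has two independent halves, and the vector fields are treated one component at a time.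

Consistency. On an edge the bubble vanishes, so a shape function restricts to a cubic, fixed by its
values and gradients at the two endpoints. Integrating a tangential derivative along an edge gives a
difference of endpoint values, and the two kinds of normal means are degrees of freedom. Hence the
edge means of all derivatives of order at most two are single-valued (`edgeMean_polyD_eq`), and they
vanish on boundary edges in the case of `feSpaceZero`. This is a patch test: in an integration by
parts against a smooth `φ`, the field `φ e_k` is replaced on each triangle by its lowest-order
Raviart–Thomas interpolant, whose normal flux on each edge is constant. The edge terms of the
interpolant cancel exactly between neighbours (`sum_flux_eq_zero`), and the interpolation error
costs a factor `h` (`abs_integral_parts_triangle_le`). Weakly convergent sequences are bounded, so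
the error tends to zero and the weak limits satisfy the exact identity `∫ g^(β+e) φ = -∫ g^β ∂φ`
(`weakLimit_integral_parts`). For `feSpace` this holds for `φ` supported in the square, so the `g^α`
are the weak derivatives of `g^0`. For `feSpaceZero` it holds for every compactly supported smooth
`φ` on the plane, so the extension of `g^0` by zero has weak derivatives up to order three;
shrinking its support by a dilation and mollifying gives test functions converging to `g^0`, which
therefore lies in `H^3_0` (`memSobolevZero_of_integral_mul_multiD`).

Approximation. Functions smooth up to the boundary are dense in `H^3` of the square (dilate, then
mollify), and test functions are dense in `H^3_0` by definition. For a smooth `φ` a shape function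
with the degrees of freedom of `φ` is built explicitly on each triangle: a Hermite cubic, then
multiples of `q (1 - 2 λ_j)` correcting the first normal means, then multiples of `q² (1 - 2 λ_j)`
correcting the second ones (`exists_shape_interpolant`). Applied to `φ` minus its cubic Taylor
polynomial, which is itself a shape function, this gives errors of order `h^(4-|α|)` in the
derivatives `∂^α` with `|α| ≤ 3` (`exists_localInterpolant`). All constants are uniform because each
derivative of a fixed polynomial in the barycentric coordinates costs at most a factor `c₀ / h_K`
(`abs_baryGrad_mul_diam_le`). -/

theorem order_eq (α : MultiIndex) : order α = α 0 + α 1 := by simp [order]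

theorem mem_multiIndices {m : ℕ} {α : MultiIndex} : α ∈ multiIndices m ↔ order α ≤ m := by
  simp only [multiIndices, Finset.mem_filter, Fintype.mem_piFinset, Finset.mem_range,
    Fin.forall_fin_two, order_eq]
  omega

theorem hasFDerivAt_polyEval (p : Poly) (x : Plane) :
    HasFDerivAt (polyEval p)
      (∑ i, polyEval (MvPolynomial.pderiv i p) x • (EuclideanSpace.proj i : Plane →L[ℝ] ℝ)) x := by
  induction p using MvPolynomial.induction_on with
  | C a =>
    have : polyEval (MvPolynomial.C a) = fun _ => a := by ext; simp [polyEval]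
    rw [this]
    simpa [polyEval] using hasFDerivAt_const a x
  | add p q hp hq =>
    have : polyEval (p + q) = polyEval p + polyEval q := by ext; simp [polyEval]
    rw [this]
    refine (hp.add hq).congr_fderiv ?_
    simp only [map_add, polyEval, add_smul, Finset.sum_add_distrib]
  | mul_X p i hp =>
    have : polyEval (p * MvPolynomial.X i) =
        fun y => polyEval p y * (EuclideanSpace.proj i : Plane →L[ℝ] ℝ) y := by
      ext; simp [polyEval]
    rw [this]
    refine (hp.mul (EuclideanSpace.proj i : Plane →L[ℝ] ℝ).hasFDerivAt).congr_fderiv ?_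
    ext y
    fin_cases i <;>
      simp [polyEval, MvPolynomial.pderiv_X, Pi.single_apply, Fin.sum_univ_two] <;> ring

theorem partialD_polyEval (i : Fin 2) (p : Poly) :
    partialD i (polyEval p) = polyEval (MvPolynomial.pderiv i p) := by
  ext x
  rw [partialD, (hasFDerivAt_polyEval p x).fderiv]
  fin_cases i <;> simp [Fin.sum_univ_two]

theorem contDiff_polyEval (p : Poly) : ContDiff ℝ ∞ (polyEval p) := by
  induction p using MvPolynomial.induction_on with
  | C a =>
    have : polyEval (MvPolynomial.C a) = fun _ => a := by ext; simp [polyEval]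
    rw [this]; exact contDiff_const
  | add p q hp hq =>
    have : polyEval (p + q) = fun x => polyEval p x + polyEval q x := by ext; simp [polyEval]
    rw [this]; exact hp.add hq
  | mul_X p i hp =>
    have : polyEval (p * MvPolynomial.X i) =
        fun y => polyEval p y * (EuclideanSpace.proj i : Plane →L[ℝ] ℝ) y := by
      ext; simp [polyEval]
    rw [this]; exact hp.mul (ContinuousLinearMap.contDiff _)

theorem continuous_polyEval (p : Poly) : Continuous (polyEval p) := (contDiff_polyEval p).continuous

@[simp] theorem polyEval_add (p q : Poly) (x : Plane) :
    polyEval (p + q) x = polyEval p x + polyEval q x := by simp [polyEval]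

@[simp] theorem polyEval_sub (p q : Poly) (x : Plane) :
    polyEval (p - q) x = polyEval p x - polyEval q x := by simp [polyEval]

@[simp] theorem polyEval_mul (p q : Poly) (x : Plane) :
    polyEval (p * q) x = polyEval p x * polyEval q x := by simp [polyEval]

@[simp] theorem polyEval_pow (p : Poly) (n : ℕ) (x : Plane) :
    polyEval (p ^ n) x = polyEval p x ^ n := by simp [polyEval]

@[simp] theorem polyEval_C (a : ℝ) (x : Plane) : polyEval (MvPolynomial.C a) x = a := by
  simp [polyEval]

@[simp] theorem polyEval_X (i : Fin 2) (x : Plane) : polyEval (MvPolynomial.X i) x = x i := by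
  simp [polyEval]

@[simp] theorem polyEval_zero (x : Plane) : polyEval 0 x = 0 := by simp [polyEval]

@[simp] theorem polyEval_one (x : Plane) : polyEval 1 x = 1 := by simp [polyEval]

theorem polyEval_sum {ι : Type*} (s : Finset ι) (p : ι → Poly) (x : Plane) :
    polyEval (∑ i ∈ s, p i) x = ∑ i ∈ s, polyEval (p i) x := by simp [polyEval]

/-- The commutator of two derivations is again a derivation, so it is zero as soon as it kills the
variables. -/
theorem pderiv_comm (i j : Fin 2) (p : Poly) :
    MvPolynomial.pderiv i (MvPolynomial.pderiv j p) =
      MvPolynomial.pderiv j (MvPolynomial.pderiv i p) := by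
  have h : ⁅(MvPolynomial.pderiv i : Derivation ℝ Poly Poly),
      (MvPolynomial.pderiv j : Derivation ℝ Poly Poly)⁆ = 0 := by
    apply MvPolynomial.derivation_ext
    intro k
    rw [Derivation.commutator_apply]
    simp only [MvPolynomial.pderiv_X, Pi.single_apply]
    split_ifs <;> simp
  have := congrArg (fun D => D p) h
  simp only [Derivation.commutator_apply, Derivation.coe_zero, Pi.zero_apply] at this
  exact sub_eq_zero.mp this

theorem contDiff_partialD (i : Fin 2) {f : Plane → ℝ} (hf : ContDiff ℝ ∞ f) :
    ContDiff ℝ ∞ (partialD i f) :=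
  (hf.fderiv_right (m := ∞) (by simp)).clm_apply contDiff_const

theorem partialD_comm (i j : Fin 2) {f : Plane → ℝ} (hf : ContDiff ℝ ∞ f) :
    partialD i (partialD j f) = partialD j (partialD i f) := by
  have hd : Differentiable ℝ (fderiv ℝ f) :=
    (hf.fderiv_right (m := ∞) (by simp)).differentiable (by simp)
  have key : ∀ (k l : Fin 2) (x : Plane), partialD k (partialD l f) x =
      fderiv ℝ (fderiv ℝ f) x (EuclideanSpace.single k 1) (EuclideanSpace.single l 1) := by
    intro k l x
    have : HasFDerivAt (partialD l f)
        ((ContinuousLinearMap.apply ℝ ℝ (EuclideanSpace.single l (1 : ℝ) : Plane)).comp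
          (fderiv ℝ (fderiv ℝ f) x)) x :=
      (ContinuousLinearMap.hasFDerivAt
        (ContinuousLinearMap.apply ℝ ℝ (EuclideanSpace.single l (1 : ℝ) : Plane))).comp x
        (hd x).hasFDerivAt
    rw [partialD, this.fderiv]
    simp
  ext x
  rw [key, key]
  exact ((contDiff_infty.1 hf 2).contDiffAt.isSymmSndFDerivAt (by simp)).eq _ _

theorem contDiff_iterate_partialD (i : Fin 2) (n : ℕ) {f : Plane → ℝ} (hf : ContDiff ℝ ∞ f) :
    ContDiff ℝ ∞ ((partialD i)^[n] f) := by
  induction n generalizing f with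
  | zero => exact hf
  | succ n ih => exact ih (contDiff_partialD i hf)

theorem contDiff_multiD (α : MultiIndex) {f : Plane → ℝ} (hf : ContDiff ℝ ∞ f) :
    ContDiff ℝ ∞ (multiD α f) :=
  contDiff_iterate_partialD _ _ (contDiff_iterate_partialD _ _ hf)

theorem partialD_iterate_comm (i j : Fin 2) (n : ℕ) {f : Plane → ℝ} (hf : ContDiff ℝ ∞ f) :
    partialD i ((partialD j)^[n] f) = (partialD j)^[n] (partialD i f) := by
  induction n generalizing f with
  | zero => rfl
  | succ n ih =>
    rw [Function.iterate_succ_apply, ih (contDiff_partialD j hf), partialD_comm i j hf,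
      Function.iterate_succ_apply]

theorem multiD_zero (f : Plane → ℝ) : multiD 0 f = f := rfl

theorem polyD_zero (p : Poly) : polyD 0 p = p := rfl

theorem order_add_single (α : MultiIndex) (i : Fin 2) : order (α + Pi.single i 1) = order α + 1 := by
  fin_cases i <;> simp [order_eq] <;> omega

theorem multiD_add_single (α : MultiIndex) (i : Fin 2) {f : Plane → ℝ} (hf : ContDiff ℝ ∞ f) :
    multiD (α + Pi.single i 1) f = multiD α (partialD i f) := by
  fin_cases i
  · simp [multiD, Function.iterate_succ_apply, partialD_iterate_comm 0 1 _ hf]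
  · simp [multiD, Function.iterate_succ_apply]

theorem partialD_multiD (α : MultiIndex) (i : Fin 2) {f : Plane → ℝ} (hf : ContDiff ℝ ∞ f) :
    partialD i (multiD α f) = multiD (α + Pi.single i 1) f := by
  rw [multiD_add_single α i hf, multiD, partialD_iterate_comm _ _ _ (contDiff_iterate_partialD _ _ hf),
    partialD_iterate_comm _ _ _ hf, multiD]

theorem pderiv_iterate_comm (i j : Fin 2) (n : ℕ) (p : Poly) :
    MvPolynomial.pderiv i ((fun q : Poly => MvPolynomial.pderiv j q)^[n] p) =
      (fun q : Poly => MvPolynomial.pderiv j q)^[n] (MvPolynomial.pderiv i p) := by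
  induction n generalizing p with
  | zero => rfl
  | succ n ih => rw [Function.iterate_succ_apply, ih, pderiv_comm, Function.iterate_succ_apply]

theorem polyD_add_single (α : MultiIndex) (i : Fin 2) (p : Poly) :
    polyD (α + Pi.single i 1) p = polyD α (MvPolynomial.pderiv i p) := by
  fin_cases i
  · simp [polyD, Function.iterate_succ_apply, pderiv_iterate_comm 0 1]
  · simp [polyD, Function.iterate_succ_apply]

theorem pderiv_polyD (α : MultiIndex) (i : Fin 2) (p : Poly) :
    MvPolynomial.pderiv i (polyD α p) = polyD (α + Pi.single i 1) p := by
  rw [polyD_add_single, polyD, pderiv_iterate_comm, pderiv_iterate_comm, polyD]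

/-- Every multi-index of positive order is of the form `α + e_i`. -/
theorem exists_eq_add_single {α : MultiIndex} {n : ℕ} (h : order α = n + 1) :
    ∃ (β : MultiIndex) (i : Fin 2), α = β + Pi.single i 1 ∧ order β = n := by
  by_cases h1 : 0 < α 1
  · refine ⟨![α 0, α 1 - 1], 1, ?_, ?_⟩
    · ext j; fin_cases j <;> simp; omega
    · rw [order_eq] at *; simp; omega
  · refine ⟨![α 0 - 1, α 1], 0, ?_, ?_⟩
    · rw [order_eq] at h
      ext j; fin_cases j <;> simp; omega
    · rw [order_eq] at *; simp; omega

theorem order_eq_zero {α : MultiIndex} (h : order α = 0) : α = 0 := by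
  rw [order_eq] at h
  ext j; fin_cases j <;> simp <;> omega

theorem multiD_polyEval (α : MultiIndex) (p : Poly) :
    multiD α (polyEval p) = polyEval (polyD α p) := by
  obtain ⟨n, hn⟩ : ∃ n, order α = n := ⟨_, rfl⟩
  induction n generalizing α p with
  | zero => rw [order_eq_zero hn]; rfl
  | succ n ih =>
    obtain ⟨β, i, rfl, hβ⟩ := exists_eq_add_single hn
    rw [multiD_add_single _ _ (contDiff_polyEval p), polyD_add_single, partialD_polyEval, ih _ _ hβ]

theorem polyD_add (α : MultiIndex) (p q : Poly) : polyD α (p + q) = polyD α p + polyD α q := by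
  simp only [polyD]
  rw [← Derivation.coeFn_coe, ← Derivation.coeFn_coe, ← Module.End.coe_pow, ← Module.End.coe_pow]
  simp

theorem polyD_C_mul (α : MultiIndex) (c : ℝ) (p : Poly) :
    polyD α (MvPolynomial.C c * p) = MvPolynomial.C c * polyD α p := by
  simp only [polyD, ← MvPolynomial.smul_eq_C_mul]
  rw [← Derivation.coeFn_coe, ← Derivation.coeFn_coe, ← Module.End.coe_pow, ← Module.End.coe_pow]
  simp

/-! ### Geometry of a triangle -/

/-- Twice the signed area of the triangle `v`. -/
def dblArea (v : Fin 3 → Plane) : ℝ :=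
  (v 1 0 - v 0 0) * (v 2 1 - v 0 1) - (v 1 1 - v 0 1) * (v 2 0 - v 0 0)

/-- The value of a barycentric coordinate. -/
def bary (v : Fin 3 → Plane) (i : Fin 3) (x : Plane) : ℝ := polyEval (barycentric v i) x

/-- The partial derivatives of the barycentric coordinates, which are constants. -/
def baryGrad (v : Fin 3 → Plane) (i : Fin 3) (k : Fin 2) : ℝ :=
  (dblArea v)⁻¹ * (![v (i + 1) 1 - v (i + 2) 1, v (i + 2) 0 - v (i + 1) 0] k)

theorem dblArea_rotate (v : Fin 3 → Plane) (i : Fin 3) :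
    (v (i + 1) 0 - v i 0) * (v (i + 2) 1 - v i 1) - (v (i + 1) 1 - v i 1) * (v (i + 2) 0 - v i 0) =
      dblArea v := by
  fin_cases i <;> simp [dblArea] <;> ring

theorem barycentric_eq (v : Fin 3 → Plane) (i : Fin 3) :
    barycentric v i = MvPolynomial.C (dblArea v)⁻¹ *
    ((MvPolynomial.C (v (i + 1) 0) - MvPolynomial.X 0) *
        (MvPolynomial.C (v (i + 2) 1) - MvPolynomial.X 1) -
      (MvPolynomial.C (v (i + 1) 1) - MvPolynomial.X 1) *
        (MvPolynomial.C (v (i + 2) 0) - MvPolynomial.X 0)) := by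
  rw [barycentric, ← dblArea_rotate v i]

theorem bary_eq (v : Fin 3 → Plane) (i : Fin 3) (x : Plane) :
    bary v i x = (dblArea v)⁻¹ * ((v (i + 1) 0 - x 0) * (v (i + 2) 1 - x 1) -
      (v (i + 1) 1 - x 1) * (v (i + 2) 0 - x 0)) := by
  simp [bary, barycentric_eq]

theorem pderiv_barycentric (v : Fin 3 → Plane) (i : Fin 3) (k : Fin 2) :
    MvPolynomial.pderiv k (barycentric v i) = MvPolynomial.C (baryGrad v i k) := by
  rw [barycentric_eq, MvPolynomial.pderiv_C_mul, baryGrad, map_mul]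
  congr 1
  fin_cases k <;>
    simp [MvPolynomial.pderiv_X]

section
variable {v : Fin 3 → Plane}

theorem dblArea_ne_zero (hv : AffineIndependent ℝ v) : dblArea v ≠ 0 := by
  intro h0
  rw [affineIndependent_iff] at hv
  have key : ∀ k : Fin 2, v 1 k = v 0 k := by
    intro k
    -- These weights sum to zero, and the components of the weighted vertex sum are zero and plus or
    -- minus the signed area. If the area vanished they would be an affine dependence.
    have h := hv Finset.univ (![v 1 k - v 2 k, v 2 k - v 0 k, v 0 k - v 1 k])
      (by simp [Fin.sum_univ_three]) ?_ 2 (by simp)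
    · simp at h; linarith
    · ext l
      rw [dblArea] at h0
      fin_cases k <;> fin_cases l <;> simp [Fin.sum_univ_three] <;> linarith
  have h := hv Finset.univ (![1, -1, 0]) (by simp [Fin.sum_univ_three]) (by
    ext l
    have := key l
    simp [Fin.sum_univ_three, this]) 0 (by simp)
  simp at h

theorem bary_sum (hD : dblArea v ≠ 0) (x : Plane) : ∑ i, bary v i x = 1 := by
  simp only [bary_eq, ← Finset.mul_sum, Fin.sum_univ_three]
  rw [inv_mul_eq_iff_eq_mul₀ hD]
  simp [dblArea]; ring

theorem bary_repr (hD : dblArea v ≠ 0) (x : Plane) (k : Fin 2) :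
    ∑ i, bary v i x * v i k = x k := by
  simp only [bary_eq, mul_assoc, ← Finset.mul_sum, Fin.sum_univ_three]
  rw [inv_mul_eq_iff_eq_mul₀ hD]
  fin_cases k <;> simp [dblArea] <;> ring

theorem bary_repr' (hD : dblArea v ≠ 0) (x : Plane) : ∑ i, bary v i x • v i = x := by
  ext k
  rw [← bary_repr hD x k]
  simp

theorem bary_vertex (hD : dblArea v ≠ 0) (i j : Fin 3) :
    bary v i (v j) = if i = j then 1 else 0 := by
  rw [bary_eq, inv_mul_eq_iff_eq_mul₀ hD]
  fin_cases i <;> fin_cases j <;> simp [dblArea] <;> ring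

theorem bary_sub (v : Fin 3 → Plane) (i : Fin 3) (x y : Plane) :
    bary v i x - bary v i y = ∑ k, baryGrad v i k * (x k - y k) := by
  simp only [bary_eq, baryGrad, Fin.sum_univ_two, mul_assoc, ← mul_add, ← mul_sub]
  simp; left; ring

theorem sum_baryGrad (v : Fin 3 → Plane) (k : Fin 2) : ∑ i, baryGrad v i k = 0 := by
  simp only [baryGrad, ← Finset.mul_sum, Fin.sum_univ_three]
  fin_cases k <;> simp

theorem sum_baryGrad_mul (hD : dblArea v ≠ 0) (k l : Fin 2) :
    ∑ i, baryGrad v i k * v i l = if k = l then 1 else 0 := by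
  simp only [baryGrad, mul_assoc, ← Finset.mul_sum, Fin.sum_univ_three]
  rw [inv_mul_eq_iff_eq_mul₀ hD]
  fin_cases k <;> fin_cases l <;> simp [dblArea] <;> ring

theorem bary_convexComb (v : Fin 3 → Plane) (i : Fin 3) (x y : Plane) {s t : ℝ} (h : s + t = 1) :
    bary v i (s • x + t • y) = s * bary v i x + t * bary v i y := by
  have h1 := bary_sub v i (s • x + t • y) y
  have h2 := bary_sub v i x y
  obtain rfl : t = 1 - s := by linarith
  simp [Fin.sum_univ_two] at h1 h2
  linear_combination h1 - s * h2

theorem bary_lineMap (v : Fin 3 → Plane) (i : Fin 3) (x y : Plane) (s : ℝ) :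
    bary v i (AffineMap.lineMap x y s) = (1 - s) * bary v i x + s * bary v i y := by
  rw [AffineMap.lineMap_apply_module, bary_convexComb v i x y (by ring)]

theorem mem_triangle_iff (hD : dblArea v ≠ 0) {x : Plane} :
    x ∈ convexHull ℝ (Set.range v) ↔ ∀ i, 0 ≤ bary v i x := by
  constructor
  · intro hx i
    have hc : Convex ℝ {x | 0 ≤ bary v i x} := by
      intro x hx y hy s t hs ht hst
      simp only [Set.mem_ofPred_eq] at *
      rw [bary_convexComb v i x y hst]
      positivity
    refine convexHull_min ?_ hc hx
    rintro _ ⟨j, rfl⟩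
    simp only [Set.mem_ofPred_eq, bary_vertex hD]
    split_ifs <;> simp
  · intro hx
    rw [← bary_repr' hD x]
    exact (convex_convexHull ℝ _).sum_mem (fun i _ => hx i) (bary_sum hD x)
      (fun i _ => subset_convexHull ℝ _ ⟨i, rfl⟩)

theorem bary_le_one (hD : dblArea v ≠ 0) {x : Plane} (hx : x ∈ convexHull ℝ (Set.range v))
    (i : Fin 3) : bary v i x ≤ 1 := by
  rw [← bary_sum hD x]
  exact Finset.single_le_sum (fun j _ => (mem_triangle_iff hD).1 hx j) (Finset.mem_univ i)

theorem bary_eq_zero_of_mem_convexHull (hD : dblArea v ≠ 0) {S : Set Plane} {x : Plane}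
    (hS : S ⊆ Set.range v) {i : Fin 3} (hi : v i ∉ S) (hx : x ∈ convexHull ℝ S) :
    bary v i x = 0 := by
  have hc : Convex ℝ {x | bary v i x = 0} := by
    intro x hx y hy s t hs ht hst
    simp only [Set.mem_ofPred_eq] at *
    rw [bary_convexComb v i x y hst, hx, hy]
    simp
  refine convexHull_min ?_ hc hx
  intro y hy
  obtain ⟨j, rfl⟩ := hS hy
  simp only [Set.mem_ofPred_eq, bary_vertex hD]
  rw [if_neg]
  rintro rfl
  exact hi hy

theorem continuous_bary (v : Fin 3 → Plane) (i : Fin 3) : Continuous (bary v i) :=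
  continuous_polyEval _

theorem subset_interior_triangle (hD : dblArea v ≠ 0) :
    {x | ∀ i, 0 < bary v i x} ⊆ interior (convexHull ℝ (Set.range v)) := by
  apply interior_maximal
  · intro x hx
    exact (mem_triangle_iff hD).2 fun i => (hx i).le
  · simp only [Set.ofPred_forall]
    exact isOpen_iInter_of_finite fun i => isOpen_lt continuous_const (continuous_bary v i)

theorem isCompact_triangle (v : Fin 3 → Plane) : IsCompact (convexHull ℝ (Set.range v)) :=
  (Set.finite_range v).isCompact_convexHull ℝ

theorem dist_le_diam_triangle {x y : Plane} (hx : x ∈ convexHull ℝ (Set.range v))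
    (hy : y ∈ convexHull ℝ (Set.range v)) :
    dist x y ≤ Metric.diam (convexHull ℝ (Set.range v)) :=
  Metric.dist_le_diam_of_mem (isCompact_triangle v).isBounded hx hy

theorem vertex_mem_triangle (v : Fin 3 → Plane) (i : Fin 3) : v i ∈ convexHull ℝ (Set.range v) :=
  subset_convexHull ℝ _ ⟨i, rfl⟩

theorem vertex_injective (hD : dblArea v ≠ 0) : Function.Injective v := by
  intro i j h
  have h1 := bary_vertex hD i i
  rw [h, bary_vertex hD] at h1
  by_contra hij
  simp [hij] at h1

theorem diam_triangle_pos (hD : dblArea v ≠ 0) :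
    0 < Metric.diam (convexHull ℝ (Set.range v)) :=
  (dist_pos.2 ((vertex_injective hD).ne (by decide : (0 : Fin 3) ≠ 1))).trans_le
    (dist_le_diam_triangle (vertex_mem_triangle v 0) (vertex_mem_triangle v 1))

theorem abs_coord_sub_le (x y : Plane) (k : Fin 2) : |x k - y k| ≤ dist x y := by
  rw [dist_eq_norm, ← Real.norm_eq_abs]
  exact PiLp.norm_apply_le (x - y) k

/-- Between the two ends of the diameter parallel to the `k`-th axis the barycentric coordinate
changes by `2 r ∂_k λ_i`, and at both ends it lies in `[0, 1]`. -/
theorem two_mul_radius_mul_le (hD : dblArea v ≠ 0) {x : Plane} {r : ℝ} (hr : 0 ≤ r)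
    (h : Metric.closedBall x r ⊆ convexHull ℝ (Set.range v)) (i : Fin 3) (k : Fin 2) :
    2 * r * |baryGrad v i k| ≤ 1 := by
  have hn : ‖(EuclideanSpace.single k r : Plane)‖ ≤ r := by simp [abs_of_nonneg hr]
  have h1 := h (show x + EuclideanSpace.single k r ∈ Metric.closedBall x r by simpa using hn)
  have h2 := h (show x - EuclideanSpace.single k r ∈ Metric.closedBall x r by simpa using hn)
  have h3 := bary_sub v i (x + EuclideanSpace.single k r) (x - EuclideanSpace.single k r)
  have h4 : bary v i (x + EuclideanSpace.single k r) - bary v i (x - EuclideanSpace.single k r) =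
      2 * r * baryGrad v i k := by
    rw [h3]
    fin_cases k <;> simp [Fin.sum_univ_two] <;> ring
  have h5 := (mem_triangle_iff hD).1 h1 i
  have h6 := (mem_triangle_iff hD).1 h2 i
  have h7 := bary_le_one hD h1 i
  have h8 := bary_le_one hD h2 i
  have : |2 * r * baryGrad v i k| ≤ 1 := by rw [← h4, abs_le]; constructor <;> linarith
  rwa [abs_mul, abs_of_nonneg (by positivity)] at this

theorem abs_baryGrad_mul_inscribedDiam_le (hD : dblArea v ≠ 0) (i : Fin 3) (k : Fin 2) :
    |baryGrad v i k| * inscribedDiam (convexHull ℝ (Set.range v)) ≤ 1 := by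
  rcases (abs_nonneg (baryGrad v i k)).eq_or_lt with h0 | h0
  · rw [← h0]; simp
  · rw [← le_div_iff₀' h0]
    refine csSup_le ⟨0, v 0, 0, le_rfl, by simp, ?_⟩ ?_
    · simpa using vertex_mem_triangle v 0
    · rintro d ⟨x, r, hr, rfl, hb⟩
      rw [le_div_iff₀ h0]
      exact two_mul_radius_mul_le hD hr hb i k

theorem exists_baryGrad_ne_zero (hD : dblArea v ≠ 0) : ∃ i, baryGrad v i 0 ≠ 0 := by
  by_contra! h
  have := sum_baryGrad_mul hD 0 0
  simp [h] at this

/-- Division by zero gives zero, so a bound on `h_K / ρ_K` carries information only once `ρ_K` is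
known to be positive. -/
theorem inscribedDiam_triangle_pos (hD : dblArea v ≠ 0) :
    0 < inscribedDiam (convexHull ℝ (Set.range v)) := by
  obtain ⟨c, hc⟩ : ∃ c : Plane, ∀ i, bary v i c = 1 / 3 := by
    refine ⟨(1 / 3 : ℝ) • (v 0 + v 1 + v 2), fun i => ?_⟩
    have e : (1 / 3 : ℝ) • (v 0 + v 1 + v 2) =
        (2 / 3 : ℝ) • ((1 / 2 : ℝ) • v 0 + (1 / 2 : ℝ) • v 1) + (1 / 3 : ℝ) • v 2 := by
      module
    rw [e, bary_convexComb _ _ _ _ (by norm_num), bary_convexComb _ _ _ _ (by norm_num)]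
    simp only [bary_vertex hD]
    fin_cases i <;> simp <;> norm_num
  have hmem : c ∈ interior (convexHull ℝ (Set.range v)) :=
    subset_interior_triangle hD fun i => by rw [hc i]; norm_num
  obtain ⟨r, hr, hb⟩ := Metric.nhds_basis_closedBall.mem_iff.1 (mem_interior_iff_mem_nhds.1 hmem)
  obtain ⟨i, hi⟩ := exists_baryGrad_ne_zero hD
  -- The supremum of an unbounded set of reals is zero by convention, so boundedness has to be
  -- shown; a nonconstant barycentric coordinate limits the radii.
  have hbdd : BddAbove {d | ∃ x : Plane, ∃ r : ℝ, 0 ≤ r ∧ d = 2 * r ∧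
      Metric.closedBall x r ⊆ convexHull ℝ (Set.range v)} := by
    refine ⟨1 / |baryGrad v i 0|, ?_⟩
    rintro d ⟨x, r, hr, rfl, hb⟩
    rw [le_div_iff₀ (abs_pos.2 hi)]
    exact two_mul_radius_mul_le hD hr hb i 0
  calc (0 : ℝ) < 2 * r := by positivity
    _ ≤ _ := le_csSup hbdd ⟨c, r, hr.le, rfl, hb⟩

/-- The form in which shape regularity enters every estimate: `|∂_k λ_i| ≤ 1 / ρ_K ≤ c₀ / h_K`. -/
theorem abs_baryGrad_mul_diam_le (hD : dblArea v ≠ 0) {c₀ : ℝ}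
    (h : Metric.diam (convexHull ℝ (Set.range v)) / inscribedDiam (convexHull ℝ (Set.range v)) ≤ c₀)
    (i : Fin 3) (k : Fin 2) :
    |baryGrad v i k| * Metric.diam (convexHull ℝ (Set.range v)) ≤ c₀ := by
  have hρ := inscribedDiam_triangle_pos hD
  rw [div_le_iff₀ hρ] at h
  have hc : 0 ≤ c₀ := by
    by_contra! hneg
    have := diam_triangle_pos hD
    nlinarith
  calc _ ≤ |baryGrad v i k| * (c₀ * inscribedDiam (convexHull ℝ (Set.range v))) := by gcongr
    _ = c₀ * (|baryGrad v i k| * inscribedDiam (convexHull ℝ (Set.range v))) := by ring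
    _ ≤ c₀ * 1 := by gcongr; exact abs_baryGrad_mul_inscribedDiam_le hD i k
    _ = c₀ := mul_one _

end

/-! ### The unit square -/

theorem isOpen_unitSquare : IsOpen unitSquare := by
  simp only [unitSquare, Set.ofPred_forall, Set.ofPred_and]
  exact isOpen_iInter_of_finite fun i =>
    (isOpen_lt continuous_const (EuclideanSpace.proj i : Plane →L[ℝ] ℝ).continuous).inter
      (isOpen_lt (EuclideanSpace.proj i : Plane →L[ℝ] ℝ).continuous continuous_const)

theorem convex_unitSquare : Convex ℝ unitSquare := by
  intro x hx y hy s t hs ht hst i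
  obtain ⟨h1, h2⟩ := hx i
  obtain ⟨h3, h4⟩ := hy i
  simp only [PiLp.add_apply, PiLp.smul_apply, smul_eq_mul]
  obtain rfl : t = 1 - s := by linarith
  constructor
  · rcases hs.eq_or_lt with rfl | hs
    · simpa
    · nlinarith [mul_pos hs h1, mul_nonneg ht h3.le]
  · rcases hs.eq_or_lt with rfl | hs
    · simpa
    · nlinarith [mul_lt_mul_of_pos_left h2 hs, mul_le_mul_of_nonneg_left h4.le ht]

theorem nonempty_unitSquare : unitSquare.Nonempty :=
  ⟨!₂[1 / 2, 1 / 2], by intro i; fin_cases i <;> norm_num⟩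

theorem interior_closure_unitSquare : interior (closure unitSquare) = unitSquare := by
  rw [convex_unitSquare.interior_closure_eq_interior_of_nonempty_interior
    (by rw [isOpen_unitSquare.interior_eq]; exact nonempty_unitSquare),
    isOpen_unitSquare.interior_eq]

theorem closure_unitSquare_subset : closure unitSquare ⊆ {x | ∀ i, 0 ≤ x i ∧ x i ≤ 1} := by
  refine closure_minimal (fun x hx i => ⟨(hx i).1.le, (hx i).2.le⟩) ?_
  simp only [Set.ofPred_forall, Set.ofPred_and]
  exact isClosed_iInter fun i =>
    (isClosed_le continuous_const (EuclideanSpace.proj i : Plane →L[ℝ] ℝ).continuous).inter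
      (isClosed_le (EuclideanSpace.proj i : Plane →L[ℝ] ℝ).continuous continuous_const)

theorem frontier_unitSquare : frontier unitSquare = closure unitSquare \ unitSquare := by
  rw [frontier, isOpen_unitSquare.interior_eq]

theorem isCompact_closure_unitSquare : IsCompact (closure unitSquare) := by
  refine Metric.isCompact_of_isClosed_isBounded isClosed_closure ?_
  rw [isBounded_iff_forall_norm_le]
  refine ⟨2, fun x hx => ?_⟩
  have h := closure_unitSquare_subset hx
  rw [EuclideanSpace.norm_eq, Real.sqrt_le_left (by norm_num)]
  simp only [Real.norm_eq_abs, sq_abs, Fin.sum_univ_two]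
  nlinarith [(h 0).1, (h 0).2, (h 1).1, (h 1).2]

/-- A segment of the closed square whose midpoint is on the boundary lies in the boundary. -/
theorem segment_subset_frontier {a b : Plane} (ha : a ∈ closure unitSquare)
    (hb : b ∈ closure unitSquare) (hm : midpoint ℝ a b ∉ unitSquare) :
    segment ℝ a b ⊆ frontier unitSquare := by
  intro x hx
  rw [frontier_unitSquare]
  refine ⟨convex_unitSquare.closure.segment_subset ha hb hx, fun hxs => hm ?_⟩
  obtain ⟨s, t, hs, ht, hst, rfl⟩ := hx
  intro i
  have h1 := closure_unitSquare_subset ha i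
  have h2 := closure_unitSquare_subset hb i
  have h3 := hxs i
  simp only [PiLp.add_apply, PiLp.smul_apply, smul_eq_mul] at h3
  rw [midpoint_eq_smul_add]
  simp only [PiLp.add_apply, PiLp.smul_apply, smul_eq_mul, invOf_eq_inv]
  obtain rfl : t = 1 - s := by linarith
  -- If the midpoint touched a side, both endpoints would lie on that side, and with them the point
  -- `x`, which is inside the square.
  constructor
  · by_contra! h
    have e1 : a i = 0 := by linarith
    have e2 : b i = 0 := by linarith
    simp [e1, e2] at h3
  · by_contra! h
    have e1 : a i = 1 := by linarith
    have e2 : b i = 1 := by linarith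
    simp [e1, e2] at h3

/-! ### Barycentric coordinates of two triangles -/

/-- Barycentric coordinates of `v` in terms of those of `u`. -/
theorem bary_eq_sum {u : Fin 3 → Plane} (hu : dblArea u ≠ 0) (v : Fin 3 → Plane) (i : Fin 3)
    (x : Plane) : bary v i x = ∑ l, bary u l x * bary v i (u l) := by
  have h0 := bary_sum hu x
  have h1 := bary_repr hu x 0
  have h2 := bary_repr hu x 1
  have e0 := bary_sub v i (u 0) x
  have e1 := bary_sub v i (u 1) x
  have e2 := bary_sub v i (u 2) x
  simp only [Fin.sum_univ_three, Fin.sum_univ_two] at *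
  linear_combination (-bary u 0 x) * e0 - bary u 1 x * e1 - bary u 2 x * e2 -
    (bary v i x) * h0 - baryGrad v i 0 * h1 - baryGrad v i 1 * h2 +
    (baryGrad v i 0 * x 0 + baryGrad v i 1 * x 1) * h0

theorem bary_midpoint (v : Fin 3 → Plane) (i : Fin 3) (x y : Plane) :
    bary v i (midpoint ℝ x y) = (bary v i x + bary v i y) / 2 := by
  rw [midpoint_eq_smul_add, smul_add, bary_convexComb _ _ _ _ (by norm_num)]
  simp; ring

/-- The edges of `u` and `v` opposite to their vertices `i` and `j` coincide. -/
def SameEdge (u v : Fin 3 → Plane) (i j : Fin 3) : Prop :=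
  (u (i + 1) = v (j + 1) ∧ u (i + 2) = v (j + 2)) ∨ (u (i + 1) = v (j + 2) ∧ u (i + 2) = v (j + 1))

theorem SameEdge.symm {u v : Fin 3 → Plane} {i j : Fin 3} (h : SameEdge u v i j) :
    SameEdge v u j i := by
  rcases h with ⟨h1, h2⟩ | ⟨h1, h2⟩
  · exact Or.inl ⟨h1.symm, h2.symm⟩
  · exact Or.inr ⟨h2.symm, h1.symm⟩

theorem SameEdge.trans {u v w : Fin 3 → Plane} {i j k : Fin 3} (h : SameEdge u v i j)
    (h' : SameEdge v w j k) : SameEdge u w i k := by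
  unfold SameEdge at *
  grind

theorem SameEdge.midpoint_eq {u v : Fin 3 → Plane} {i j : Fin 3} (h : SameEdge u v i j) :
    midpoint ℝ (u (i + 1)) (u (i + 2)) = midpoint ℝ (v (j + 1)) (v (j + 2)) := by
  rcases h with ⟨h1, h2⟩ | ⟨h1, h2⟩
  · rw [h1, h2]
  · rw [h1, h2, midpoint_comm]

theorem sum_fin_three_rotate {M : Type*} [AddCommMonoid M] (f : Fin 3 → M) (i : Fin 3) :
    ∑ l, f l = f i + f (i + 1) + f (i + 2) := by
  fin_cases i <;> simp [Fin.sum_univ_three]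
  · abel
  · abel

theorem fin_three_cases (i j : Fin 3) : j = i ∨ j = i + 1 ∨ j = i + 2 := by
  revert i j; decide

/-- Two affine functions vanishing on the same line are proportional; the factor is read off at the
vertex `u i`. -/
theorem SameEdge.bary_eq_mul {u v : Fin 3 → Plane} {i j : Fin 3} (h : SameEdge u v i j)
    (hu : dblArea u ≠ 0) (hv : dblArea v ≠ 0) (x : Plane) :
    bary v j x = bary u i x * bary v j (u i) := by
  have h1 : j ≠ j + 1 := (by decide : ∀ l : Fin 3, l ≠ l + 1) j
  have h2 : j ≠ j + 2 := (by decide : ∀ l : Fin 3, l ≠ l + 2) j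
  rw [bary_eq_sum hu, sum_fin_three_rotate _ i]
  rcases h with ⟨e1, e2⟩ | ⟨e1, e2⟩ <;> simp [e1, e2, bary_vertex hv, h1, h2]

theorem SameEdge.baryGrad_eq_mul {u v : Fin 3 → Plane} {i j : Fin 3} (h : SameEdge u v i j)
    (hu : dblArea u ≠ 0) (hv : dblArea v ≠ 0) (k : Fin 2) :
    baryGrad v j k = baryGrad u i k * bary v j (u i) := by
  have h1 := bary_sub v j (EuclideanSpace.single k 1) 0
  have h2 := bary_sub u i (EuclideanSpace.single k 1) 0
  rw [h.bary_eq_mul hu hv, h.bary_eq_mul hu hv 0, ← sub_mul, h2] at h1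
  fin_cases k <;> simpa [Fin.sum_univ_two] using h1.symm

/-- Up to sign, the signed double area times `∇λ_i` is the edge vector turned by a right angle,
which depends on the edge alone. -/
theorem SameEdge.abs_flux_eq {u v : Fin 3 → Plane} {i j : Fin 3} (h : SameEdge u v i j)
    (hu : dblArea u ≠ 0) (hv : dblArea v ≠ 0) (k : Fin 2) :
    |(|dblArea u| * baryGrad u i k)| = |(|dblArea v| * baryGrad v j k)| := by
  rw [abs_mul, abs_mul, abs_abs, abs_abs, ← abs_mul, ← abs_mul, baryGrad, baryGrad,
    mul_inv_cancel_left₀ hu, mul_inv_cancel_left₀ hv]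
  rcases h with ⟨e1, e2⟩ | ⟨e1, e2⟩ <;> fin_cases k <;> simp [e1, e2, abs_sub_comm]

/-! ### Combinatorics of a triangulation -/

namespace Triangulation

variable {Ω : Set Plane} (T : Triangulation Ω)

theorem dblArea_ne (K : Fin T.numCells) : dblArea (T.vertex K) ≠ 0 := dblArea_ne_zero (T.indep K)

theorem cell_subset_closure (K : Fin T.numCells) : T.cell K ⊆ closure Ω := by
  rw [← T.cover]; exact Set.subset_iUnion (fun K => convexHull ℝ (Set.range (T.vertex K))) K

theorem vertex_mem_cell (K : Fin T.numCells) (i : Fin 3) : T.vertex K i ∈ T.cell K :=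
  vertex_mem_triangle _ _

theorem exists_vertex_notMem {K L : Fin T.numCells} (h : K ≠ L) :
    ∃ i, T.vertex K i ∉ T.vertices L := by
  by_contra! hc
  apply h
  apply T.distinct
  have hcard : ∀ M, (Set.range (T.vertex M)).ncard = 3 := by
    intro M
    rw [← Set.image_univ, Set.ncard_image_of_injective _ (vertex_injective (T.dblArea_ne M))]
    simp [Set.ncard_univ]
  apply Set.eq_of_subset_of_ncard_le
  · rintro _ ⟨i, rfl⟩; exact hc i
  · rw [hcard, hcard]
  · exact Set.finite_range _

/-- How conformity is used: the intersection is the hull of the common vertices, and `λ_i` vanishes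
at every vertex of `K` except the `i`-th. -/
theorem bary_eq_zero_of_mem_inter {K L : Fin T.numCells} {i : Fin 3}
    (hi : T.vertex K i ∉ T.vertices L) {x : Plane} (hK : x ∈ T.cell K) (hL : x ∈ T.cell L) :
    bary (T.vertex K) i x = 0 := by
  have hx : x ∈ T.cell K ∩ T.cell L := ⟨hK, hL⟩
  simp only [cell, vertices] at hx
  rw [T.conforming] at hx
  exact bary_eq_zero_of_mem_convexHull (T.dblArea_ne K) Set.inter_subset_left (fun h => hi h.2) hx

/-- On an overlap some `λ_i` of `K` would vanish on an open set. Being affine it would vanish along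
the segment to the vertex `i` too, where it equals one. -/
theorem disjoint_interior {K L : Fin T.numCells} (h : K ≠ L) :
    Disjoint (interior (T.cell K)) (interior (T.cell L)) := by
  rw [Set.disjoint_left]
  intro x hxK hxL
  obtain ⟨i, hi⟩ := T.exists_vertex_notMem h
  have h0 : ∀ᶠ y in 𝓝 x, bary (T.vertex K) i y = 0 := by
    filter_upwards [isOpen_interior.mem_nhds hxK, isOpen_interior.mem_nhds hxL] with y h1 h2
    exact T.bary_eq_zero_of_mem_inter hi (interior_subset h1) (interior_subset h2)
  have ht : Tendsto (fun t : ℝ => (1 - t) • x + t • T.vertex K i) (𝓝[>] 0) (𝓝 x) := by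
    have : Continuous fun t : ℝ => (1 - t) • x + t • T.vertex K i := by fun_prop
    have h := this.tendsto 0
    simp only [sub_zero, one_smul, zero_smul, add_zero] at h
    exact h.mono_left nhdsWithin_le_nhds
  obtain ⟨t, ht0, htp⟩ := ((ht.eventually h0).and self_mem_nhdsWithin).exists
  rw [bary_convexComb _ _ _ _ (by ring), h0.self_of_nhds, bary_vertex (T.dblArea_ne K)] at ht0
  simp at ht0
  exact (ne_of_gt htp) ht0

/-- Neighbours lie on opposite sides of their common edge. Otherwise the segment from the edge
midpoint to the third vertex of `L` would run inside both cells for a short time with `λ_i > 0`,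
whereas `λ_i` vanishes on `K ∩ L`. -/
theorem bary_opposite_neg {K L : Fin T.numCells} (h : K ≠ L) {i j : Fin 3}
    (hs : SameEdge (T.vertex K) (T.vertex L) i j) : bary (T.vertex K) i (T.vertex L j) < 0 := by
  have hK := T.dblArea_ne K
  have hL := T.dblArea_ne L
  have hi : T.vertex K i ∉ T.vertices L := by
    obtain ⟨i', hi'⟩ := T.exists_vertex_notMem h
    have h1 : T.vertex K (i + 1) ∈ T.vertices L := by
      rcases hs with ⟨e1, e2⟩ | ⟨e1, e2⟩ <;> rw [e1] <;> exact ⟨_, rfl⟩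
    have h2 : T.vertex K (i + 2) ∈ T.vertices L := by
      rcases hs with ⟨e1, e2⟩ | ⟨e1, e2⟩ <;> rw [e2] <;> exact ⟨_, rfl⟩
    rcases fin_three_cases i i' with rfl | rfl | rfl
    · exact hi'
    · exact absurd h1 hi'
    · exact absurd h2 hi'
  have hne : bary (T.vertex K) i (T.vertex L j) ≠ 0 := by
    intro h0
    have := hs.symm.bary_eq_mul hL hK (T.vertex K i)
    rw [h0, bary_vertex hK] at this
    simp at this
  by_contra! hpos
  have hpos := lt_of_le_of_ne hpos hne.symm
  set m := midpoint ℝ (T.vertex K (i + 1)) (T.vertex K (i + 2)) with hm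
  have hmK : m ∈ T.cell K :=
    (convex_convexHull ℝ _).midpoint_mem (T.vertex_mem_cell K _) (T.vertex_mem_cell K _)
  have hmL : m ∈ T.cell L := by
    rw [hm, hs.midpoint_eq]
    exact (convex_convexHull ℝ _).midpoint_mem (T.vertex_mem_cell L _) (T.vertex_mem_cell L _)
  have hm0 : bary (T.vertex K) i m = 0 := T.bary_eq_zero_of_mem_inter hi hmK hmL
  have hcont : Continuous fun t : ℝ => (1 - t) • m + t • T.vertex L j := by fun_prop
  have hev : ∀ l, ∀ᶠ t in 𝓝[>] (0 : ℝ), 0 ≤ bary (T.vertex K) l ((1 - t) • m + t • T.vertex L j) := by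
    intro l
    by_cases hl : l = i
    · subst hl
      filter_upwards [self_mem_nhdsWithin] with t ht
      rw [bary_convexComb _ _ _ _ (by ring), hm0, mul_zero, zero_add]
      exact (mul_pos ht hpos).le
    · have h1 : 0 < bary (T.vertex K) l m := by
        rw [hm, bary_midpoint, bary_vertex hK, bary_vertex hK]
        rcases fin_three_cases i l with rfl | rfl | rfl
        · exact absurd rfl hl
        · simp
        · simp
      have h2 := ((continuous_bary (T.vertex K) l).comp hcont).tendsto 0
      simp only [Function.comp_apply, sub_zero, one_smul, zero_smul, add_zero] at h2
      exact ((h2.mono_left nhdsWithin_le_nhds).eventually (lt_mem_nhds h1)).mono fun t ht => ht.le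
  have hlt : ∀ᶠ t in 𝓝[>] (0 : ℝ), t < 1 :=
    nhdsWithin_le_nhds (gt_mem_nhds one_pos)
  obtain ⟨t, ⟨htK, ht1⟩, ht0⟩ := (((eventually_all.2 hev).and hlt).and self_mem_nhdsWithin).exists
  have ht0 : (0 : ℝ) < t := ht0
  have hxK : (1 - t) • m + t • T.vertex L j ∈ T.cell K := (mem_triangle_iff hK).2 htK
  have hxL : (1 - t) • m + t • T.vertex L j ∈ T.cell L :=
    (convex_convexHull ℝ _) hmL (T.vertex_mem_cell L j) (by linarith) ht0.le (by ring)
  have := T.bary_eq_zero_of_mem_inter hi hxK hxL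
  rw [bary_convexComb _ _ _ _ (by ring), hm0, mul_zero, zero_add] at this
  exact (mul_pos ht0 hpos).ne' this

/-- The outward normals of two neighbours, scaled by the edge length, are opposite: they agree up to
sign by `abs_flux_eq`, and the sign comes from `bary_opposite_neg`. -/
theorem flux_add_flux {K L : Fin T.numCells} (h : K ≠ L) {i j : Fin 3}
    (hs : SameEdge (T.vertex K) (T.vertex L) i j) (k : Fin 2) :
    |dblArea (T.vertex K)| * baryGrad (T.vertex K) i k +
      |dblArea (T.vertex L)| * baryGrad (T.vertex L) j k = 0 := by
  have hK := T.dblArea_ne K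
  have hL := T.dblArea_ne L
  have h1 := hs.abs_flux_eq hK hL k
  have h2 := hs.baryGrad_eq_mul hK hL k
  have h3 := T.bary_opposite_neg h.symm hs.symm
  -- In the case of equal signs the product of the two fluxes is a square, but it is also a
  -- nonnegative multiple of a negative number; hence both fluxes vanish.
  rcases abs_eq_abs.1 h1 with h4 | h4
  · have h5 : 0 ≤ (|dblArea (T.vertex K)| * baryGrad (T.vertex K) i k) *
        (|dblArea (T.vertex L)| * baryGrad (T.vertex L) j k) := by
      rw [← h4]; exact mul_self_nonneg _
    have h6 : (|dblArea (T.vertex K)| * baryGrad (T.vertex K) i k) *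
        (|dblArea (T.vertex L)| * baryGrad (T.vertex L) j k) =
        |dblArea (T.vertex K)| * |dblArea (T.vertex L)| * (baryGrad (T.vertex K) i k) ^ 2 *
          bary (T.vertex L) j (T.vertex K i) := by rw [h2]; ring
    have hp : 0 < |dblArea (T.vertex K)| * |dblArea (T.vertex L)| := by positivity
    have h7 : baryGrad (T.vertex K) i k ^ 2 = 0 := by
      by_contra hne
      have hsq : 0 < baryGrad (T.vertex K) i k ^ 2 := lt_of_le_of_ne (sq_nonneg _) (Ne.symm hne)
      have := mul_neg_of_pos_of_neg (mul_pos hp hsq) h3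
      linarith
    have h8 : baryGrad (T.vertex K) i k = 0 := by simpa using h7
    rw [h2, h8]; simp
  · rw [h4]; ring

/-- Two different neighbours across one edge would both lie opposite to `K`, hence on the same side
of the edge, although they must also lie opposite to each other. -/
theorem neighbour_unique {K L L' : Fin T.numCells} (h : K ≠ L) (h' : K ≠ L') {i j j' : Fin 3}
    (hs : SameEdge (T.vertex K) (T.vertex L) i j)
    (hs' : SameEdge (T.vertex K) (T.vertex L') i j') : L = L' := by
  by_contra hne
  have h1 := T.bary_opposite_neg hne (hs.symm.trans hs')
  rw [hs.bary_eq_mul (T.dblArea_ne K) (T.dblArea_ne L)] at h1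
  have h2 := T.bary_opposite_neg h' hs'
  have h3 := T.bary_opposite_neg h.symm hs.symm
  nlinarith [mul_pos_of_neg_of_neg h2 h3]

theorem sameEdge_index_unique {v u : Fin 3 → Plane} (hu : dblArea u ≠ 0) {i j j' : Fin 3}
    (hs : SameEdge v u i j) (hs' : SameEdge v u i j') : j = j' := by
  have h := hs.symm.trans hs'
  have hinj := vertex_injective hu
  rcases h with ⟨e1, e2⟩ | ⟨e1, e2⟩ <;> have e1 := hinj e1 <;> have e2 := hinj e2
  · exact add_right_cancel e1
  · exact absurd ⟨e1, e2⟩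
      ((by decide : ∀ k l : Fin 3, ¬ (k + 1 = l + 2 ∧ k + 2 = l + 1)) j j')

/-- A cell on the other side of an edge whose midpoint is an interior point. -/
theorem exists_neighbour (hΩ : IsOpen Ω) (K : Fin T.numCells) (i : Fin 3)
    (hm : midpoint ℝ (T.vertex K (i + 1)) (T.vertex K (i + 2)) ∈ Ω) :
    ∃ L j, K ≠ L ∧ SameEdge (T.vertex K) (T.vertex L) i j := by
  have hK := T.dblArea_ne K
  set m := midpoint ℝ (T.vertex K (i + 1)) (T.vertex K (i + 2)) with hmdef
  have hb0 : bary (T.vertex K) i m = 0 := by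
    rw [hmdef, bary_midpoint, bary_vertex hK, bary_vertex hK]; simp
  have hb1 : bary (T.vertex K) (i + 1) m ≠ 0 := by
    rw [hmdef, bary_midpoint, bary_vertex hK, bary_vertex hK]; simp
  have hb2 : bary (T.vertex K) (i + 2) m ≠ 0 := by
    rw [hmdef, bary_midpoint, bary_vertex hK, bary_vertex hK]; simp
  have hmK : m ∈ T.cell K :=
    (convex_convexHull ℝ _).midpoint_mem (T.vertex_mem_cell K _) (T.vertex_mem_cell K _)
  -- A ray leaving `K` through the edge midpoint `m`, directed away from the vertex `i`, so that
  -- `λ_i (γ t) = -t`.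
  let γ : ℝ → Plane := fun t => (1 + t) • m + (-t) • T.vertex K i
  have hγ : Tendsto γ (𝓝[>] 0) (𝓝 m) := by
    have : Continuous γ := by fun_prop
    have h := this.tendsto 0
    simp only [γ, add_zero, one_smul, neg_zero, zero_smul] at h
    exact h.mono_left nhdsWithin_le_nhds
  have hγK : ∀ t, bary (T.vertex K) i (γ t) = -t := by
    intro t
    simp only [γ]
    rw [bary_convexComb _ _ _ _ (by ring), hb0, bary_vertex hK]; simp
  -- Near `m` the ray is covered by finitely many cells, so one of them is met for arbitrarily small
  -- `t > 0`; being closed, it also contains `m`.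
  have hex : ∃ L, ∃ᶠ t in 𝓝[>] (0 : ℝ), γ t ∈ T.cell L := by
    by_contra! hc
    obtain ⟨t, h1, h2⟩ := ((eventually_all.2 hc).and (hγ.eventually (hΩ.mem_nhds hm))).exists
    have h3 : γ t ∈ ⋃ L, convexHull ℝ (Set.range (T.vertex L)) := by
      rw [T.cover]; exact subset_closure h2
    obtain ⟨L, hL⟩ := Set.mem_iUnion.1 h3
    exact h1 L hL
  obtain ⟨L, hL⟩ := hex
  have hmL : m ∈ T.cell L :=
    (isCompact_triangle (T.vertex L)).isClosed.mem_of_frequently_of_tendsto hL hγ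
  obtain ⟨t, htL, ht⟩ := (hL.and_eventually self_mem_nhdsWithin).exists
  have ht : (0 : ℝ) < t := ht
  have hKL : K ≠ L := by
    rintro rfl
    have := (mem_triangle_iff hK).1 htL i
    rw [hγK] at this
    linarith
  -- At `m` the coordinates of both endpoints of the edge are nonzero, so neither endpoint can be
  -- missing from `L`.
  have ha : T.vertex K (i + 1) ∈ T.vertices L := by
    by_contra h
    exact hb1 (T.bary_eq_zero_of_mem_inter h hmK hmL)
  have hb : T.vertex K (i + 2) ∈ T.vertices L := by
    by_contra h
    exact hb2 (T.bary_eq_zero_of_mem_inter h hmK hmL)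
  obtain ⟨p, hp⟩ := ha
  obtain ⟨q, hq⟩ := hb
  have hpq : p ≠ q := by
    rintro rfl
    have := vertex_injective hK (hp.symm.trans hq)
    simp at this
  have : ∃ j : Fin 3, (p = j + 1 ∧ q = j + 2) ∨ (p = j + 2 ∧ q = j + 1) := by
    have hdec : ∀ p q : Fin 3, p ≠ q →
        ∃ j : Fin 3, (p = j + 1 ∧ q = j + 2) ∨ (p = j + 2 ∧ q = j + 1) := by decide
    exact hdec p q hpq
  obtain ⟨j, ⟨rfl, rfl⟩ | ⟨rfl, rfl⟩⟩ := this
  · exact ⟨L, j, hKL, Or.inl ⟨hp.symm, hq.symm⟩⟩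
  · exact ⟨L, j, hKL, Or.inr ⟨hp.symm, hq.symm⟩⟩

end Triangulation

/-! ### Cancellation of the edge fluxes -/

theorem edgeMean_symm (a b : Plane) (p : Poly) : edgeMean a b p = edgeMean b a p := by
  simp only [edgeMean]
  have h := intervalIntegral.integral_comp_sub_left (a := 0) (b := 1)
    (fun s => polyEval p (AffineMap.lineMap a b s)) (1 : ℝ)
  simp only [sub_self, sub_zero] at h
  rw [← h]
  congr 1
  ext s
  rw [AffineMap.lineMap_apply_one_sub]

/-- The fluxes of a weakly continuous piecewise polynomial cancel across the edges. -/
theorem sum_flux_eq_zero {Ω : Set Plane} (hΩ : IsOpen Ω) (T : Triangulation Ω)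
    (P : T.PiecewisePoly) (φ : Plane → ℝ) (k : Fin 2)
    (hP : ∀ K L, ∀ a ∈ T.vertices K ∩ T.vertices L, ∀ b ∈ T.vertices K ∩ T.vertices L, a ≠ b →
      edgeMean a b (P K) = edgeMean a b (P L))
    (hbd : ∀ K i, midpoint ℝ (T.vertex K (i + 1)) (T.vertex K (i + 2)) ∉ Ω →
      φ (midpoint ℝ (T.vertex K (i + 1)) (T.vertex K (i + 2))) *
        edgeMean (T.vertex K (i + 1)) (T.vertex K (i + 2)) (P K) = 0) :
    ∑ K, ∑ i, φ (midpoint ℝ (T.vertex K (i + 1)) (T.vertex K (i + 2))) *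
      (|dblArea (T.vertex K)| * baryGrad (T.vertex K) i k) *
        edgeMean (T.vertex K (i + 1)) (T.vertex K (i + 2)) (P K) = 0 := by
  classical
  rw [← Fintype.sum_prod_type']
  -- Pairs of a cell and an edge whose midpoint is interior; the other pairs contribute zero by
  -- `hbd`.
  let S : Finset (Fin T.numCells × Fin 3) := Finset.univ.filter fun e =>
    midpoint ℝ (T.vertex e.1 (e.2 + 1)) (T.vertex e.1 (e.2 + 2)) ∈ Ω
  rw [← Finset.sum_subset (Finset.subset_univ S)]
  swap
  · intro e _ he
    have := hbd e.1 e.2 (by simpa [S] using he)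
    calc _ = (|dblArea (T.vertex e.1)| * baryGrad (T.vertex e.1) e.2 k) *
          (φ (midpoint ℝ (T.vertex e.1 (e.2 + 1)) (T.vertex e.1 (e.2 + 2))) *
            edgeMean (T.vertex e.1 (e.2 + 1)) (T.vertex e.1 (e.2 + 2)) (P e.1)) := by ring
      _ = 0 := by rw [this, mul_zero]
  have hex : ∀ e ∈ S, ∃ e' : Fin T.numCells × Fin 3, e.1 ≠ e'.1 ∧
      SameEdge (T.vertex e.1) (T.vertex e'.1) e.2 e'.2 := by
    intro e he
    obtain ⟨L, j, h1, h2⟩ := T.exists_neighbour hΩ e.1 e.2 (by simpa [S] using he)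
    exact ⟨(L, j), h1, h2⟩
  choose g hg1 hg2 using hex
  have hgS : ∀ e he, g e he ∈ S := by
    intro e he
    have := (hg2 e he).midpoint_eq
    simp only [S, Finset.mem_filter, Finset.mem_univ, true_and] at he ⊢
    rwa [← this]
  -- The involution sends an edge seen from one cell to the same edge seen from the neighbour. Mean
  -- and midpoint agree there and the normals are opposite.
  refine Finset.sum_involution g ?_ ?_ hgS ?_
  · intro e he
    have hs := hg2 e he
    have hf := T.flux_add_flux (hg1 e he) hs k
    have hmean : edgeMean (T.vertex (g e he).1 ((g e he).2 + 1))
        (T.vertex (g e he).1 ((g e he).2 + 2)) (P (g e he).1) =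
        edgeMean (T.vertex e.1 (e.2 + 1)) (T.vertex e.1 (e.2 + 2)) (P e.1) := by
      have hne : T.vertex e.1 (e.2 + 1) ≠ T.vertex e.1 (e.2 + 2) := by
        intro h
        have := vertex_injective (T.dblArea_ne _) h
        simp at this
      rcases hs with ⟨e1, e2⟩ | ⟨e1, e2⟩
      · rw [← e1, ← e2]
        exact (hP _ _ _ ⟨⟨_, rfl⟩, ⟨_, e1.symm⟩⟩ _ ⟨⟨_, rfl⟩, ⟨_, e2.symm⟩⟩ hne).symm
      · rw [← e1, ← e2, edgeMean_symm]
        exact (hP _ _ _ ⟨⟨_, rfl⟩, ⟨_, e1.symm⟩⟩ _ ⟨⟨_, rfl⟩, ⟨_, e2.symm⟩⟩ hne).symm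
    rw [hmean, ← hs.midpoint_eq, ← add_mul, ← mul_add, hf]
    ring
  · intro e he _ h
    exact hg1 e he (congrArg Prod.fst h).symm
  · intro e he
    have h1 := hg1 e he
    have h2 := hg1 _ (hgS e he)
    have s1 := (hg2 e he).symm
    have s2 := hg2 _ (hgS e he)
    have hc := T.neighbour_unique h2 h1.symm s2 s1
    refine Prod.ext hc ?_
    rw [hc] at s2
    exact Triangulation.sameEdge_index_unique (T.dblArea_ne _) s2 s1

/-! ### Integration over a triangle in polar form about a vertex -/

theorem integral_unitSquare (H : Plane → ℝ) (hH : Continuous H) :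
    ∫ z in unitSquare, H z = ∫ s in (0 : ℝ)..1, ∫ t in (0 : ℝ)..1, H !₂[s, t] := by
  let e : ℝ × ℝ ≃ᵐ Plane :=
    MeasurableEquiv.finTwoArrow.symm.trans (MeasurableEquiv.toLp 2 (Fin 2 → ℝ))
  have he : MeasurePreserving e :=
    (PiLp.volume_preserving_toLp (Fin 2)).comp ((volume_preserving_finTwoArrow ℝ).symm _)
  have hev : ∀ z, e z = !₂[z.1, z.2] := fun z => rfl
  have hpre : e ⁻¹' unitSquare = Set.Ioo 0 1 ×ˢ Set.Ioo 0 1 := by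
    ext z
    simp only [Set.mem_preimage, hev, unitSquare, Set.mem_ofPred_eq, Fin.forall_fin_two, Set.mem_prod,
      Set.mem_Ioo]
    rfl
  rw [← he.setIntegral_preimage_emb e.measurableEmbedding, hpre]
  have hc : Continuous fun z : ℝ × ℝ => H (e z) := by
    simp only [hev]
    refine hH.comp ((PiLp.continuous_toLp 2 _).comp (continuous_pi fun i => ?_))
    fin_cases i
    · exact continuous_fst
    · exact continuous_snd
  rw [Measure.volume_eq_prod, setIntegral_prod]
  · rw [intervalIntegral.integral_of_le zero_le_one, ← integral_Ioc_eq_integral_Ioo]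
    congr 1
    ext s
    rw [intervalIntegral.integral_of_le zero_le_one, ← integral_Ioc_eq_integral_Ioo]
    rfl
  · refine (hc.continuousOn.integrableOn_compact (isCompact_Icc.prod isCompact_Icc)).mono_set
      (Set.prod_mono Set.Ioo_subset_Icc_self Set.Ioo_subset_Icc_self)

theorem interior_triangle {v : Fin 3 → Plane} (hD : dblArea v ≠ 0) :
    interior (convexHull ℝ (Set.range v)) = {x | ∀ i, 0 < bary v i x} := by
  refine Set.Subset.antisymm (fun x hx i => ?_) (subset_interior_triangle hD)
  have h0 := (mem_triangle_iff hD).1 (interior_subset hx) i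
  refine lt_of_le_of_ne h0 fun h => ?_
  have ht : Tendsto (fun t : ℝ => (1 + t) • x + (-t) • v i) (𝓝[>] 0) (𝓝 x) := by
    have : Continuous fun t : ℝ => (1 + t) • x + (-t) • v i := by fun_prop
    have h := this.tendsto 0
    simp only [add_zero, one_smul, neg_zero, zero_smul] at h
    exact h.mono_left nhdsWithin_le_nhds
  obtain ⟨t, h1, h2⟩ := ((ht.eventually (isOpen_interior.mem_nhds hx)).and
    self_mem_nhdsWithin).exists
  have h3 := (mem_triangle_iff hD).1 (interior_subset h1) i
  rw [bary_convexComb _ _ _ _ (by ring), ← h, bary_vertex hD] at h3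
  simp at h3
  exact absurd (show (0 : ℝ) < t from h2) (not_lt.2 h3)

theorem interior_triangle_ae_eq (v : Fin 3 → Plane) :
    interior (convexHull ℝ (Set.range v)) =ᵐ[volume] convexHull ℝ (Set.range v) :=
  interior_ae_eq_of_null_frontier ((convex_convexHull ℝ _).addHaar_frontier volume)

/-- The map of the unit square onto a triangle which collapses one side to the vertex `v j`. -/
def collapse (v : Fin 3 → Plane) (j : Fin 3) (z : Plane) : Plane :=
  v j + z 1 • (v (j + 1) - v j) + (z 1 * z 0) • (v (j + 2) - v (j + 1))

theorem collapse_eq (v : Fin 3 → Plane) (j : Fin 3) (z : Plane) :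
    collapse v j z = (1 - z 1) • v j + z 1 • ((1 - z 0) • v (j + 1) + z 0 • v (j + 2)) := by
  unfold collapse; module

theorem bary_collapse {v : Fin 3 → Plane} (hD : dblArea v ≠ 0) (j : Fin 3) (z : Plane) :
    bary v j (collapse v j z) = 1 - z 1 ∧ bary v (j + 1) (collapse v j z) = z 1 * (1 - z 0) ∧
      bary v (j + 2) (collapse v j z) = z 1 * z 0 := by
  have h3 : j + 1 ≠ j + 2 := (by decide : ∀ l : Fin 3, l + 1 ≠ l + 2) j
  have h4 : j + 2 ≠ j + 1 := h3.symm
  simp only [collapse_eq]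
  refine ⟨?_, ?_, ?_⟩ <;>
    rw [bary_convexComb _ _ _ _ (by ring), bary_convexComb _ _ _ _ (by ring)] <;>
    simp [bary_vertex hD]

/-- The derivative of `collapse`. -/
def collapseD (v : Fin 3 → Plane) (j : Fin 3) (z : Plane) : Plane →L[ℝ] Plane :=
  (EuclideanSpace.proj 1 : Plane →L[ℝ] ℝ).smulRight (v (j + 1) - v j) +
    (z 1 • (EuclideanSpace.proj 0 : Plane →L[ℝ] ℝ) +
      z 0 • (EuclideanSpace.proj 1 : Plane →L[ℝ] ℝ)).smulRight (v (j + 2) - v (j + 1))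

theorem hasFDerivAt_collapse (v : Fin 3 → Plane) (j : Fin 3) (z : Plane) :
    HasFDerivAt (collapse v j) (collapseD v j z) z := by
  have h1 := ((EuclideanSpace.proj 1 : Plane →L[ℝ] ℝ).hasFDerivAt (x := z))
  have h0 := ((EuclideanSpace.proj 0 : Plane →L[ℝ] ℝ).hasFDerivAt (x := z))
  exact (((hasFDerivAt_const (v j) z).add (h1.smul_const (v (j + 1) - v j))).add
    ((h1.mul h0).smul_const (v (j + 2) - v (j + 1)))).congr_fderiv (by
      ext w; simp [collapseD])

theorem det_collapseD (v : Fin 3 → Plane) (j : Fin 3) (z : Plane) :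
    (collapseD v j z).det = -(z 1 * dblArea v) := by
  rw [ContinuousLinearMap.det, ← LinearMap.det_toMatrix (EuclideanSpace.basisFun (Fin 2) ℝ).toBasis,
    Matrix.det_fin_two, ← dblArea_rotate v j]
  simp [LinearMap.toMatrix_apply, collapseD]
  ring

theorem collapse_image {v : Fin 3 → Plane} (hD : dblArea v ≠ 0) (j : Fin 3) :
    collapse v j '' unitSquare = interior (convexHull ℝ (Set.range v)) := by
  rw [interior_triangle hD]
  ext x
  constructor
  · rintro ⟨z, hz, rfl⟩ i
    obtain ⟨h0, h1, h2⟩ := bary_collapse hD j z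
    have z0 := hz 0
    have z1 := hz 1
    have : 0 < 1 - z 0 := by linarith
    rcases fin_three_cases j i with rfl | rfl | rfl
    · rw [h0]; linarith
    · rw [h1]; exact mul_pos z1.1 this
    · rw [h2]; exact mul_pos z1.1 z0.1
  · intro hx
    have hs := bary_sum hD x
    have hr := bary_repr' hD x
    rw [sum_fin_three_rotate _ j] at hs hr
    have p0 := hx j
    have p1 := hx (j + 1)
    have p2 := hx (j + 2)
    have ht : 0 < 1 - bary v j x := by linarith
    -- The radial coordinate is `1 - λ_j`, and the position along the opposite edge is `λ_{j+2}`
    -- divided by it.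
    refine ⟨!₂[bary v (j + 2) x / (1 - bary v j x), 1 - bary v j x], ?_, ?_⟩
    · have q0 : 0 < bary v (j + 2) x / (1 - bary v j x) := div_pos p2 ht
      have q1 : bary v (j + 2) x / (1 - bary v j x) < 1 := by rw [div_lt_one ht]; linarith
      exact Fin.forall_fin_two.2 ⟨⟨q0, q1⟩, ⟨ht, sub_lt_self 1 p0⟩⟩
    · conv_rhs => rw [← hr]
      rw [collapse]
      simp only [Matrix.cons_val_zero, Matrix.cons_val_one,
        mul_div_cancel₀ _ ht.ne']
      have e : bary v (j + 1) x = 1 - bary v j x - bary v (j + 2) x := by linarith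
      rw [e]; module

theorem collapse_injOn {v : Fin 3 → Plane} (hD : dblArea v ≠ 0) (j : Fin 3) :
    Set.InjOn (collapse v j) unitSquare := by
  intro z hz w hw h
  obtain ⟨h0, -, h2⟩ := bary_collapse hD j z
  obtain ⟨k0, -, k2⟩ := bary_collapse hD j w
  rw [h] at h0 h2
  have e1 : z 1 = w 1 := by linarith
  have e0 : z 0 = w 0 := by
    have := h2.symm.trans k2
    rw [e1] at this
    exact mul_left_cancel₀ (hw 1).1.ne' this
  ext i; fin_cases i
  · exact e0
  · exact e1

/-- The divergence theorem on a triangle for the field `p (x - v j)`, whose flux is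
concentrated on the edge opposite to `v j`. -/
theorem integral_triangle_radial {v : Fin 3 → Plane} (hD : dblArea v ≠ 0) (j : Fin 3) (p : Poly) :
    ∫ x in convexHull ℝ (Set.range v),
      (∑ i, polyEval (MvPolynomial.pderiv i p) x * (x i - v j i) + 2 * polyEval p x) =
      |dblArea v| * edgeMean (v (j + 1)) (v (j + 2)) p := by
  rw [← setIntegral_congr_set (interior_triangle_ae_eq v), ← collapse_image hD j,
    integral_image_eq_integral_abs_det_fderiv_smul volume isOpen_unitSquare.measurableSet
      (fun z _ => (hasFDerivAt_collapse v j z).hasFDerivWithinAt) (collapse_injOn hD j)]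
  have hcol : Continuous (collapse v j) :=
    continuous_iff_continuousAt.2 fun z => (hasFDerivAt_collapse v j z).continuousAt
  let H : Plane → ℝ := fun z => z 1 * |dblArea v| *
    (∑ i, polyEval (MvPolynomial.pderiv i p) (collapse v j z) * (collapse v j z i - v j i) +
      2 * polyEval p (collapse v j z))
  have hH : Continuous H := by
    have hq : ∀ q : Poly, Continuous fun z => polyEval q (collapse v j z) :=
      fun q => (continuous_polyEval q).comp hcol
    have hk : ∀ i, Continuous fun z => collapse v j z i := fun i =>
      (EuclideanSpace.proj i : Plane →L[ℝ] ℝ).continuous.comp hcol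
    have h1 : Continuous fun z : Plane => z 1 :=
      (EuclideanSpace.proj (1 : Fin 2) : Plane →L[ℝ] ℝ).continuous
    refine (h1.mul continuous_const).mul ((continuous_finsetSum _ fun i _ => ?_).add
      (continuous_const.mul (hq p)))
    exact (hq _).mul ((hk i).sub continuous_const)
  have hcongr : ∫ z in unitSquare, |(collapseD v j z).det| •
      (∑ i, polyEval (MvPolynomial.pderiv i p) (collapse v j z) * (collapse v j z i - v j i) +
        2 * polyEval p (collapse v j z)) = ∫ z in unitSquare, H z := by
    refine setIntegral_congr_fun isOpen_unitSquare.measurableSet fun z hz => ?_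
    simp only [H, det_collapseD, abs_neg, abs_mul, abs_of_pos (hz 1).1, smul_eq_mul]
  rw [hcongr, integral_unitSquare H hH, edgeMean, ← intervalIntegral.integral_const_mul]
  congr 1
  ext s
  have hpath : ∀ t : ℝ, collapse v j !₂[s, t] =
      v j + t • (AffineMap.lineMap (v (j + 1)) (v (j + 2)) s - v j) := by
    intro t
    rw [AffineMap.lineMap_apply_module, collapse_eq]
    simp only [Matrix.cons_val_zero, Matrix.cons_val_one]
    module
  set y : Plane := AffineMap.lineMap (v (j + 1)) (v (j + 2)) s with hy
  -- With the Jacobian factor `t`, the integrand on the ray from `v j` to the edge point `y` is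
  -- exactly the derivative of `t² p`. Only the value at `t = 1`, on the edge, survives.
  have hderiv : ∀ t : ℝ, HasDerivAt
      (fun t : ℝ => |dblArea v| * (t ^ 2 * polyEval p (v j + t • (y - v j)))) (H !₂[s, t]) t := by
    intro t
    have h1 : HasDerivAt (fun t : ℝ => v j + t • (y - v j)) (y - v j) t := by
      simpa using ((hasDerivAt_id t).smul_const (y - v j)).const_add (v j)
    have h2 := (hasFDerivAt_polyEval p (v j + t • (y - v j))).comp_hasDerivAt t h1
    have h3 := ((((hasDerivAt_id t).pow 2).mul h2).const_mul |dblArea v|)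
    refine h3.congr_deriv ?_
    simp only [H, hpath]
    simp [Fin.sum_univ_two]
    ring
  have hHs : Continuous fun t : ℝ => H !₂[s, t] := by
    refine hH.comp ((PiLp.continuous_toLp 2 _).comp (continuous_pi fun i => ?_))
    fin_cases i
    · exact continuous_const
    · exact continuous_id
  rw [intervalIntegral.integral_eq_sub_of_hasDerivAt (fun t _ => hderiv t)
    (hHs.intervalIntegrable _ _)]
  simp

/-! ### Weak continuity of the derivatives of finite element functions -/

theorem edgeMean_intervalIntegrable (a b : Plane) (p : Poly) :
    IntervalIntegrable (fun s : ℝ => polyEval p (AffineMap.lineMap a b s)) volume 0 1 :=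
  ((continuous_polyEval p).comp AffineMap.lineMap_continuous).intervalIntegrable _ _

theorem edgeMean_add (a b : Plane) (p q : Poly) :
    edgeMean a b (p + q) = edgeMean a b p + edgeMean a b q := by
  simp only [edgeMean, polyEval_add]
  exact intervalIntegral.integral_add (edgeMean_intervalIntegrable a b p)
    (edgeMean_intervalIntegrable a b q)

theorem edgeMean_C_mul (a b : Plane) (c : ℝ) (p : Poly) :
    edgeMean a b (MvPolynomial.C c * p) = c * edgeMean a b p := by
  simp [edgeMean]

theorem edgeMean_sub (a b : Plane) (p q : Poly) :
    edgeMean a b (p - q) = edgeMean a b p - edgeMean a b q := by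
  simp only [edgeMean, polyEval_sub]
  exact intervalIntegral.integral_sub (edgeMean_intervalIntegrable a b p)
    (edgeMean_intervalIntegrable a b q)

theorem dirD_eq (ν : Plane) (p : Poly) : dirD ν p =
    MvPolynomial.C (ν 0) * MvPolynomial.pderiv 0 p +
      MvPolynomial.C (ν 1) * MvPolynomial.pderiv 1 p := by
  simp [dirD, Fin.sum_univ_two]

theorem edgeMean_dirD (a b ν : Plane) (p : Poly) : edgeMean a b (dirD ν p) =
    ν 0 * edgeMean a b (MvPolynomial.pderiv 0 p) +
      ν 1 * edgeMean a b (MvPolynomial.pderiv 1 p) := by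
  rw [dirD_eq, edgeMean_add, edgeMean_C_mul, edgeMean_C_mul]

theorem dirD_add (ν : Plane) (p q : Poly) : dirD ν (p + q) = dirD ν p + dirD ν q := by
  simp only [dirD_eq, map_add]; ring

theorem dirD_sub (ν : Plane) (p q : Poly) : dirD ν (p - q) = dirD ν p - dirD ν q := by
  simp only [dirD_eq, map_sub]; ring

theorem dirD_C_mul (ν : Plane) (c : ℝ) (p : Poly) :
    dirD ν (MvPolynomial.C c * p) = MvPolynomial.C c * dirD ν p := by
  simp only [dirD_eq, MvPolynomial.pderiv_C_mul]; ring

theorem edgeNormal_sub (a b : Plane) (p q : Poly) :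
    edgeNormal a b (p - q) = edgeNormal a b p - edgeNormal a b q := by
  rw [edgeNormal, dirD_sub, edgeMean_sub]; rfl

theorem edgeNormalTwo_sub (a b : Plane) (p q : Poly) :
    edgeNormalTwo a b (p - q) = edgeNormalTwo a b p - edgeNormalTwo a b q := by
  rw [edgeNormalTwo, dirD_sub, dirD_sub, edgeMean_sub]; rfl

theorem edgeNormal_add (a b : Plane) (p q : Poly) :
    edgeNormal a b (p + q) = edgeNormal a b p + edgeNormal a b q := by
  rw [edgeNormal, dirD_add, edgeMean_add]; rfl

theorem edgeNormalTwo_add (a b : Plane) (p q : Poly) :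
    edgeNormalTwo a b (p + q) = edgeNormalTwo a b p + edgeNormalTwo a b q := by
  rw [edgeNormalTwo, dirD_add, dirD_add, edgeMean_add]; rfl

theorem hasDerivAt_polyEval_lineMap (a b : Plane) (p : Poly) (s : ℝ) :
    HasDerivAt (fun s : ℝ => polyEval p (AffineMap.lineMap a b s))
      ((b 0 - a 0) * polyEval (MvPolynomial.pderiv 0 p) (AffineMap.lineMap a b s) +
        (b 1 - a 1) * polyEval (MvPolynomial.pderiv 1 p) (AffineMap.lineMap a b s)) s := by
  have h1 : HasDerivAt (fun s : ℝ => (AffineMap.lineMap a b s : Plane)) (b - a) s :=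
    AffineMap.hasDerivAt_lineMap
  refine ((hasFDerivAt_polyEval p (AffineMap.lineMap a b s)).comp_hasDerivAt s h1).congr_deriv ?_
  simp [Fin.sum_univ_two]
  ring

/-- The fundamental theorem of calculus along the edge: vertex values alone fix the mean of a
tangential derivative. -/
theorem edgeMean_tangential (a b : Plane) (p : Poly) :
    (b 0 - a 0) * edgeMean a b (MvPolynomial.pderiv 0 p) +
      (b 1 - a 1) * edgeMean a b (MvPolynomial.pderiv 1 p) = polyEval p b - polyEval p a := by
  rw [← edgeMean_C_mul, ← edgeMean_C_mul, ← edgeMean_add, edgeMean]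
  simp only [polyEval_add, polyEval_mul, polyEval_C]
  rw [intervalIntegral.integral_eq_sub_of_hasDerivAt
    (fun s _ => hasDerivAt_polyEval_lineMap a b p s)]
  · simp
  · have h : ∀ q : Poly, Continuous fun s : ℝ => polyEval q (AffineMap.lineMap a b s) := fun q =>
      (continuous_polyEval q).comp AffineMap.lineMap_continuous
    exact ((continuous_const.mul (h _)).add (continuous_const.mul (h _))).intervalIntegrable _ _

/-- The restriction of `p` to the segment from `a` to `b` is a cubic polynomial. -/
def CubicOn (a b : Plane) (p : Poly) : Prop :=
  ∃ r : Polynomial ℝ, r.natDegree ≤ 3 ∧ ∀ s, polyEval p (AffineMap.lineMap a b s) = r.eval s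

theorem CubicOn.add {a b : Plane} {p q : Poly} (hp : CubicOn a b p) (hq : CubicOn a b q) :
    CubicOn a b (p + q) := by
  obtain ⟨r, hr, h⟩ := hp
  obtain ⟨r', hr', h'⟩ := hq
  exact ⟨r + r', Polynomial.natDegree_add_le_of_degree_le hr hr', fun s => by simp [h, h']⟩

theorem CubicOn.sub {a b : Plane} {p q : Poly} (hp : CubicOn a b p) (hq : CubicOn a b q) :
    CubicOn a b (p - q) := by
  obtain ⟨r, hr, h⟩ := hp
  obtain ⟨r', hr', h'⟩ := hq
  exact ⟨r - r', (Polynomial.natDegree_sub_le _ _).trans (max_le hr hr'), fun s => by simp [h, h']⟩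

theorem cubicOn_of_totalDegree_le (a b : Plane) {p : Poly} (hp : p.totalDegree ≤ 3) :
    CubicOn a b p := by
  let f : Fin 2 → Polynomial ℝ := fun i => Polynomial.C (b i - a i) * Polynomial.X +
    Polynomial.C (a i)
  refine ⟨MvPolynomial.aeval f p, ?_, fun s => ?_⟩
  · have := MvPolynomial.aeval_natDegree_le p hp f (fun i => Polynomial.natDegree_linear_le (R := ℝ))
    simpa using this
  · rw [polyEval, ← Polynomial.coe_evalRingHom, MvPolynomial.aeval_def, MvPolynomial.eval₂_comp_left,
      MvPolynomial.eval]
    have h1 : (Polynomial.evalRingHom s).comp (algebraMap ℝ (Polynomial ℝ)) = RingHom.id ℝ := by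
      ext x; simp
    have h2 : (Polynomial.evalRingHom s : Polynomial ℝ → ℝ) ∘ f =
        fun i => (AffineMap.lineMap a b s : Plane) i := by
      funext i
      simp [f, AffineMap.lineMap_apply_module]
      ring
    rw [h1, h2]
    rfl

theorem cubicOn_of_eq_zero {a b : Plane} {p : Poly}
    (hp : ∀ s : ℝ, polyEval p (AffineMap.lineMap a b s) = 0) : CubicOn a b p :=
  ⟨0, by simp, fun s => by simp [hp s]⟩

theorem bubble_eval (v : Fin 3 → Plane) (x : Plane) : polyEval (bubble v) x = ∏ i, bary v i x := by
  simp [bubble, polyEval, bary]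

theorem bubble_lineMap {v : Fin 3 → Plane} (hD : dblArea v ≠ 0) (i j : Fin 3) (s : ℝ) :
    polyEval (bubble v) (AffineMap.lineMap (v i) (v j) s) = 0 := by
  obtain ⟨k, hki, hkj⟩ : ∃ k : Fin 3, k ≠ i ∧ k ≠ j :=
    (by decide : ∀ i j : Fin 3, ∃ k : Fin 3, k ≠ i ∧ k ≠ j) i j
  rw [bubble_eval]
  refine Finset.prod_eq_zero (Finset.mem_univ k) ?_
  rw [bary_lineMap, bary_vertex hD, bary_vertex hD, if_neg hki, if_neg hkj]
  ring

theorem mem_shapeSpace {v : Fin 3 → Plane} {p : Poly} : p ∈ shapeSpace v ↔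
    ∃ p₀ p₁ p₂ : Poly, p₀.totalDegree ≤ 3 ∧ p₁.totalDegree ≤ 1 ∧ p₂.totalDegree ≤ 1 ∧
      p = p₀ + bubble v * p₁ + bubble v ^ 2 * p₂ := by
  simp only [shapeSpace, Submodule.mem_sup, Submodule.mem_map, LinearMap.mulLeft_apply,
    MvPolynomial.mem_restrictTotalDegree]
  constructor
  · rintro ⟨_, ⟨p₀, h0, _, ⟨p₁, h1, rfl⟩, rfl⟩, _, ⟨p₂, h2, rfl⟩, rfl⟩
    exact ⟨p₀, p₁, p₂, h0, h1, h2, rfl⟩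
  · rintro ⟨p₀, p₁, p₂, h0, h1, h2, rfl⟩
    exact ⟨_, ⟨p₀, h0, _, ⟨p₁, h1, rfl⟩, rfl⟩, _, ⟨p₂, h2, rfl⟩, rfl⟩

/-- The bubble vanishes on every edge, so only the `P₃` part is seen there. -/
theorem cubicOn_of_mem_shapeSpace {v : Fin 3 → Plane} (hD : dblArea v ≠ 0) {p : Poly}
    (hp : p ∈ shapeSpace v) {a b : Plane} (ha : a ∈ Set.range v) (hb : b ∈ Set.range v) :
    CubicOn a b p := by
  obtain ⟨p₀, p₁, p₂, h0, -, -, rfl⟩ := mem_shapeSpace.1 hp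
  obtain ⟨i, rfl⟩ := ha
  obtain ⟨j, rfl⟩ := hb
  refine ((cubicOn_of_totalDegree_le _ _ h0).add (cubicOn_of_eq_zero fun s => ?_)).add
    (cubicOn_of_eq_zero fun s => ?_) <;> simp [bubble_lineMap hD]

/-- Vanishing degrees of freedom on an edge annihilate the means of all derivatives of order at
most two. -/
theorem edgeMean_polyD_eq_zero {a b : Plane} (hab : a ≠ b) {p : Poly} (hc : CubicOn a b p)
    (ha : polyEval p a = 0 ∧ ∀ i, polyEval (MvPolynomial.pderiv i p) a = 0)
    (hb : polyEval p b = 0 ∧ ∀ i, polyEval (MvPolynomial.pderiv i p) b = 0)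
    (hn : edgeNormal a b p = 0) (hn2 : edgeNormalTwo a b p = 0)
    {β : MultiIndex} (hβ : order β ≤ 2) : edgeMean a b (polyD β p) = 0 := by
  have hd : dist a b ≠ 0 := dist_ne_zero.2 hab
  have hN : (b 0 - a 0) ^ 2 + (b 1 - a 1) ^ 2 ≠ 0 := by
    intro h
    apply hab
    have h0 : b 0 - a 0 = 0 := by nlinarith [sq_nonneg (b 0 - a 0), sq_nonneg (b 1 - a 1)]
    have h1 : b 1 - a 1 = 0 := by nlinarith [sq_nonneg (b 0 - a 0), sq_nonneg (b 1 - a 1)]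
    ext i; fin_cases i
    · simpa using (sub_eq_zero.1 h0).symm
    · simpa using (sub_eq_zero.1 h1).symm
  have hν0 : unitNormal a b 0 = (dist a b)⁻¹ * (b 1 - a 1) := by simp [unitNormal]
  have hν1 : unitNormal a b 1 = (dist a b)⁻¹ * -(b 0 - a 0) := by simp [unitNormal]
  -- A cubic in one variable with zero value and zero slope at both ends is identically zero.
  have hzero : edgeMean a b p = 0 := by
    obtain ⟨r, hr, h⟩ := hc
    have hr4 : ∀ s : ℝ, r.eval s =
        r.coeff 0 + r.coeff 1 * s + r.coeff 2 * s ^ 2 + r.coeff 3 * s ^ 3 := by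
      intro s
      rw [Polynomial.eval_eq_sum_range' (n := 4) (by omega)]
      simp [Finset.sum_range_succ]
    have hder : ∀ s : ℝ, HasDerivAt (fun s => r.eval s)
        (r.coeff 1 + 2 * r.coeff 2 * s + 3 * r.coeff 3 * s ^ 2) s := by
      intro s
      simp only [hr4]
      refine (((((hasDerivAt_id s).const_mul (r.coeff 1)).const_add (r.coeff 0)).add
        (((hasDerivAt_id s).pow 2).const_mul (r.coeff 2))).add
        (((hasDerivAt_id s).pow 3).const_mul (r.coeff 3))).congr_deriv ?_
      simp; ring
    have hfun : (fun s : ℝ => polyEval p (AffineMap.lineMap a b s)) = fun s => r.eval s := funext h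
    have d0 := (hasDerivAt_polyEval_lineMap a b p 0)
    have d1 := (hasDerivAt_polyEval_lineMap a b p 1)
    rw [hfun] at d0 d1
    have e0 := d0.unique (hder 0)
    have e1 := d1.unique (hder 1)
    have f0 := h 0
    have f1 := h 1
    simp only [AffineMap.lineMap_apply_zero, AffineMap.lineMap_apply_one, ha.2, hb.2, ha.1, hb.1,
      hr4] at e0 e1 f0 f1
    have c0 : r.coeff 0 = 0 := by linarith
    have c1 : r.coeff 1 = 0 := by linarith
    have c3 : r.coeff 3 = 0 := by linarith
    have c2 : r.coeff 2 = 0 := by linarith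
    simp [edgeMean, h, hr4, c0, c1, c2, c3]
  -- With `d = b - a`, the first-order means solve a 2×2 system made of the tangential and the
  -- normal equation, of determinant `±|d|²`. The second-order means solve a 3×3 system, made of the
  -- tangential derivatives of the two components of the gradient and the second normal mean, of
  -- determinant `|d|⁴`.
  have t1 := edgeMean_tangential a b p
  rw [ha.1, hb.1] at t1
  have t2 : ∀ i, (b 0 - a 0) * edgeMean a b (MvPolynomial.pderiv 0 (MvPolynomial.pderiv i p)) +
      (b 1 - a 1) * edgeMean a b (MvPolynomial.pderiv 1 (MvPolynomial.pderiv i p)) = 0 := by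
    intro i
    rw [edgeMean_tangential, ha.2, hb.2, sub_zero]
  have n1 : (b 1 - a 1) * edgeMean a b (MvPolynomial.pderiv 0 p) -
      (b 0 - a 0) * edgeMean a b (MvPolynomial.pderiv 1 p) = 0 := by
    rw [edgeNormal, edgeMean_dirD, hν0, hν1] at hn
    have : (dist a b)⁻¹ * ((b 1 - a 1) * edgeMean a b (MvPolynomial.pderiv 0 p) -
      (b 0 - a 0) * edgeMean a b (MvPolynomial.pderiv 1 p)) = 0 := by linarith
    exact (mul_eq_zero.1 this).resolve_left (inv_ne_zero hd)
  have n2 : (b 1 - a 1) ^ 2 * edgeMean a b (MvPolynomial.pderiv 0 (MvPolynomial.pderiv 0 p)) -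
      2 * (b 0 - a 0) * (b 1 - a 1) *
        edgeMean a b (MvPolynomial.pderiv 0 (MvPolynomial.pderiv 1 p)) +
      (b 0 - a 0) ^ 2 * edgeMean a b (MvPolynomial.pderiv 1 (MvPolynomial.pderiv 1 p)) = 0 := by
    rw [edgeNormalTwo, edgeMean_dirD, dirD_eq] at hn2
    simp only [map_add, MvPolynomial.pderiv_C_mul, edgeMean_add, edgeMean_C_mul, hν0, hν1,
      pderiv_comm 1 0] at hn2
    have : ((dist a b)⁻¹) ^ 2 *
        ((b 1 - a 1) ^ 2 * edgeMean a b (MvPolynomial.pderiv 0 (MvPolynomial.pderiv 0 p)) -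
      2 * (b 0 - a 0) * (b 1 - a 1) *
        edgeMean a b (MvPolynomial.pderiv 0 (MvPolynomial.pderiv 1 p)) +
      (b 0 - a 0) ^ 2 * edgeMean a b (MvPolynomial.pderiv 1 (MvPolynomial.pderiv 1 p))) = 0 := by
      linear_combination hn2
    exact (mul_eq_zero.1 this).resolve_left (pow_ne_zero _ (inv_ne_zero hd))
  have t20 := t2 0
  have t21 := t2 1
  rw [pderiv_comm 1 0] at t20
  set d0 := b 0 - a 0
  set d1 := b 1 - a 1
  have E0 : edgeMean a b (MvPolynomial.pderiv 0 p) = 0 := by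
    refine (mul_eq_zero.1 (?_ : (d0 ^ 2 + d1 ^ 2) * _ = 0)).resolve_left hN
    linear_combination d0 * t1 + d1 * n1
  have E1 : edgeMean a b (MvPolynomial.pderiv 1 p) = 0 := by
    refine (mul_eq_zero.1 (?_ : (d0 ^ 2 + d1 ^ 2) * _ = 0)).resolve_left hN
    linear_combination d1 * t1 - d0 * n1
  have E11 : edgeMean a b (MvPolynomial.pderiv 1 (MvPolynomial.pderiv 1 p)) = 0 := by
    refine (mul_eq_zero.1 (?_ : ((d0 ^ 2 + d1 ^ 2) ^ 2) * _ = 0)).resolve_left (pow_ne_zero _ hN)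
    linear_combination d0 ^ 2 * n2 - d0 * d1 ^ 2 * t20 + (d1 ^ 3 + 2 * d0 ^ 2 * d1) * t21
  have E00 : edgeMean a b (MvPolynomial.pderiv 0 (MvPolynomial.pderiv 0 p)) = 0 := by
    refine (mul_eq_zero.1 (?_ : ((d0 ^ 2 + d1 ^ 2) ^ 2) * _ = 0)).resolve_left (pow_ne_zero _ hN)
    linear_combination d1 ^ 2 * n2 + (d0 ^ 3 + 2 * d0 * d1 ^ 2) * t20 - d0 ^ 2 * d1 * t21
  have E01 : edgeMean a b (MvPolynomial.pderiv 0 (MvPolynomial.pderiv 1 p)) = 0 := by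
    refine (mul_eq_zero.1 (?_ : ((d0 ^ 2 + d1 ^ 2)) * _ = 0)).resolve_left hN
    linear_combination d0 * t21 + d1 * t20 - d0 * d1 * E11 - d0 * d1 * E00
  have hcases : (β 0 = 0 ∧ β 1 = 0) ∨ (β 0 = 1 ∧ β 1 = 0) ∨ (β 0 = 0 ∧ β 1 = 1) ∨
      (β 0 = 2 ∧ β 1 = 0) ∨ (β 0 = 1 ∧ β 1 = 1) ∨ (β 0 = 0 ∧ β 1 = 2) := by
    rw [order_eq] at hβ; omega
  rcases hcases with ⟨h0, h1⟩ | ⟨h0, h1⟩ | ⟨h0, h1⟩ | ⟨h0, h1⟩ | ⟨h0, h1⟩ | ⟨h0, h1⟩ <;>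
    simp only [polyD, h0, h1, Function.iterate_zero, Function.iterate_succ, Function.comp, id]
  · exact hzero
  · exact E0
  · exact E1
  · exact E00
  · exact E01
  · exact E11

theorem polyD_sub (α : MultiIndex) (p q : Poly) : polyD α (p - q) = polyD α p - polyD α q := by
  have h := polyD_add α (p - q) q
  rw [sub_add_cancel] at h
  rw [h, add_sub_cancel_right]

/-- The difference of the two polynomials is cubic on the common edge and has vanishing degrees of
freedom there. -/
theorem edgeMean_polyD_eq {Ω : Set Plane} {T : Triangulation Ω} {w : T.PiecewisePoly}
    (hw : w ∈ feSpace T) {β : MultiIndex} (hβ : order β ≤ 2) (K L : Fin T.numCells) (a : Plane)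
    (ha : a ∈ T.vertices K ∩ T.vertices L) (b : Plane) (hb : b ∈ T.vertices K ∩ T.vertices L)
    (hab : a ≠ b) : edgeMean a b (polyD β (w K)) = edgeMean a b (polyD β (w L)) := by
  obtain ⟨h1, h2, h3⟩ := hw
  rw [← sub_eq_zero, ← edgeMean_sub, ← polyD_sub]
  refine edgeMean_polyD_eq_zero hab
    ((cubicOn_of_mem_shapeSpace (T.dblArea_ne K) (h1 K) ha.1 hb.1).sub
      (cubicOn_of_mem_shapeSpace (T.dblArea_ne L) (h1 L) ha.2 hb.2)) ?_ ?_ ?_ ?_ hβ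
  · simpa [sub_eq_zero] using h2 K L a ha
  · simpa [sub_eq_zero] using h2 K L b hb
  · rw [edgeNormal_sub, sub_eq_zero]; exact (h3 K L a ha b hb hab).1
  · rw [edgeNormalTwo_sub, sub_eq_zero]; exact (h3 K L a ha b hb hab).2

theorem edgeMean_polyD_eq_zero_of_boundary {Ω : Set Plane} {T : Triangulation Ω}
    {w : T.PiecewisePoly} (hw : w ∈ feSpaceZero T) {β : MultiIndex} (hβ : order β ≤ 2)
    (K : Fin T.numCells) {a b : Plane} (ha : a ∈ T.vertices K) (hb : b ∈ T.vertices K)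
    (hab : a ≠ b) (hs : segment ℝ a b ⊆ frontier Ω) : edgeMean a b (polyD β (w K)) = 0 := by
  obtain ⟨⟨h1, -, -⟩, h2, h3⟩ := hw
  obtain ⟨h4, h5⟩ := h3 K a ha b hb hab hs
  exact edgeMean_polyD_eq_zero hab (cubicOn_of_mem_shapeSpace (T.dblArea_ne K) (h1 K) ha hb)
    (h2 K a ha (hs (left_mem_segment ℝ a b))) (h2 K b hb (hs (right_mem_segment ℝ a b))) h4 h5 hβ

/-! ### Integration by parts up to a consistency error -/

theorem fderiv_apply_eq_sum (f : Plane → ℝ) (x h : Plane) :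
    fderiv ℝ f x h = ∑ i, partialD i f x * h i := by
  have : h = h 0 • EuclideanSpace.single 0 1 + h 1 • EuclideanSpace.single 1 1 := by
    ext i; fin_cases i <;> simp
  conv_lhs => rw [this]
  simp [partialD, Fin.sum_univ_two]
  ring

/-- First and second order Taylor estimates with a common constant. -/
def TaylorBound (φ : Plane → ℝ) (M : ℝ) : Prop :=
  (∀ x y, |φ y - φ x| ≤ M * dist y x) ∧
    ∀ x y, |φ y - φ x - ∑ l, partialD l φ x * (y l - x l)| ≤ M * dist y x ^ 2

theorem exists_taylorBound {φ : Plane → ℝ} (hφ : ContDiff ℝ ∞ φ) (hc : HasCompactSupport φ) :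
    ∃ M, 0 ≤ M ∧ TaylorBound φ M := by
  obtain ⟨C₁, h₁⟩ := ContDiff.lipschitzWith_of_hasCompactSupport hc hφ (by simp)
  obtain ⟨C₂, h₂⟩ := ContDiff.lipschitzWith_of_hasCompactSupport (hc.fderiv (𝕜 := ℝ))
    (hφ.fderiv_right (m := ∞) (by simp)) (by simp)
  refine ⟨max C₁ C₂, by positivity, fun x y => ?_, fun x y => ?_⟩
  · have := h₁.dist_le_mul y x
    rw [Real.dist_eq] at this
    exact this.trans (by gcongr; exact le_max_left _ _)
  · have h := (convex_closedBall x (dist y x)).norm_image_sub_le_of_norm_hasFDerivWithin_le'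
      (f := φ) (f' := fderiv ℝ φ) (φ := fderiv ℝ φ x) (C := C₂ * dist y x)
      (fun z _ => ((hφ.differentiable (by simp)) z).hasFDerivAt.hasFDerivWithinAt)
      (fun z hz => by
        have := h₂.dist_le_mul z x
        rw [dist_eq_norm] at this
        exact this.trans (by gcongr; exact Metric.mem_closedBall.1 hz))
      (Metric.mem_closedBall_self dist_nonneg) (Metric.mem_closedBall.2 le_rfl)
    rw [fderiv_apply_eq_sum, Real.norm_eq_abs, ← dist_eq_norm] at h
    simp only [PiLp.sub_apply] at h
    refine h.trans ?_
    rw [mul_assoc, ← pow_two]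
    gcongr
    exact le_max_right _ _

section
variable {v : Fin 3 → Plane} {φ : Plane → ℝ} {M c₀ : ℝ}

/-- The coefficients of the lowest order interpolant of the field `φ e_k` with respect to the
fields `x - v j`. -/
def fluxCoeff (v : Fin 3 → Plane) (φ : Plane → ℝ) (k : Fin 2) (j : Fin 3) : ℝ :=
  φ (midpoint ℝ (v (j + 1)) (v (j + 2))) * baryGrad v j k

theorem midpoint_mem_triangle (v : Fin 3 → Plane) (i j : Fin 3) :
    midpoint ℝ (v i) (v j) ∈ convexHull ℝ (Set.range v) :=
  (convex_convexHull ℝ _).midpoint_mem (vertex_mem_triangle v i) (vertex_mem_triangle v j)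

/-- The fields `x - v j` weighted by `∂_k λ_j` sum to exactly `-e_k`, which also explains the plus
sign. Only the oscillation of `φ` over the triangle, at most `M h`, is left. -/
theorem abs_interpolant_sub_le (hD : dblArea v ≠ 0) (hM : 0 ≤ M) (hφ : TaylorBound φ M) {h : ℝ}
    (hh : h = Metric.diam (convexHull ℝ (Set.range v)))
    (hc : ∀ i k, |baryGrad v i k| * h ≤ c₀) {x : Plane} (hx : x ∈ convexHull ℝ (Set.range v))
    (k l : Fin 2) :
    |(if k = l then φ x else 0) + ∑ j, fluxCoeff v φ k j * (x l - v j l)| ≤ 3 * (c₀ * M * h) := by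
  have h1 : ∑ j, baryGrad v j k * (x l - v j l) = -(if k = l then 1 else 0) := by
    rw [← sum_baryGrad_mul hD k l]
    have := sum_baryGrad v k
    simp only [Fin.sum_univ_three] at *
    linear_combination x l * this
  have h2 : (if k = l then φ x else 0) + ∑ j, fluxCoeff v φ k j * (x l - v j l) =
      ∑ j, (φ (midpoint ℝ (v (j + 1)) (v (j + 2))) - φ x) * (baryGrad v j k * (x l - v j l)) := by
    have h3 : (if k = l then φ x else 0) = φ x * (if k = l then 1 else 0) := by simp
    rw [h3]
    simp only [fluxCoeff, sub_mul, Finset.sum_sub_distrib, ← Finset.mul_sum, h1, mul_assoc]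
    ring
  rw [h2]
  have hh0 : 0 ≤ h := hh ▸ Metric.diam_nonneg
  calc _ ≤ ∑ j : Fin 3, |(φ (midpoint ℝ (v (j + 1)) (v (j + 2))) - φ x) *
        (baryGrad v j k * (x l - v j l))| := Finset.abs_sum_le_sum_abs _ _
    _ ≤ ∑ j : Fin 3, c₀ * M * h := by
        refine Finset.sum_le_sum fun j _ => ?_
        rw [abs_mul, abs_mul]
        have e1 : |φ (midpoint ℝ (v (j + 1)) (v (j + 2))) - φ x| ≤ M * h := by
          refine (hφ.1 x _).trans ?_
          rw [hh]
          gcongr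
          exact dist_le_diam_triangle (midpoint_mem_triangle v _ _) hx
        have e2 : |x l - v j l| ≤ h := by
          rw [hh]
          exact (abs_coord_sub_le _ _ _).trans (dist_le_diam_triangle hx (vertex_mem_triangle v j))
        calc _ ≤ (M * h) * (|baryGrad v j k| * h) := by gcongr
          _ ≤ (M * h) * c₀ := by gcongr; exact hc j k
          _ = c₀ * M * h := by ring
    _ = 3 * (c₀ * M * h) := by simp

/-- A first-order bound on `φ` would not suffice, since `∇λ` has size `1 / h`. The identities `∑ ∂_k
λ_j = 0` and `2 ∑ ∂_k λ_j m_j = -e_k` for the edge midpoints `m_j` remove the affine part of `φ`,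
leaving a remainder `M h²` times `c₀ / h`. -/
theorem abs_interpolant_div_sub_le (hD : dblArea v ≠ 0) (hM : 0 ≤ M) (hφ : TaylorBound φ M) {h : ℝ}
    (hh : h = Metric.diam (convexHull ℝ (Set.range v)))
    (hc : ∀ i k, |baryGrad v i k| * h ≤ c₀) {x : Plane} (hx : x ∈ convexHull ℝ (Set.range v))
    (k : Fin 2) :
    |partialD k φ x + 2 * ∑ j, fluxCoeff v φ k j| ≤ 6 * (c₀ * M * h) := by
  have hh0 : 0 ≤ h := hh ▸ Metric.diam_nonneg
  have h1 := sum_baryGrad v k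
  have h2 : ∀ l : Fin 2, 2 * ∑ j, baryGrad v j k * (midpoint ℝ (v (j + 1)) (v (j + 2)) l) =
      -(if k = l then 1 else 0) := by
    intro l
    rw [← sum_baryGrad_mul hD k l]
    simp only [Fin.sum_univ_three, midpoint_eq_smul_add] at *
    simp
    linear_combination (v 0 l + v 1 l + v 2 l) * h1
  have h3 : partialD k φ x + 2 * ∑ j, fluxCoeff v φ k j =
      2 * ∑ j, baryGrad v j k * (φ (midpoint ℝ (v (j + 1)) (v (j + 2))) - φ x -
        ∑ l, partialD l φ x * (midpoint ℝ (v (j + 1)) (v (j + 2)) l - x l)) := by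
    have h20 := h2 0
    have h21 := h2 1
    have hk : partialD k φ x = partialD 0 φ x * (if k = 0 then 1 else 0) +
      partialD 1 φ x * (if k = 1 then 1 else 0) := by fin_cases k <;> simp
    rw [hk]
    simp only [fluxCoeff, Fin.sum_univ_three, Fin.sum_univ_two] at *
    linear_combination (2 * φ x - 2 * partialD 0 φ x * x 0 - 2 * partialD 1 φ x * x 1) * h1 +
      partialD 0 φ x * h20 + partialD 1 φ x * h21
  rw [h3, abs_mul, abs_two]
  calc _ ≤ 2 * ∑ j : Fin 3, |baryGrad v j k * (φ (midpoint ℝ (v (j + 1)) (v (j + 2))) - φ x -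
        ∑ l, partialD l φ x * (midpoint ℝ (v (j + 1)) (v (j + 2)) l - x l))| := by
        gcongr; exact Finset.abs_sum_le_sum_abs _ _
    _ ≤ 2 * ∑ j : Fin 3, c₀ * M * h := by
        gcongr with j
        rw [abs_mul]
        have e1 : dist (midpoint ℝ (v (j + 1)) (v (j + 2))) x ≤ h := by
          rw [hh]; exact dist_le_diam_triangle (midpoint_mem_triangle v _ _) hx
        calc _ ≤ |baryGrad v j k| * (M * h ^ 2) := by
              gcongr
              exact (hφ.2 x _).trans (by gcongr)
          _ = (|baryGrad v j k| * h) * (M * h) := by ring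
          _ ≤ c₀ * (M * h) := by gcongr; exact hc j k
          _ = c₀ * M * h := by ring
    _ = 6 * (c₀ * M * h) := by simp; ring

theorem integrableOn_triangle {f : Plane → ℝ} (hf : Continuous f) (v : Fin 3 → Plane) :
    IntegrableOn f (convexHull ℝ (Set.range v)) :=
  hf.continuousOn.integrableOn_compact (isCompact_triangle v)

/-- The edge terms are the integral of the divergence of `p` times the interpolant, by
`integral_triangle_radial`. What remains pairs `∇p` and `p` with the interpolation errors of `φ e_k`
and of its divergence. -/
theorem abs_integral_parts_triangle_le (hD : dblArea v ≠ 0) (hM : 0 ≤ M) (hs : ContDiff ℝ ∞ φ)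
    (hφ : TaylorBound φ M) {h : ℝ} (hh : h = Metric.diam (convexHull ℝ (Set.range v)))
    (hc : ∀ i k, |baryGrad v i k| * h ≤ c₀) (k : Fin 2) (p : Poly) :
    |(∫ x in convexHull ℝ (Set.range v),
        (polyEval (MvPolynomial.pderiv k p) x * φ x + polyEval p x * partialD k φ x)) +
      ∑ j, φ (midpoint ℝ (v (j + 1)) (v (j + 2))) * (|dblArea v| * baryGrad v j k) *
        edgeMean (v (j + 1)) (v (j + 2)) p| ≤
      6 * (c₀ * M * h) * ∫ x in convexHull ℝ (Set.range v),
        (∑ l, |polyEval (MvPolynomial.pderiv l p) x| + |polyEval p x|) := by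
  have hpc : ∀ q : Poly, Continuous (polyEval q) := continuous_polyEval
  have hφc : Continuous φ := hs.continuous
  have hdc : Continuous (partialD k φ) := (contDiff_partialD k hs).continuous
  have hxc : ∀ l : Fin 2, Continuous fun x : Plane => x l := fun l =>
    (EuclideanSpace.proj l : Plane →L[ℝ] ℝ).continuous
  have hcj : ∀ j, Continuous fun x : Plane => fluxCoeff v φ k j *
      (∑ i, polyEval (MvPolynomial.pderiv i p) x * (x i - v j i) + 2 * polyEval p x) := fun j =>
    continuous_const.mul ((continuous_finsetSum _ fun i _ =>
      (hpc _).mul ((hxc i).sub continuous_const)).add (continuous_const.mul (hpc p)))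
  have hA : Continuous fun x => polyEval (MvPolynomial.pderiv k p) x * φ x +
      polyEval p x * partialD k φ x := ((hpc _).mul hφc).add ((hpc p).mul hdc)
  have hB : Continuous fun x => ∑ l, |polyEval (MvPolynomial.pderiv l p) x| + |polyEval p x| :=
    (continuous_finsetSum _ fun i _ => (hpc _).abs).add (hpc p).abs
  have key : (∫ x in convexHull ℝ (Set.range v),
        (polyEval (MvPolynomial.pderiv k p) x * φ x + polyEval p x * partialD k φ x)) +
      ∑ j, φ (midpoint ℝ (v (j + 1)) (v (j + 2))) * (|dblArea v| * baryGrad v j k) *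
        edgeMean (v (j + 1)) (v (j + 2)) p = ∫ x in convexHull ℝ (Set.range v),
        ((polyEval (MvPolynomial.pderiv k p) x * φ x + polyEval p x * partialD k φ x) +
        ∑ j, fluxCoeff v φ k j *
          (∑ i, polyEval (MvPolynomial.pderiv i p) x * (x i - v j i) + 2 * polyEval p x)) := by
    rw [integral_add (integrableOn_triangle hA v)
      (integrableOn_triangle (continuous_finsetSum _ fun j _ => hcj j) v),
      integral_finsetSum _ fun j _ => integrableOn_triangle (hcj j) v]
    congr 1
    refine Finset.sum_congr rfl fun j _ => ?_
    rw [integral_const_mul, integral_triangle_radial hD j p, fluxCoeff]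
    ring
  rw [key, ← integral_const_mul, ← Real.norm_eq_abs]
  refine norm_integral_le_of_norm_le ((integrableOn_triangle hB v).const_mul _) ?_
  refine (ae_restrict_iff' (isCompact_triangle v).measurableSet).2 (Eventually.of_forall ?_)
  intro x hx
  have e0 := abs_interpolant_sub_le hD hM hφ hh hc hx k 0
  have e1 := abs_interpolant_sub_le hD hM hφ hh hc hx k 1
  have e2 := abs_interpolant_div_sub_le hD hM hφ hh hc hx k
  have hnn : 0 ≤ c₀ * M * h := by
    have := (abs_nonneg _).trans e0
    linarith
  -- Regrouping: each component of the gradient of `p` multiplies a component of the field error,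
  -- and `p` multiplies the divergence error.
  have hid : (polyEval (MvPolynomial.pderiv k p) x * φ x + polyEval p x * partialD k φ x) +
        ∑ j, fluxCoeff v φ k j *
          (∑ i, polyEval (MvPolynomial.pderiv i p) x * (x i - v j i) + 2 * polyEval p x) =
      polyEval (MvPolynomial.pderiv 0 p) x *
        ((if k = 0 then φ x else 0) + ∑ j, fluxCoeff v φ k j * (x 0 - v j 0)) +
      polyEval (MvPolynomial.pderiv 1 p) x *
        ((if k = 1 then φ x else 0) + ∑ j, fluxCoeff v φ k j * (x 1 - v j 1)) +
      polyEval p x * (partialD k φ x + 2 * ∑ j, fluxCoeff v φ k j) := by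
    have hk : polyEval (MvPolynomial.pderiv k p) x * φ x =
        polyEval (MvPolynomial.pderiv 0 p) x * (if k = 0 then φ x else 0) +
        polyEval (MvPolynomial.pderiv 1 p) x * (if k = 1 then φ x else 0) := by
      fin_cases k <;> simp
    rw [hk]
    simp only [Fin.sum_univ_three, Fin.sum_univ_two]
    ring
  rw [hid, Real.norm_eq_abs]
  refine (abs_add_three _ _ _).trans ?_
  rw [abs_mul, abs_mul, abs_mul, Fin.sum_univ_two]
  have m0 := mul_le_mul_of_nonneg_left e0 (abs_nonneg (polyEval (MvPolynomial.pderiv 0 p) x))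
  have m1 := mul_le_mul_of_nonneg_left e1 (abs_nonneg (polyEval (MvPolynomial.pderiv 1 p) x))
  have m2 := mul_le_mul_of_nonneg_left e2 (abs_nonneg (polyEval p x))
  have n0 := mul_nonneg (abs_nonneg (polyEval (MvPolynomial.pderiv 0 p) x)) hnn
  have n1 := mul_nonneg (abs_nonneg (polyEval (MvPolynomial.pderiv 1 p) x)) hnn
  linarith

end

/-! ### Broken derivatives -/

section
variable {T : Triangulation unitSquare}

theorem interior_cell_subset (K : Fin T.numCells) : interior (T.cell K) ⊆ unitSquare :=
  (interior_mono (T.cell_subset_closure K)).trans interior_closure_unitSquare.subset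

theorem integrable_indicator_cell {f : Plane → ℝ} (hf : Continuous f) (K : Fin T.numCells) :
    Integrable ((interior (T.cell K)).indicator f) :=
  ((integrableOn_triangle hf (T.vertex K)).mono_set interior_subset).integrable_indicator
    isOpen_interior.measurableSet

theorem integral_sum_indicator (f : Fin T.numCells → Plane → ℝ) (hf : ∀ K, Continuous (f K)) :
    ∫ x in unitSquare, ∑ K, (interior (T.cell K)).indicator (f K) x =
      ∑ K, ∫ x in T.cell K, f K x := by
  rw [integral_finsetSum _ fun K _ => (integrable_indicator_cell (hf K) K).integrableOn]
  refine Finset.sum_congr rfl fun K _ => ?_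
  rw [setIntegral_indicator isOpen_interior.measurableSet,
    Set.inter_eq_right.2 (interior_cell_subset K)]
  exact setIntegral_congr_set (interior_triangle_ae_eq (T.vertex K))

theorem integral_brokenD_mul (α : MultiIndex) (w : T.PiecewisePoly) {φ : Plane → ℝ}
    (hφ : Continuous φ) :
    ∫ x in unitSquare, brokenD T α w x * φ x =
      ∑ K, ∫ x in T.cell K, polyEval (polyD α (w K)) x * φ x := by
  rw [← integral_sum_indicator (fun K x => polyEval (polyD α (w K)) x * φ x)
    fun K => (continuous_polyEval _).mul hφ]
  congr 1
  ext x
  rw [brokenD, Finset.sum_mul]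
  refine Finset.sum_congr rfl fun K _ => ?_
  by_cases hx : x ∈ interior (T.cell K) <;> simp [hx]

/-- The interiors are disjoint, so at most one summand is nonzero at any point. -/
theorem abs_sum_indicator (f : Fin T.numCells → Plane → ℝ) (x : Plane) :
    |∑ K, (interior (T.cell K)).indicator (f K) x| =
      ∑ K, (interior (T.cell K)).indicator (fun y => |f K y|) x := by
  by_cases hx : ∃ K, x ∈ interior (T.cell K)
  · obtain ⟨K, hK⟩ := hx
    have h0 : ∀ L, L ≠ K → x ∉ interior (T.cell L) := fun L hL hxL =>
      Set.disjoint_left.1 (T.disjoint_interior hL) hxL hK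
    rw [Finset.sum_eq_single K, Finset.sum_eq_single K]
    · simp [hK]
    · intro L _ hL; simp [h0 L hL]
    · simp
    · intro L _ hL; simp [h0 L hL]
    · simp
  · push Not at hx
    simp [hx]

theorem integral_abs_brokenD (α : MultiIndex) (w : T.PiecewisePoly) :
    ∫ x in unitSquare, |brokenD T α w x| = ∑ K, ∫ x in T.cell K, |polyEval (polyD α (w K)) x| := by
  rw [← integral_sum_indicator _ fun K => (continuous_polyEval _).abs]
  congr 1
  ext x
  rw [brokenD, abs_sum_indicator]

theorem cellDiam_le_meshSize (T : Triangulation unitSquare) (K : Fin T.numCells) :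
    T.cellDiam K ≤ T.meshSize := le_ciSup (Set.finite_range _).bddAbove K

/-- Integration by parts against the broken derivatives of a piecewise polynomial with continuous
edge means. -/
theorem abs_integral_parts_brokenD_le {c₀ M : ℝ} (hM : 0 ≤ M) {φ : Plane → ℝ}
    (hreg : ∀ K, T.cellDiam K / inscribedDiam (T.cell K) ≤ c₀)
    (hs : ContDiff ℝ ∞ φ) (hφ : TaylorBound φ M) (β : MultiIndex) (k : Fin 2) (w : T.PiecewisePoly)
    (hP : ∀ K L, ∀ a ∈ T.vertices K ∩ T.vertices L, ∀ b ∈ T.vertices K ∩ T.vertices L, a ≠ b →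
      edgeMean a b (polyD β (w K)) = edgeMean a b (polyD β (w L)))
    (hbd : ∀ K i, midpoint ℝ (T.vertex K (i + 1)) (T.vertex K (i + 2)) ∉ unitSquare →
      φ (midpoint ℝ (T.vertex K (i + 1)) (T.vertex K (i + 2))) *
        edgeMean (T.vertex K (i + 1)) (T.vertex K (i + 2)) (polyD β (w K)) = 0) :
    |(∫ x in unitSquare, brokenD T (β + Pi.single k 1) w x * φ x) +
      ∫ x in unitSquare, brokenD T β w x * partialD k φ x| ≤
      6 * (c₀ * M * T.meshSize) *
        (∑ l, (∫ x in unitSquare, |brokenD T (β + Pi.single l 1) w x|) +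
          ∫ x in unitSquare, |brokenD T β w x|) := by
  have hdc : Continuous (partialD k φ) := (contDiff_partialD k hs).continuous
  have hsum := sum_flux_eq_zero isOpen_unitSquare T (fun K => polyD β (w K)) φ k hP hbd
  rw [integral_brokenD_mul _ _ hs.continuous, integral_brokenD_mul _ _ hdc,
    ← Finset.sum_add_distrib]
  simp only [integral_abs_brokenD, ← pderiv_polyD]
  have hint : ∀ K, (∫ x in T.cell K, polyEval (MvPolynomial.pderiv k (polyD β (w K))) x * φ x) +
      (∫ x in T.cell K, polyEval (polyD β (w K)) x * partialD k φ x) =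
      ∫ x in T.cell K, (polyEval (MvPolynomial.pderiv k (polyD β (w K))) x * φ x +
        polyEval (polyD β (w K)) x * partialD k φ x) := fun K =>
    (integral_add
      (integrableOn_triangle ((continuous_polyEval _).mul hs.continuous) (T.vertex K))
      (integrableOn_triangle ((continuous_polyEval _).mul hdc) (T.vertex K))).symm
  have habs : ∀ K, ∫ x in T.cell K, (∑ l, |polyEval (MvPolynomial.pderiv l (polyD β (w K))) x| +
      |polyEval (polyD β (w K)) x|) =
      ∑ l, (∫ x in T.cell K, |polyEval (MvPolynomial.pderiv l (polyD β (w K))) x|) +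
      ∫ x in T.cell K, |polyEval (polyD β (w K)) x| := by
    intro K
    have hi : ∀ q : Poly, IntegrableOn (fun x => |polyEval q x|) (T.cell K) := fun q =>
      integrableOn_triangle (continuous_polyEval q).abs (T.vertex K)
    rw [integral_add (integrable_finsetSum _ fun l _ => hi _) (hi _),
      integral_finsetSum _ fun l _ => hi _]
  rw [Finset.sum_comm, ← Finset.sum_add_distrib, Finset.mul_sum]
  calc _ = |∑ K, ((∫ x in T.cell K, (polyEval (MvPolynomial.pderiv k (polyD β (w K))) x * φ x +
        polyEval (polyD β (w K)) x * partialD k φ x)) +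
        ∑ j, φ (midpoint ℝ (T.vertex K (j + 1)) (T.vertex K (j + 2))) *
          (|dblArea (T.vertex K)| * baryGrad (T.vertex K) j k) *
          edgeMean (T.vertex K (j + 1)) (T.vertex K (j + 2)) (polyD β (w K)))| := by
        -- The edge terms may be inserted because their sum over all cells is zero.
        simp only [hint]
        rw [Finset.sum_add_distrib, hsum, add_zero]
    _ ≤ _ := Finset.abs_sum_le_sum_abs _ _
    _ ≤ _ := by
        refine Finset.sum_le_sum fun K _ => ?_
        have hb := abs_integral_parts_triangle_le (T.dblArea_ne K) hM hs hφ rfl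
          (abs_baryGrad_mul_diam_le (T.dblArea_ne K) (hreg K)) k (polyD β (w K))
        refine hb.trans ?_
        change _ * (∫ x in T.cell K, _) ≤ _
        rw [habs K]
        have hc : 0 ≤ c₀ := by
          refine le_trans ?_ (abs_baryGrad_mul_diam_le (T.dblArea_ne K) (hreg K) 0 0)
          exact mul_nonneg (abs_nonneg _) Metric.diam_nonneg
        gcongr
        exact cellDiam_le_meshSize T K

end

/-! ### Weak limits of broken derivatives -/

instance isFiniteMeasure_restrict_unitSquare :
    IsFiniteMeasure ((volume : Measure Plane).restrict unitSquare) :=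
  ⟨by
    rw [Measure.restrict_apply_univ]
    exact (measure_mono subset_closure).trans_lt isCompact_closure_unitSquare.measure_lt_top⟩

/-- By the uniform boundedness principle, applied to the functionals `⟨f k, ·⟩`, the sequence is
bounded in `L²`, and on a set of finite measure this bounds the `L¹` norms. -/
theorem WeaklyConvergesL2.exists_integral_abs_le {f : ℕ → Plane → ℝ} {g : Plane → ℝ}
    (h : WeaklyConvergesL2 unitSquare f g) : ∃ B, ∀ k, ∫ x in unitSquare, |f k x| ≤ B := by
  obtain ⟨hf, -, hlim⟩ := h
  set μ := (volume : Measure Plane).restrict unitSquare with hμ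
  let F : ℕ → Lp ℝ 2 μ := fun k => (hf k).toLp
  have hbd : ∃ C, ∀ k, ‖innerSL ℝ (F k)‖ ≤ C := by
    refine banach_steinhaus fun x => ?_
    have hx := hlim x (Lp.memLp x)
    have heq : ∀ k, innerSL ℝ (F k) x = ∫ y, f k y * x y ∂μ := by
      intro k
      rw [innerSL_apply_apply, L2.inner_def]
      refine integral_congr_ae ?_
      filter_upwards [(hf k).coeFn_toLp] with y hy
      simp only [F, hy, RCLike.inner_apply, conj_trivial]
      ring
    obtain ⟨C, hC⟩ := (hx.norm).bddAbove_range
    refine ⟨C, fun k => ?_⟩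
    rw [heq]
    exact hC ⟨k, rfl⟩
  obtain ⟨C, hC⟩ := hbd
  have hpow : μ Set.univ ^ (1 / (1 : ℝ≥0∞).toReal - 1 / (2 : ℝ≥0∞).toReal) ≠ ⊤ :=
    ENNReal.rpow_ne_top_of_nonneg (by norm_num) (measure_ne_top μ _)
  refine ⟨C * (μ Set.univ ^ (1 / (1 : ℝ≥0∞).toReal - 1 / (2 : ℝ≥0∞).toReal)).toReal, fun k => ?_⟩
  have h1 : ∫ x, |f k x| ∂μ = (eLpNorm (f k) 1 μ).toReal := by
    rw [eLpNorm_one_eq_lintegral_enorm, ← integral_norm_eq_lintegral_enorm (hf k).1]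
    rfl
  rw [h1]
  have h2 := eLpNorm_le_eLpNorm_mul_rpow_measure_univ (p := 1) (q := 2) (by norm_num) (hf k).1
  refine (ENNReal.toReal_mono (ENNReal.mul_ne_top (hf k).2.ne hpow) h2).trans ?_
  rw [ENNReal.toReal_mul]
  gcongr
  have h3 := hC k
  rw [innerSL_apply_norm] at h3
  rwa [← Lp.norm_toLp (f k) (hf k)]

theorem tsupport_partialD_subset (k : Fin 2) (φ : Plane → ℝ) :
    tsupport (partialD k φ) ⊆ tsupport φ := tsupport_fderiv_apply_subset ℝ _

theorem hasCompactSupport_partialD (k : Fin 2) {φ : Plane → ℝ} (h : HasCompactSupport φ) :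
    HasCompactSupport (partialD k φ) :=
  h.of_isClosed_subset (isClosed_tsupport _) (tsupport_partialD_subset k φ)

theorem IsTestFunction.partialD {Ω : Set Plane} {φ : Plane → ℝ} (h : IsTestFunction Ω φ)
    (k : Fin 2) : IsTestFunction Ω (partialD k φ) :=
  ⟨contDiff_partialD k h.1, hasCompactSupport_partialD k h.2.1,
    (tsupport_partialD_subset k φ).trans h.2.2⟩

theorem memLp_of_hasCompactSupport {φ : Plane → ℝ} (h : ContDiff ℝ ∞ φ) (hc : HasCompactSupport φ)
    (μ : Measure Plane) [IsFiniteMeasureOnCompacts μ] : MemLp φ 2 μ :=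
  h.continuous.memLp_of_hasCompactSupport hc

/-- The weak limits of the broken derivatives of order `≤ 3` satisfy integration by parts. -/
theorem weakLimit_integral_parts {ι : Type*} {T : ι → Triangulation unitSquare} {c₀ : ℝ}
    (hreg : ∀ i K, (T i).cellDiam K / inscribedDiam ((T i).cell K) ≤ c₀)
    {n : ℕ → ι} {w : ∀ k, (T (n k)).PiecewisePoly} {g : MultiIndex → Plane → ℝ}
    (hmesh : Tendsto (fun k => (T (n k)).meshSize) atTop (𝓝 0))
    (hw : ∀ k, w k ∈ feSpace (T (n k)))
    (hg : ∀ α, order α ≤ 3 →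
      WeaklyConvergesL2 unitSquare (fun k => brokenD (T (n k)) α (w k)) (g α))
    {φ : Plane → ℝ} (hφ : ContDiff ℝ ∞ φ) (hφc : HasCompactSupport φ)
    {β : MultiIndex} (hβ : order β ≤ 2)
    (hbd : ∀ k K i,
      midpoint ℝ ((T (n k)).vertex K (i + 1)) ((T (n k)).vertex K (i + 2)) ∉ unitSquare →
      φ (midpoint ℝ ((T (n k)).vertex K (i + 1)) ((T (n k)).vertex K (i + 2))) *
        edgeMean ((T (n k)).vertex K (i + 1)) ((T (n k)).vertex K (i + 2)) (polyD β (w k K)) = 0)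
    (l : Fin 2) :
    (∫ x in unitSquare, g (β + Pi.single l 1) x * φ x) +
      ∫ x in unitSquare, g β x * partialD l φ x = 0 := by
  obtain ⟨M, hM, hT⟩ := exists_taylorBound hφ hφc
  have hw' : ∀ m : Fin 2, WeaklyConvergesL2 unitSquare
      (fun k => brokenD (T (n k)) (β + Pi.single m 1) (w k)) (g (β + Pi.single m 1)) := fun m =>
    hg _ (by rw [order_add_single]; omega)
  have hw0 := hg β (by omega)
  obtain ⟨B, hB⟩ := hw0.exists_integral_abs_le
  obtain ⟨B0, hB0⟩ := (hw' 0).exists_integral_abs_le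
  obtain ⟨B1, hB1⟩ := (hw' 1).exists_integral_abs_le
  have hlim := ((hw' l).2.2 φ (memLp_of_hasCompactSupport hφ hφc _)).add
    (hw0.2.2 (partialD l φ) (memLp_of_hasCompactSupport (contDiff_partialD l hφ)
      (hasCompactSupport_partialD l hφc) _))
  -- The left side is the limit of the discrete integration-by-parts defects, and these are bounded
  -- by the mesh size times bounded `L¹` norms.
  refine tendsto_nhds_unique hlim ?_
  have hz : Tendsto (fun k => 6 * (c₀ * M * (T (n k)).meshSize) * (B0 + B1 + B)) atTop (𝓝 0) := by
    have := ((hmesh.const_mul (c₀ * M)).const_mul 6).mul_const (B0 + B1 + B)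
    simpa using this
  refine squeeze_zero_norm (fun k => ?_) hz
  rw [Real.norm_eq_abs]
  refine (abs_integral_parts_brokenD_le hM (hreg (n k)) hφ hT β l (w k)
    (fun K L a ha b hb hab => edgeMean_polyD_eq (hw k) hβ K L a ha b hb hab) (hbd k)).trans ?_
  have hK : Nonempty (Fin (T (n k)).numCells) := by
    by_contra hne
    rw [not_nonempty_iff] at hne
    have hc := (T (n k)).cover
    rw [Set.iUnion_of_empty] at hc
    exact (nonempty_unitSquare.mono subset_closure).ne_empty hc.symm
  have hc : 0 ≤ c₀ := by
    refine le_trans ?_ (abs_baryGrad_mul_diam_le ((T (n k)).dblArea_ne hK.some)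
      (hreg (n k) hK.some) 0 0)
    exact mul_nonneg (abs_nonneg _) Metric.diam_nonneg
  have hmn : 0 ≤ (T (n k)).meshSize :=
    le_trans Metric.diam_nonneg (cellDiam_le_meshSize (T (n k)) hK.some)
  rw [Fin.sum_univ_two]
  gcongr
  · exact hB0 k
  · exact hB1 k
  · exact hB k

/-- Iterated integration by parts, for a class of test functions closed under derivatives. -/
theorem integral_mul_multiD {g : MultiIndex → Plane → ℝ} {A : (Plane → ℝ) → Prop}
    (hs : ∀ φ, A φ → ContDiff ℝ ∞ φ) (hA : ∀ φ k, A φ → A (partialD k φ))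
    (hstep : ∀ β k φ, order β ≤ 2 → A φ → (∫ x in unitSquare, g (β + Pi.single k 1) x * φ x) +
      ∫ x in unitSquare, g β x * partialD k φ x = 0)
    {α : MultiIndex} (hα : order α ≤ 3) {φ : Plane → ℝ} (hφ : A φ) :
    ∫ x in unitSquare, g 0 x * multiD α φ x = (-1) ^ order α * ∫ x in unitSquare, g α x * φ x := by
  obtain ⟨m, hm⟩ : ∃ m, order α = m := ⟨_, rfl⟩
  induction m generalizing α φ with
  | zero => rw [order_eq_zero hm]; simp [multiD_zero, order]
  | succ m ih =>
    obtain ⟨β, i, rfl, hβ⟩ := exists_eq_add_single hm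
    rw [multiD_add_single _ _ (hs φ hφ), ih (by omega) (hA φ i hφ) hβ, hm, hβ]
    have := hstep β i φ (by omega) hφ
    rw [pow_succ]
    linear_combination (-1) ^ m * this

theorem locallyIntegrableOn_of_memLp {f : Plane → ℝ}
    (hf : MemLp f 2 (volume.restrict unitSquare)) : LocallyIntegrableOn f unitSquare :=
  IntegrableOn.locallyIntegrableOn (hf.integrable (by norm_num))

/-- Weak derivatives are unique up to null sets. -/
theorem HasWeakDeriv.ae_eq {Ω : Set Plane} (hΩ : IsOpen Ω) {α : MultiIndex} {f g g' : Plane → ℝ}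
    (h : HasWeakDeriv Ω α f g) (h' : HasWeakDeriv Ω α f g') : g =ᵐ[volume.restrict Ω] g' := by
  have key : ∀ᵐ x ∂volume, x ∈ Ω → g x - g' x = 0 := by
    refine hΩ.ae_eq_zero_of_integral_contDiff_smul_eq_zero (h.2.1.sub h'.2.1) ?_
    intro φ hφ hc hsub
    have e1 := h.2.2 φ ⟨hφ, hc, hsub⟩
    have e2 := h'.2.2 φ ⟨hφ, hc, hsub⟩
    have hint : ∀ u : Plane → ℝ, LocallyIntegrableOn u Ω →
        IntegrableOn (fun x => u x * φ x) Ω := by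
      intro u hu
      have h1 : IntegrableOn (fun x => u x * φ x) (tsupport φ) := by
        have := (hu.integrableOn_compact_subset hsub hc).mul_continuousOn hφ.continuous.continuousOn hc
        exact this
      refine (integrableOn_iff_integrable_of_support_subset ?_).1 h1 |>.integrableOn
      intro x hx
      exact subset_tsupport _ (right_ne_zero_of_mul hx)
    have e3 : (∫ x in Ω, g x * φ x) - ∫ x in Ω, g' x * φ x = 0 := by
      have h1 : ((-1 : ℝ) ^ order α) ≠ 0 := pow_ne_zero _ (by norm_num)
      have := e1.symm.trans e2
      rw [mul_right_inj' h1] at this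
      rw [this, sub_self]
    rw [← integral_sub (hint g h.2.1) (hint g' h'.2.1)] at e3
    have e4 : ∫ x, φ x • (g x - g' x) = ∫ x in Ω, (g x * φ x - g' x * φ x) := by
      rw [setIntegral_eq_integral_of_forall_compl_eq_zero]
      · congr 1; ext x; simp; ring
      · intro x hx
        have : φ x = 0 := image_eq_zero_of_notMem_tsupport fun hx' => hx (hsub hx')
        simp [this]
    exact e4.trans e3
  rw [Filter.EventuallyEq, ae_restrict_iff' hΩ.measurableSet]
  filter_upwards [key] with x hx hxΩ
  exact sub_eq_zero.1 (hx hxΩ)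

theorem weakDeriv_ae_eq {Ω : Set Plane} (hΩ : IsOpen Ω) {α : MultiIndex} {f g : Plane → ℝ}
    (h : HasWeakDeriv Ω α f g) : weakDeriv Ω α f =ᵐ[volume.restrict Ω] g := by
  have hex : ∃ g, HasWeakDeriv Ω α f g := ⟨g, h⟩
  rw [weakDeriv, dif_pos hex]
  exact hex.choose_spec.ae_eq hΩ h

/-! ### Dilation and mollification -/

/-- The dilation by the factor `t` about the centre of the unit square. -/
def dilate (t : ℝ) (x : Plane) : Plane := t • x + (1 - t) • !₂[1 / 2, 1 / 2]

theorem dilate_apply (t : ℝ) (x : Plane) (i : Fin 2) : dilate t x i = t * x i + (1 - t) / 2 := by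
  fin_cases i <;> simp [dilate] <;> ring

theorem eLpNorm_two_sq {α : Type*} [MeasurableSpace α] (f : α → ℝ) (μ : Measure α) :
    eLpNorm f 2 μ ^ 2 = ∫⁻ x, ‖f x‖ₑ ^ 2 ∂μ := by
  have := eLpNorm_nnreal_pow_eq_lintegral (μ := μ) (f := f) (p := 2) (by norm_num)
  simpa using this

/-- The change of variables contributes `t⁻² ≤ 4` to the square of the norm. -/
theorem eLpNorm_comp_dilate_le {u : Plane → ℝ} (hu : AEStronglyMeasurable u volume) {t : ℝ}
    (ht : 1 / 2 ≤ t) (y : Plane) :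
    eLpNorm (fun x => u (dilate t x - y)) 2 volume ≤ 2 * eLpNorm u 2 volume := by
  have ht0 : t ≠ 0 := by linarith
  set b : Plane := (1 - t) • !₂[1 / 2, 1 / 2] - y with hb
  have hF : (fun x => u (dilate t x - y)) = u ∘ fun x => t • x + b := by
    ext x
    simp only [dilate, Function.comp_apply, hb]
    congr 1
    abel
  have hmap : Measure.map (fun x : Plane => t • x + b) volume =
      ENNReal.ofReal |(t ^ 2)⁻¹| • (volume : Measure Plane) := by
    have h1 : (fun x : Plane => t • x + b) = (fun x => x + b) ∘ fun x => t • x := rfl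
    rw [h1, ← Measure.map_map (by fun_prop) (by fun_prop), Measure.map_addHaar_smul _ ht0,
      Measure.map_smul, map_add_right_eq_self]
    simp
  have hc : ENNReal.ofReal |(t ^ 2)⁻¹| ≤ 2 ^ 2 := by
    rw [show ((2 : ℝ≥0∞) ^ 2) = ENNReal.ofReal 4 by norm_num]
    apply ENNReal.ofReal_le_ofReal
    rw [abs_of_pos (by positivity)]
    refine inv_le_of_inv_le₀ (by norm_num) ?_
    nlinarith
  rw [hF, ← eLpNorm_map_measure (by rw [hmap]; exact hu.smul_measure _) (by fun_prop), hmap,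
    eLpNorm_smul_measure_of_ne_top (by norm_num), smul_eq_mul]
  gcongr
  calc ENNReal.ofReal |(t ^ 2)⁻¹| ^ (1 / (2 : ℝ≥0∞)).toReal
      ≤ ((2 : ℝ≥0∞) ^ 2) ^ (1 / (2 : ℝ≥0∞)).toReal := by gcongr
    _ = 2 := by
      rw [← ENNReal.rpow_natCast, ← ENNReal.rpow_mul]; norm_num

theorem volume_unitSquare_le : volume unitSquare ≤ 1 := by
  have h := integral_unitSquare (fun _ => 1) continuous_const
  simp only [integral_const, smul_eq_mul, mul_one, intervalIntegral.integral_const, sub_zero] at h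
  have hfin : volume unitSquare ≠ ⊤ := by
    have := (isFiniteMeasure_restrict_unitSquare).measure_univ_lt_top
    rw [Measure.restrict_apply_univ] at this
    exact this.ne
  have h2 : volume unitSquare = ENNReal.ofReal 1 := by
    rw [← h, measureReal_restrict_apply_univ, ofReal_measureReal hfin]
  rw [h2]; simp

theorem eLpNorm_restrict_unitSquare_le {f : Plane → ℝ} {C : ℝ} (h : ∀ x ∈ unitSquare, |f x| ≤ C) :
    eLpNorm f 2 (volume.restrict unitSquare) ≤ ENNReal.ofReal C := by
  refine (eLpNorm_le_of_ae_bound (C := C) ?_).trans ?_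
  · exact (ae_restrict_iff' isOpen_unitSquare.measurableSet).2 (Eventually.of_forall h)
  · rw [Measure.restrict_apply_univ]
    calc _ ≤ (1 : ℝ≥0∞) ^ (2 : ℝ≥0∞).toReal⁻¹ * ENNReal.ofReal C := by
          gcongr
          exact volume_unitSquare_le
      _ = _ := by simp

/-- Dilations and translations act continuously on `L²`. -/
theorem eventually_eLpNorm_dilate_sub_le {g : Plane → ℝ} (hg : MemLp g 2 volume) {ε : ℝ}
    (hε : 0 < ε) : ∀ᶠ δ in 𝓝[>] (0 : ℝ), ∀ (t : ℝ) (y : Plane), |t - 1| ≤ 4 * δ → ‖y‖ ≤ δ →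
      eLpNorm (fun x => g (dilate t x - y) - g x) 2 (volume.restrict unitSquare) ≤
        ENNReal.ofReal ε := by
  -- Density of continuous compactly supported functions. The error splits as `2 · ε/4` from the
  -- dilated difference `g - h`, `ε/4` from the uniform continuity of `h`, and `ε/4` from `h - g`.
  obtain ⟨h, hc, hgh, hcont, hmem⟩ := hg.exists_hasCompactSupport_eLpNorm_sub_le (by norm_num)
    (ENNReal.ofReal_pos.2 (by positivity : 0 < ε / 4)).ne'
  obtain ⟨ρ, hρ, huc⟩ := Metric.uniformContinuous_iff.1
    (hc.uniformContinuous_of_continuous hcont) (ε / 4) (by positivity)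
  -- Points of the square are within distance one of the centre, so they move by at most `4 δ + δ <
  -- ρ`; the bound `1 / 8` ensures `t ≥ 1 / 2`.
  have hsmall : ∀ᶠ δ in 𝓝[>] (0 : ℝ), δ < min (1 / 8) (ρ / 10) :=
    nhdsWithin_le_nhds (gt_mem_nhds (by positivity))
  filter_upwards [hsmall, self_mem_nhdsWithin] with δ hδ hδ0 t y ht hy
  have hδ0 : 0 < δ := hδ0
  have hδ1 : δ < 1 / 8 := hδ.trans_le (min_le_left _ _)
  have hδ2 : δ < ρ / 10 := hδ.trans_le (min_le_right _ _)
  have ht2 : 1 / 2 ≤ t := by have := (abs_le.1 ht).1; linarith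
  have hdist : ∀ x ∈ unitSquare, dist (dilate t x - y) x < ρ := by
    intro x hx
    have e : dilate t x - y - x = (t - 1) • (x - !₂[1 / 2, 1 / 2]) - y := by
      simp only [dilate]; module
    have hn : ‖x - (!₂[1 / 2, 1 / 2] : Plane)‖ ≤ 1 := by
      rw [EuclideanSpace.norm_eq, Real.sqrt_le_left (by norm_num)]
      simp only [Real.norm_eq_abs, sq_abs, Fin.sum_univ_two]
      have h0 := hx 0
      have h1 := hx 1
      simp
      nlinarith
    rw [dist_eq_norm, e]
    calc _ ≤ ‖(t - 1) • (x - (!₂[1 / 2, 1 / 2] : Plane))‖ + ‖y‖ := norm_sub_le _ _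
      _ ≤ (4 * δ) * 1 + δ := by
          rw [norm_smul, Real.norm_eq_abs]
          gcongr
      _ < ρ := by linarith
  have hmeas : AEStronglyMeasurable (g - h) volume := hg.1.sub hmem.1
  have hquasi : ∀ u : Plane → ℝ, AEStronglyMeasurable u volume →
      AEStronglyMeasurable (fun x => u (dilate t x - y)) volume := by
    intro u hu
    refine hu.comp_quasiMeasurePreserving (f := fun x => dilate t x - y) ?_
    have h1 : (fun x : Plane => dilate t x - y) =
        (fun x => x + ((1 - t) • !₂[1 / 2, 1 / 2] - y)) ∘ fun x => t • x := by
      ext1 x; simp only [dilate, Function.comp]; abel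
    rw [h1]
    refine (measurePreserving_add_right volume _).quasiMeasurePreserving.comp ⟨by fun_prop, ?_⟩
    rw [Measure.map_addHaar_smul _ (by linarith)]
    exact Measure.smul_absolutelyContinuous
  have hdecomp : (fun x => g (dilate t x - y) - g x) =
      (fun x => (g - h) (dilate t x - y)) + ((fun x => h (dilate t x - y) - h x) + (h - g)) := by
    ext x; simp
  rw [hdecomp]
  have m1 : AEStronglyMeasurable (fun x => (g - h) (dilate t x - y)) (volume.restrict unitSquare) :=
    (hquasi _ hmeas).restrict
  have m2 : AEStronglyMeasurable (fun x => h (dilate t x - y) - h x)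
      (volume.restrict unitSquare) := ((hquasi h hmem.1).sub hmem.1).restrict
  have m3 : AEStronglyMeasurable (h - g) (volume.restrict unitSquare) :=
    (hmem.1.sub hg.1).restrict
  refine (eLpNorm_add_le m1 (m2.add m3) (by norm_num)).trans ?_
  refine (add_le_add_right (eLpNorm_add_le m2 m3 (by norm_num)) _).trans ?_
  have b1 : eLpNorm (fun x => (g - h) (dilate t x - y)) 2 (volume.restrict unitSquare) ≤
      ENNReal.ofReal (ε / 2) := by
    refine (eLpNorm_mono_measure _ Measure.restrict_le_self).trans ?_
    refine (eLpNorm_comp_dilate_le hmeas ht2 y).trans ?_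
    calc _ ≤ 2 * ENNReal.ofReal (ε / 4) := by gcongr
      _ = ENNReal.ofReal (ε / 2) := by
        rw [show (2 : ℝ≥0∞) = ENNReal.ofReal 2 by norm_num, ← ENNReal.ofReal_mul (by norm_num)]
        congr 1; ring
  have b2 : eLpNorm (fun x => h (dilate t x - y) - h x) 2 (volume.restrict unitSquare) ≤
      ENNReal.ofReal (ε / 4) := by
    refine eLpNorm_restrict_unitSquare_le fun x hx => ?_
    have := huc (hdist x hx)
    rw [Real.dist_eq] at this
    exact this.le
  have b3 : eLpNorm (h - g) 2 (volume.restrict unitSquare) ≤ ENNReal.ofReal (ε / 4) := by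
    refine (eLpNorm_mono_measure _ Measure.restrict_le_self).trans ?_
    rw [eLpNorm_sub_comm]; exact hgh
  calc _ ≤ ENNReal.ofReal (ε / 2) + (ENNReal.ofReal (ε / 4) + ENNReal.ofReal (ε / 4)) := by gcongr
    _ = ENNReal.ofReal ε := by
      rw [← ENNReal.ofReal_add (by positivity) (by positivity),
        ← ENNReal.ofReal_add (by positivity) (by positivity)]
      congr 1; ring

/-- The convolution of `f` and `η`. -/
def conv (f η : Plane → ℝ) (z : Plane) : ℝ := ∫ y, f y * η (z - y)

theorem conv_eq_convolution (f η : Plane → ℝ) :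
    conv f η = MeasureTheory.convolution f η (ContinuousLinearMap.mul ℝ ℝ) volume := rfl

theorem contDiff_conv {f η : Plane → ℝ} (hf : LocallyIntegrable f) (hη : ContDiff ℝ ∞ η)
    (hc : HasCompactSupport η) : ContDiff ℝ ∞ (conv f η) :=
  hc.contDiff_convolution_right (ContinuousLinearMap.mul ℝ ℝ) hf hη

theorem partialD_conv {f η : Plane → ℝ} (hf : LocallyIntegrable f) (hη : ContDiff ℝ ∞ η)
    (hc : HasCompactSupport η) (i : Fin 2) :
    partialD i (conv f η) = conv f (partialD i η) := by
  ext x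
  have h := hc.hasFDerivAt_convolution_right (ContinuousLinearMap.mul ℝ ℝ) hf
    (hη.of_le (by simp)) x
  rw [partialD, conv_eq_convolution, h.fderiv,
    convolution_precompR_apply _ hf (hc.fderiv ℝ) (hη.continuous_fderiv (by simp))]
  rfl

theorem multiD_conv {f η : Plane → ℝ} (hf : LocallyIntegrable f) (hη : ContDiff ℝ ∞ η)
    (hc : HasCompactSupport η) (α : MultiIndex) :
    multiD α (conv f η) = conv f (multiD α η) := by
  obtain ⟨m, hm⟩ : ∃ m, order α = m := ⟨_, rfl⟩
  induction m generalizing α η with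
  | zero => rw [order_eq_zero hm]; rfl
  | succ m ih =>
    obtain ⟨β, i, rfl, hβ⟩ := exists_eq_add_single hm
    rw [multiD_add_single _ _ (contDiff_conv hf hη hc), multiD_add_single _ _ hη,
      partialD_conv hf hη hc, ih (contDiff_partialD i hη) (hasCompactSupport_partialD i hc) _ hβ]

theorem contDiff_comp_affine {u : Plane → ℝ} (hu : ContDiff ℝ ∞ u) (t : ℝ) (b : Plane) :
    ContDiff ℝ ∞ fun x => u (t • x + b) :=
  hu.comp (g := u) (f := fun x : Plane => t • x + b) (by fun_prop)

/-- The prefactor `s` makes the induction close: each differentiation moves a factor `t` into it. -/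
theorem multiD_comp_affine {u : Plane → ℝ} (hu : ContDiff ℝ ∞ u) (s t : ℝ) (b : Plane)
    (α : MultiIndex) :
    multiD α (fun x => s * u (t • x + b)) = fun x => s * t ^ order α * multiD α u (t • x + b) := by
  obtain ⟨m, hm⟩ : ∃ m, order α = m := ⟨_, rfl⟩
  induction m generalizing α u s with
  | zero => rw [order_eq_zero hm]; simp [multiD_zero, order]
  | succ m ih =>
    obtain ⟨β, i, rfl, hβ⟩ := exists_eq_add_single hm
    have hd : partialD i (fun x => s * u (t • x + b)) =
        fun x => (s * t) * partialD i u (t • x + b) := by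
      ext x
      have h1 : HasFDerivAt (fun x : Plane => t • x + b) (t • ContinuousLinearMap.id ℝ Plane) x :=
        ((hasFDerivAt_id x).const_smul t).add_const b
      have h2 := (((hu.differentiable (by simp)) (t • x + b)).hasFDerivAt.comp x h1).const_mul s
      rw [partialD]
      have h3 : fderiv ℝ (fun x => s * u (t • x + b)) x = _ := h2.fderiv
      rw [h3]
      simp [partialD]
      ring
    rw [multiD_add_single _ _ (contDiff_const.mul (contDiff_comp_affine hu t b)), hd,
      ih (contDiff_partialD i hu) _ _ hβ, multiD_add_single _ _ hu, hm, hβ]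
    ext x
    ring

/-- A standard mollifier of radius `δ`. -/
structure IsMollifier (η : Plane → ℝ) (δ : ℝ) : Prop where
  contDiff : ContDiff ℝ ∞ η
  compact : HasCompactSupport η
  nonneg : ∀ x, 0 ≤ η x
  integral : ∫ x, η x = 1
  support : tsupport η ⊆ Metric.closedBall 0 δ

theorem exists_isMollifier {δ : ℝ} (hδ : 0 < δ) : ∃ η, IsMollifier η δ := by
  let f : ContDiffBump (0 : Plane) := ⟨δ / 2, δ, by positivity, by linarith⟩
  exact ⟨f.normed volume, f.contDiff_normed, f.hasCompactSupport_normed, f.nonneg_normed,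
    f.integral_normed, f.tsupport_normed_eq.subset⟩

theorem conv_eq_integral_sub (f η : Plane → ℝ) (z : Plane) :
    conv f η z = ∫ y, f (z - y) * η y := by
  rw [conv, ← integral_sub_left_eq_self (fun y => f y * η (z - y)) volume z]
  simp

/-- The mollifier is a probability density, so the square of a mean is at most the mean of the
squares. -/
theorem enorm_conv_sub_sq_le {g η : Plane → ℝ} {δ : ℝ} (hg : MemLp g 2 volume) (hm : Measurable g)
    (hη : IsMollifier η δ) (z : Plane) (a : ℝ) :
    ‖conv g η z - a‖ₑ ^ 2 ≤
      ∫⁻ y, ‖g (z - y) - a‖ₑ ^ 2 ∂(volume.withDensity fun y => ENNReal.ofReal (η y)) := by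
  have hηm : Measurable fun y => ENNReal.ofReal (η y) :=
    hη.contDiff.continuous.measurable.ennreal_ofReal
  set ν := (volume : Measure Plane).withDensity fun y => ENNReal.ofReal (η y) with hν
  have hprob : IsProbabilityMeasure ν := by
    constructor
    rw [hν, withDensity_apply _ MeasurableSet.univ, Measure.restrict_univ,
      ← ofReal_integral_eq_lintegral_ofReal
        (hη.contDiff.continuous.integrable_of_hasCompactSupport hη.compact)
        (Eventually.of_forall hη.nonneg), hη.integral]
    simp
  have hηL : MemLp η 2 volume := memLp_of_hasCompactSupport hη.contDiff hη.compact _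
  have hgz : MemLp (fun y => g (z - y)) 2 volume :=
    hg.comp_measurePreserving (Measure.measurePreserving_sub_left volume z)
  have hint : Integrable (fun y => g (z - y) * η y) := hgz.integrable_mul hηL
  have hintη : Integrable η := hη.contDiff.continuous.integrable_of_hasCompactSupport hη.compact
  have hF : Measurable fun y => g (z - y) - a :=
    (hm.comp (measurable_const.sub measurable_id)).sub measurable_const
  have h1 : conv g η z - a = ∫ y, (g (z - y) - a) * η y := by
    simp only [sub_mul]
    rw [integral_sub hint (hintη.const_mul a), integral_const_mul, hη.integral, mul_one,
      conv_eq_integral_sub]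
  have h2 : ‖conv g η z - a‖ₑ ≤ ∫⁻ y, ‖g (z - y) - a‖ₑ ∂ν := by
    rw [h1, hν, lintegral_withDensity_eq_lintegral_mul _ hηm hF.enorm]
    refine (enorm_integral_le_lintegral_enorm _).trans (le_of_eq ?_)
    congr 1
    ext y
    rw [enorm_mul, Pi.mul_apply, mul_comm, Real.enorm_of_nonneg (hη.nonneg y)]
  have h3 := eLpNorm_le_eLpNorm_of_exponent_le (p := 1) (q := 2) (μ := ν) (by norm_num)
    hF.aestronglyMeasurable
  rw [eLpNorm_one_eq_lintegral_enorm] at h3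
  rw [← eLpNorm_two_sq]
  exact pow_le_pow_left' (h2.trans h3) 2

/-- The mollified function is an average of translates, each close to `g` by
`eventually_eLpNorm_dilate_sub_le`; Jensen's inequality and Tonelli's theorem carry the bound over
to the average. -/
theorem eventually_eLpNorm_conv_sub_le {g : Plane → ℝ} (hg : MemLp g 2 volume) {ε : ℝ}
    (hε : 0 < ε) : ∀ᶠ δ in 𝓝[>] (0 : ℝ), ∀ (t : ℝ) (η : Plane → ℝ), |t - 1| ≤ 4 * δ →
      IsMollifier η δ → eLpNorm (fun x => conv g η (dilate t x) - g x) 2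
        (volume.restrict unitSquare) ≤ ENNReal.ofReal ε := by
  -- Tonelli's theorem needs a jointly measurable integrand, so `g` is first replaced by a
  -- measurable representative.
  have reduce : ∀ g' : Plane → ℝ, g =ᵐ[volume] g' → ∀ (t : ℝ) (η : Plane → ℝ),
      eLpNorm (fun x => conv g η (dilate t x) - g x) 2 (volume.restrict unitSquare) =
      eLpNorm (fun x => conv g' η (dilate t x) - g' x) 2 (volume.restrict unitSquare) := by
    intro g' hgg' t η
    refine eLpNorm_congr_ae (ae_restrict_of_ae ?_)
    have hc : ∀ z, conv g η z = conv g' η z := by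
      intro z
      refine integral_congr_ae ?_
      filter_upwards [hgg'] with y hy
      rw [hy]
    filter_upwards [hgg'] with x hx
    rw [hc, hx]
  obtain ⟨g', hg'm, hgg'⟩ := hg.1
  have hg' : MemLp g' 2 volume := hg.ae_eq hgg'
  simp only [reduce g' hgg']
  filter_upwards [eventually_eLpNorm_dilate_sub_le hg' hε] with δ hδ t η ht hη
  refine (ENNReal.pow_le_pow_left_iff two_ne_zero).1 ?_
  rw [eLpNorm_two_sq]
  have hηm : Measurable fun y => ENNReal.ofReal (η y) :=
    hη.contDiff.continuous.measurable.ennreal_ofReal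
  set ν := (volume : Measure Plane).withDensity fun y => ENNReal.ofReal (η y) with hν
  have hν1 : ν Set.univ = 1 := by
    rw [hν, withDensity_apply _ MeasurableSet.univ, Measure.restrict_univ,
      ← ofReal_integral_eq_lintegral_ofReal
        (hη.contDiff.continuous.integrable_of_hasCompactSupport hη.compact)
        (Eventually.of_forall hη.nonneg), hη.integral]
    simp
  have hfin : IsFiniteMeasure ν := ⟨by rw [hν1]; simp⟩
  have hsupp : ∀ᵐ y ∂ν, ‖y‖ ≤ δ := by
    rw [hν, ae_withDensity_iff hηm]
    refine Eventually.of_forall fun y hy => ?_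
    have : y ∈ tsupport η := subset_tsupport _ fun h0 => hy (by simp [h0])
    simpa using hη.support this
  have hdm : Measurable fun p : Plane × Plane => g' (dilate t p.1 - p.2) - g' p.1 := by
    have h1 : Measurable fun p : Plane × Plane => dilate t p.1 - p.2 := by
      unfold dilate; fun_prop
    exact (hg'm.measurable.comp h1).sub (hg'm.measurable.comp measurable_fst)
  calc ∫⁻ x in unitSquare, ‖conv g' η (dilate t x) - g' x‖ₑ ^ 2
      ≤ ∫⁻ x in unitSquare, ∫⁻ y, ‖g' (dilate t x - y) - g' x‖ₑ ^ 2 ∂ν :=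
        lintegral_mono fun x => enorm_conv_sub_sq_le hg' hg'm.measurable hη _ _
    _ = ∫⁻ y, ∫⁻ x in unitSquare, ‖g' (dilate t x - y) - g' x‖ₑ ^ 2 ∂volume ∂ν :=
        lintegral_lintegral_swap (hdm.enorm.pow_const 2).aemeasurable
    _ ≤ ∫⁻ _, ENNReal.ofReal ε ^ 2 ∂ν := by
        refine lintegral_mono_ae ?_
        filter_upwards [hsupp] with y hy
        rw [← eLpNorm_two_sq]
        exact pow_le_pow_left' (hδ t y ht hy) 2
    _ = ENNReal.ofReal ε ^ 2 := by rw [lintegral_const, hν1, mul_one]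

/-! ### Smooth approximation in `H³` and `H³₀` -/

theorem abs_pow_sub_one_le {t τ : ℝ} (ht : |t - 1| ≤ τ) (hτ : τ ≤ 1) {m : ℕ} (hm : m ≤ 3) :
    |t ^ m| ≤ 8 ∧ |1 - t ^ m| ≤ 7 * τ := by
  have h1 := abs_le.1 ht
  have ht0 : 0 ≤ t := by linarith
  have ht2 : t ≤ 2 := by linarith
  have hτ0 : 0 ≤ τ := (abs_nonneg _).trans ht
  have hsq : t ^ 2 ≤ 4 := by nlinarith
  constructor
  · rw [abs_of_nonneg (by positivity)]
    calc t ^ m ≤ 2 ^ m := by gcongr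
      _ ≤ 2 ^ 3 := by gcongr; norm_num
      _ = 8 := by norm_num
  · have hgeom : ∃ s, 0 ≤ s ∧ s ≤ 7 ∧ 1 - t ^ m = -((t - 1) * s) := by
      interval_cases m
      · exact ⟨0, by norm_num, by norm_num, by ring⟩
      · exact ⟨1, by norm_num, by norm_num, by ring⟩
      · exact ⟨t + 1, by linarith, by linarith, by ring⟩
      · exact ⟨t ^ 2 + t + 1, by positivity, by linarith, by ring⟩
    obtain ⟨s, hs0, hs7, hs⟩ := hgeom
    rw [hs, abs_neg, abs_mul, abs_of_nonneg hs0]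
    calc |t - 1| * s ≤ τ * 7 := by gcongr
      _ = 7 * τ := by ring

theorem multiD_comp_sub {η : Plane → ℝ} (hη : ContDiff ℝ ∞ η) (z y : Plane) (α : MultiIndex) :
    multiD α (fun y => η (z - y)) y = (-1) ^ order α * multiD α η (z - y) := by
  have h := congrFun (multiD_comp_affine hη 1 (-1) z α) y
  simp only [one_mul] at h
  have e : ∀ y : Plane, (-1 : ℝ) • y + z = z - y := fun y => by module
  simp only [e] at h
  exact h

/-- The approximant is `x ↦ (G₀ * η) (dilate t x)`, with `G₀` the extension of `g 0` by zero. Weak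
differentiability is assumed only for test functions in the balls that the mollifier sees. A
contraction `t < 1` keeps these balls inside the square, which serves `H³`; an expansion `t > 1`
pushes the support of the approximant inside, which serves `H³₀`. -/
theorem eventually_exists_smooth_approx {g : MultiIndex → Plane → ℝ}
    (hg : ∀ α, order α ≤ 3 → MemLp (g α) 2 (volume.restrict unitSquare)) {ε : ℝ} (hε : 0 < ε) :
    ∀ᶠ δ in 𝓝[>] (0 : ℝ), ∀ t : ℝ, |t - 1| ≤ 4 * δ →
      (∀ x ∈ unitSquare, ∀ ψ : Plane → ℝ, ContDiff ℝ ∞ ψ → HasCompactSupport ψ →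
        tsupport ψ ⊆ Metric.closedBall (dilate t x) δ → ∀ α, order α ≤ 3 →
          ∫ y in unitSquare, g 0 y * multiD α ψ y =
            (-1) ^ order α * ∫ y in unitSquare, g α y * ψ y) →
      ∃ φ : Plane → ℝ, ContDiff ℝ ∞ φ ∧
        (∀ x, Disjoint (Metric.closedBall (dilate t x) δ) unitSquare → φ x = 0) ∧
        ∀ α, order α ≤ 3 → eLpNorm (fun x => g α x - multiD α φ x) 2 (volume.restrict unitSquare) ≤
          ENNReal.ofReal ε := by
  let G : MultiIndex → Plane → ℝ := fun α => unitSquare.indicator (g α)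
  have hG : ∀ α, order α ≤ 3 → MemLp (G α) 2 volume := fun α hα =>
    (memLp_indicator_iff_restrict isOpen_unitSquare.measurableSet).2 (hg α hα)
  -- The error is `-t^m (G * η - G) + (1 - t^m) G` with `m = |α|`. Here `t^m ≤ 8` turns `ε / 16`
  -- into `ε / 2`, and `|1 - t^m| ≤ 7 · 4 δ` gives the `28 δ` below.
  have hev1 : ∀ᶠ δ in 𝓝[>] (0 : ℝ), ∀ α ∈ multiIndices 3, ∀ (t : ℝ) (η : Plane → ℝ),
      |t - 1| ≤ 4 * δ → IsMollifier η δ → eLpNorm (fun x => conv (G α) η (dilate t x) - G α x) 2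
        (volume.restrict unitSquare) ≤ ENNReal.ofReal (ε / 16) :=
    (Finset.eventually_all _).2 fun α hα =>
      eventually_eLpNorm_conv_sub_le (hG α (mem_multiIndices.1 hα)) (by positivity)
  have hev2 : ∀ᶠ δ in 𝓝[>] (0 : ℝ), ∀ α ∈ multiIndices 3,
      28 * δ * (eLpNorm (G α) 2 volume).toReal < ε / 2 := by
    refine (Finset.eventually_all _).2 fun α _ => nhdsWithin_le_nhds ?_
    have : Tendsto (fun δ : ℝ => 28 * δ * (eLpNorm (G α) 2 volume).toReal) (𝓝 0) (𝓝 0) := by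
      have h : Continuous fun δ : ℝ => 28 * δ * (eLpNorm (G α) 2 volume).toReal := by fun_prop
      simpa using h.tendsto 0
    exact this.eventually (gt_mem_nhds (by positivity))
  have hev3 : ∀ᶠ δ in 𝓝[>] (0 : ℝ), δ < 1 / 4 := nhdsWithin_le_nhds (gt_mem_nhds (by norm_num))
  filter_upwards [hev1, hev2, hev3, self_mem_nhdsWithin] with δ h1 h2 h3 hδ t ht hweak
  have hδ : 0 < δ := hδ
  obtain ⟨η, hη⟩ := exists_isMollifier hδ
  have hloc : LocallyIntegrable (G 0) := (hG 0 (by simp [order])).locallyIntegrable (by norm_num)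
  have hcs := contDiff_conv hloc hη.contDiff hη.compact
  have hφs : ContDiff ℝ ∞ fun x => conv (G 0) η (dilate t x) := contDiff_comp_affine hcs t _
  refine ⟨fun x => conv (G 0) η (dilate t x), hφs, ?_, ?_⟩
  · intro x hx
    have : ∀ y, G 0 y * η (dilate t x - y) = 0 := by
      intro y
      by_cases hy : y ∈ unitSquare
      · have hyb : y ∉ Metric.closedBall (dilate t x) δ := fun h => Set.disjoint_left.1 hx h hy
        have : η (dilate t x - y) = 0 := by
          refine image_eq_zero_of_notMem_tsupport fun h => hyb ?_
          have := hη.support h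
          rw [mem_closedBall_zero_iff] at this
          rwa [Metric.mem_closedBall, dist_comm, dist_eq_norm]
        rw [this, mul_zero]
      · simp [G, hy]
    simp [conv, this]
  · intro α hα
    have hmul : ∀ x ∈ unitSquare, multiD α (fun x => conv (G 0) η (dilate t x)) x =
        t ^ order α * conv (G α) η (dilate t x) := by
      intro x hx
      have e1 := congrFun (multiD_comp_affine hcs 1 t ((1 - t) • !₂[1 / 2, 1 / 2]) α) x
      simp only [one_mul] at e1
      refine e1.trans ?_
      rw [multiD_conv hloc hη.contDiff hη.compact]
      change _ * conv (G 0) (multiD α η) (dilate t x) = _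
      congr 1
      have hind : ∀ (u ζ : Plane → ℝ), conv (unitSquare.indicator u) ζ (dilate t x) =
          ∫ y in unitSquare, u y * ζ (dilate t x - y) := by
        intro u ζ
        rw [conv, ← integral_indicator isOpen_unitSquare.measurableSet]
        congr 1
        ext y
        by_cases hy : y ∈ unitSquare <;> simp [hy]
      rw [hind, hind]
      -- Testing with `y ↦ η (z - y)` moves the derivatives from `η` to `g`; the sign from the
      -- reflection cancels the sign in the weak derivative.
      have hψs : ContDiff ℝ ∞ fun y => η (dilate t x - y) := by
        have := hη.contDiff
        fun_prop
      have hψsup : tsupport (fun y => η (dilate t x - y)) ⊆ Metric.closedBall (dilate t x) δ := by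
        refine closure_minimal (fun y hy => ?_) Metric.isClosed_closedBall
        have := hη.support (subset_tsupport _ hy)
        rw [mem_closedBall_zero_iff] at this
        rwa [Metric.mem_closedBall, dist_comm, dist_eq_norm]
      have hψc : HasCompactSupport fun y => η (dilate t x - y) :=
        (isCompact_closedBall _ _).of_isClosed_subset (isClosed_tsupport _) hψsup
      have hw := hweak x hx _ hψs hψc hψsup α hα
      simp only [multiD_comp_sub hη.contDiff] at hw
      have hpm : ((-1 : ℝ) ^ order α) ≠ 0 := pow_ne_zero _ (by norm_num)
      have e2 : ∀ y, g 0 y * ((-1) ^ order α * multiD α η (dilate t x - y)) =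
          (-1) ^ order α * (g 0 y * multiD α η (dilate t x - y)) := fun y => by ring
      simp only [e2, integral_const_mul] at hw
      exact mul_left_cancel₀ hpm hw
    obtain ⟨hb1, hb2⟩ := abs_pow_sub_one_le ht (by linarith) hα
    have hae : (fun x => g α x - multiD α (fun x => conv (G 0) η (dilate t x)) x)
        =ᵐ[volume.restrict unitSquare]
        (-(t ^ order α)) • (fun x => conv (G α) η (dilate t x) - G α x) +
          (1 - t ^ order α) • G α := by
      refine (ae_restrict_iff' isOpen_unitSquare.measurableSet).2 (Eventually.of_forall ?_)
      intro x hx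
      simp only [hmul x hx, Pi.add_apply, Pi.smul_apply, smul_eq_mul]
      have : G α x = g α x := by simp [G, hx]
      rw [this]; ring
    rw [eLpNorm_congr_ae hae]
    have hGm : AEStronglyMeasurable (G α) (volume.restrict unitSquare) := (hG α hα).1.restrict
    have hcm : AEStronglyMeasurable (fun x => conv (G α) η (dilate t x))
        (volume.restrict unitSquare) := by
      have hl : LocallyIntegrable (G α) := (hG α hα).locallyIntegrable (by norm_num)
      exact (contDiff_comp_affine (contDiff_conv hl hη.contDiff hη.compact) t
        ((1 - t) • !₂[1 / 2, 1 / 2])).continuous.aestronglyMeasurable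
    refine (eLpNorm_add_le ((hcm.sub hGm).const_smul _) (hGm.const_smul _) (by norm_num)).trans ?_
    rw [eLpNorm_const_smul, eLpNorm_const_smul]
    have c1 : ‖-(t ^ order α)‖ₑ ≤ ENNReal.ofReal 8 := by
      rw [enorm_neg, Real.enorm_eq_ofReal_abs]
      exact ENNReal.ofReal_le_ofReal hb1
    have c2 : ‖1 - t ^ order α‖ₑ ≤ ENNReal.ofReal (28 * δ) := by
      rw [Real.enorm_eq_ofReal_abs]
      exact ENNReal.ofReal_le_ofReal (hb2.trans (by linarith))
    have c3 : eLpNorm (G α) 2 (volume.restrict unitSquare) ≤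
        ENNReal.ofReal (eLpNorm (G α) 2 volume).toReal := by
      rw [ENNReal.ofReal_toReal (hG α hα).2.ne]
      exact eLpNorm_mono_measure _ Measure.restrict_le_self
    have c4 := h1 α (mem_multiIndices.2 hα) t η ht hη
    calc _ ≤ ENNReal.ofReal 8 * ENNReal.ofReal (ε / 16) +
          ENNReal.ofReal (28 * δ) * ENNReal.ofReal (eLpNorm (G α) 2 volume).toReal := by
          gcongr
          exact c4
      _ = ENNReal.ofReal (8 * (ε / 16) + 28 * δ * (eLpNorm (G α) 2 volume).toReal) := by
          rw [← ENNReal.ofReal_mul (by norm_num), ← ENNReal.ofReal_mul (by positivity),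
            ← ENNReal.ofReal_add (by positivity) (by positivity)]
      _ ≤ ENNReal.ofReal ε := by
          apply ENNReal.ofReal_le_ofReal
          have := h2 α (mem_multiIndices.2 hα)
          linarith

theorem hasWeakDeriv_weakDeriv {Ω : Set Plane} {α : MultiIndex} {f : Plane → ℝ}
    (h : ∃ g, HasWeakDeriv Ω α f g) : HasWeakDeriv Ω α f (weakDeriv Ω α f) := by
  rw [weakDeriv, dif_pos h]
  exact h.choose_spec

theorem MemSobolev.memLp_weakDeriv {k : ℕ} {f : Plane → ℝ} (hf : MemSobolev k unitSquare f)
    {α : MultiIndex} (hα : order α ≤ k) :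
    MemLp (weakDeriv unitSquare α f) 2 (volume.restrict unitSquare) := by
  obtain ⟨g, hg, hw⟩ := hf.2 α hα
  exact hg.ae_eq (weakDeriv_ae_eq isOpen_unitSquare hw).symm

theorem hasWeakDeriv_zero {f : Plane → ℝ} (hf : MemLp f 2 (volume.restrict unitSquare)) :
    HasWeakDeriv unitSquare 0 f f :=
  ⟨locallyIntegrableOn_of_memLp hf, locallyIntegrableOn_of_memLp hf, fun φ _ => by
    simp [multiD_zero, order]⟩

/-- Functions of `H³` on the square are limits of functions smooth up to the boundary. -/
theorem MemSobolev.exists_smooth_approx {f : Plane → ℝ} (hf : MemSobolev 3 unitSquare f) {ε : ℝ}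
    (hε : 0 < ε) : ∃ φ : Plane → ℝ, ContDiff ℝ ∞ φ ∧ ∀ α, order α ≤ 3 →
      eLpNorm (fun x => weakDeriv unitSquare α f x - multiD α φ x) 2
        (volume.restrict unitSquare) ≤ ENNReal.ofReal ε := by
  have hev := eventually_exists_smooth_approx (g := fun α => weakDeriv unitSquare α f)
    (fun α hα => hf.memLp_weakDeriv hα) hε
  have hlt : ∀ᶠ δ in 𝓝[>] (0 : ℝ), δ < 1 / 4 := nhdsWithin_le_nhds (gt_mem_nhds (by norm_num))
  obtain ⟨δ, ⟨h, hδ4⟩, hδ⟩ := ((hev.and hlt).and self_mem_nhdsWithin).exists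
  have hδ : 0 < δ := hδ
  have ht : |1 - 4 * δ - 1| ≤ 4 * δ := by
    rw [show 1 - 4 * δ - 1 = -(4 * δ) by ring, abs_neg, abs_of_pos (by positivity)]
  suffices hs : _ by
    obtain ⟨φ, h1, -, h2⟩ := h (1 - 4 * δ) ht hs
    exact ⟨φ, h1, h2⟩
  intro x hx ψ hψ hψc hsup α hα
  -- The contraction maps the square into the square with coordinates between `2 δ` and `1 - 2 δ`.
  have hball : Metric.closedBall (dilate (1 - 4 * δ) x) δ ⊆ unitSquare := by
    intro y hy i
    have e1 := (abs_coord_sub_le y (dilate (1 - 4 * δ) x) i).trans (Metric.mem_closedBall.1 hy)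
    rw [dilate_apply, abs_le] at e1
    have hxi := hx i
    have ht : 0 < 1 - 4 * δ := by linarith
    have p1 := mul_pos ht hxi.1
    have p2 := mul_lt_mul_of_pos_left hxi.2 ht
    constructor <;> linarith [e1.1, e1.2]
  obtain ⟨g, -, hw⟩ := hf.2 α hα
  have e := (hasWeakDeriv_weakDeriv ⟨g, hw⟩).2.2 ψ ⟨hψ, hψc, hsup.trans hball⟩
  rw [← e]
  refine integral_congr_ae ?_
  filter_upwards [weakDeriv_ae_eq isOpen_unitSquare (hasWeakDeriv_zero hf.1)] with y hy
  rw [hy]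

/-- A family of weak derivatives on the whole plane, extended by zero from the square, comes from
a function of `H³₀`. -/
theorem memSobolevZero_of_integral_mul_multiD {g : MultiIndex → Plane → ℝ}
    (hg : ∀ α, order α ≤ 3 → MemLp (g α) 2 (volume.restrict unitSquare))
    (hweak : ∀ φ, ContDiff ℝ ∞ φ → HasCompactSupport φ → ∀ α, order α ≤ 3 →
      ∫ y in unitSquare, g 0 y * multiD α φ y = (-1) ^ order α * ∫ y in unitSquare, g α y * φ y) :
    MemSobolevZero 3 unitSquare (g 0) := by
  have hw : ∀ α, order α ≤ 3 → HasWeakDeriv unitSquare α (g 0) (g α) := fun α hα =>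
    ⟨locallyIntegrableOn_of_memLp (hg 0 (by simp [order])), locallyIntegrableOn_of_memLp (hg α hα),
      fun φ hφ => hweak φ hφ.1 hφ.2.1 α hα⟩
  refine ⟨⟨hg 0 (by simp [order]), fun α hα => ⟨g α, hg α hα, hw α hα⟩⟩, fun ε hε => ?_⟩
  obtain ⟨r, hr0, hrε⟩ := ENNReal.lt_iff_exists_nnreal_btwn.1 hε
  have hr : (0 : ℝ) < r := by exact_mod_cast hr0
  have hev := eventually_exists_smooth_approx hg hr
  obtain ⟨δ, h, hδ⟩ := (hev.and self_mem_nhdsWithin).exists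
  have hδ : 0 < δ := hδ
  obtain ⟨φ, h1, h2, h3⟩ := h (1 + 4 * δ) (by
      rw [show 1 + 4 * δ - 1 = 4 * δ by ring, abs_of_pos (by positivity)])
    (fun x _ ψ hψ hψc _ α hα => hweak ψ hψ hψc α hα)
  -- If `φ x ≠ 0`, the ball of radius `δ` about the dilated point meets the square, so `(1 + 4 δ)
  -- |x_i - 1/2| ≤ 1/2 + δ`.
  set ρ := (1 / 2 + δ) / (1 + 4 * δ) with hρ
  have hρ2 : ρ < 1 / 2 := by
    rw [hρ, div_lt_iff₀ (by positivity)]; linarith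
  let C : Set Plane := {x | ∀ i, |x i - 1 / 2| ≤ ρ}
  have hCcl : IsClosed C := by
    simp only [C, Set.ofPred_forall]
    refine isClosed_iInter fun i => isClosed_le ?_ continuous_const
    exact ((EuclideanSpace.proj i : Plane →L[ℝ] ℝ).continuous.sub continuous_const).abs
  have hCsub : C ⊆ unitSquare := by
    intro x hx i
    have := abs_le.1 (hx i)
    constructor <;> linarith [this.1, this.2]
  have hsup : tsupport φ ⊆ C := by
    refine closure_minimal (fun x hx => ?_) hCcl
    by_contra hxC
    apply hx
    apply h2
    rw [Set.disjoint_left]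
    intro y hy hyΩ
    simp only [C, Set.mem_ofPred_eq, not_forall, not_le] at hxC
    obtain ⟨i, hi⟩ := hxC
    have e1 := (abs_coord_sub_le y (dilate (1 + 4 * δ) x) i).trans (Metric.mem_closedBall.1 hy)
    rw [dilate_apply] at e1
    have e2 : |y i - 1 / 2| ≤ 1 / 2 := by
      have := hyΩ i
      rw [abs_le]; constructor <;> linarith
    rw [hρ, div_lt_iff₀ (by positivity)] at hi
    have e3 : |x i - 1 / 2| * (1 + 4 * δ) ≤ |y i - ((1 + 4 * δ) * x i + (1 - (1 + 4 * δ)) / 2)| +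
        |y i - 1 / 2| := by
      rw [← abs_of_pos (show 0 < 1 + 4 * δ by positivity), ← abs_mul,
        abs_of_pos (show 0 < 1 + 4 * δ by positivity)]
      have : (x i - 1 / 2) * (1 + 4 * δ) =
          -(y i - ((1 + 4 * δ) * x i + (1 - (1 + 4 * δ)) / 2)) + (y i - 1 / 2) := by ring
      rw [this]
      refine (abs_add_le _ _).trans ?_
      rw [abs_neg]
    linarith
  have hcomp : HasCompactSupport φ :=
    isCompact_closure_unitSquare.of_isClosed_subset (isClosed_tsupport _)
      ((hsup.trans hCsub).trans subset_closure)
  refine ⟨φ, ⟨h1, hcomp, hsup.trans hCsub⟩, fun α hα => ?_⟩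
  refine lt_of_le_of_lt ?_ hrε
  have hae : (fun x => weakDeriv unitSquare α (g 0) x - multiD α φ x)
      =ᵐ[volume.restrict unitSquare] fun x => g α x - multiD α φ x := by
    filter_upwards [weakDeriv_ae_eq isOpen_unitSquare (hw α hα)] with x hx
    rw [hx]
  rw [eLpNorm_congr_ae hae]
  simpa using h3 α hα

/-! ### Consistency -/

section
variable {ι : Type*} {T : ι → Triangulation unitSquare} {n : ℕ → ι}
  {w : ∀ k, (T (n k)).PiecewisePoly} {g : MultiIndex → Plane → ℝ}

theorem consistency_feSpace (hreg : ShapeRegular T)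
    (hmesh : Tendsto (fun k => (T (n k)).meshSize) atTop (𝓝 0))
    (hw : ∀ k, w k ∈ feSpace (T (n k)))
    (hg : ∀ α, order α ≤ 3 →
      WeaklyConvergesL2 unitSquare (fun k => brokenD (T (n k)) α (w k)) (g α)) :
    MemSobolev 3 unitSquare (g 0) ∧ ∀ α, order α ≤ 3 → HasWeakDeriv unitSquare α (g 0) (g α) := by
  obtain ⟨c₀, -, hc₀⟩ := hreg
  have hL : ∀ α, order α ≤ 3 → MemLp (g α) 2 (volume.restrict unitSquare) := fun α hα =>
    (hg α hα).2.1
  have hwd : ∀ α, order α ≤ 3 → HasWeakDeriv unitSquare α (g 0) (g α) := by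
    intro α hα
    refine ⟨locallyIntegrableOn_of_memLp (hL 0 (by simp [order])),
      locallyIntegrableOn_of_memLp (hL α hα), fun φ hφ => ?_⟩
    refine integral_mul_multiD (A := IsTestFunction unitSquare) (fun φ h => h.1)
      (fun φ k h => h.partialD k) ?_ hα hφ
    intro β k φ hβ hφ
    refine weakLimit_integral_parts hc₀ hmesh hw hg hφ.1 hφ.2.1 hβ ?_ k
    intro k K i hm
    -- Test functions vanish at midpoints outside the square, so boundary edges need no information
    -- on the finite element function.
    rw [image_eq_zero_of_notMem_tsupport fun h => hm (hφ.2.2 h), zero_mul]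
  exact ⟨⟨hL 0 (by simp [order]), fun α hα => ⟨g α, hL α hα, hwd α hα⟩⟩, hwd⟩

/-- Here the edge means vanish on boundary edges, so the test function need not vanish there, and
integration by parts holds for all compactly supported smooth functions on the plane. -/
theorem consistency_feSpaceZero (hreg : ShapeRegular T)
    (hmesh : Tendsto (fun k => (T (n k)).meshSize) atTop (𝓝 0))
    (hw : ∀ k, w k ∈ feSpaceZero (T (n k)))
    (hg : ∀ α, order α ≤ 3 →
      WeaklyConvergesL2 unitSquare (fun k => brokenD (T (n k)) α (w k)) (g α)) :
    MemSobolevZero 3 unitSquare (g 0) := by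
  obtain ⟨c₀, -, hc₀⟩ := hreg
  refine memSobolevZero_of_integral_mul_multiD (fun α hα => (hg α hα).2.1) ?_
  intro φ hφ hφc α hα
  refine integral_mul_multiD (A := fun φ => ContDiff ℝ ∞ φ ∧ HasCompactSupport φ) (fun φ h => h.1)
    (fun φ k h => ⟨contDiff_partialD k h.1, hasCompactSupport_partialD k h.2⟩) ?_ hα ⟨hφ, hφc⟩
  intro β k φ hβ hφ
  refine weakLimit_integral_parts hc₀ hmesh (fun k => (hw k).1) hg hφ.1 hφ.2 hβ ?_ k
  intro k K i hm
  have hne : (T (n k)).vertex K (i + 1) ≠ (T (n k)).vertex K (i + 2) := by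
    intro h
    have := vertex_injective ((T (n k)).dblArea_ne _) h
    simp at this
  rw [edgeMean_polyD_eq_zero_of_boundary (hw k) hβ K ⟨_, rfl⟩ ⟨_, rfl⟩ hne, mul_zero]
  exact segment_subset_frontier
    ((T (n k)).cell_subset_closure K ((T (n k)).vertex_mem_cell K _))
    ((T (n k)).cell_subset_closure K ((T (n k)).vertex_mem_cell K _)) hm

end

/-! ### Polynomials in the barycentric coordinates -/

/-- The polynomial `F(λ₀, λ₁, λ₂)` in the barycentric coordinates of `v`. -/
def baryPoly (v : Fin 3 → Plane) (F : MvPolynomial (Fin 3) ℝ) : Poly :=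
  MvPolynomial.aeval (barycentric v) F

theorem polyEval_baryPoly (v : Fin 3 → Plane) (F : MvPolynomial (Fin 3) ℝ) (x : Plane) :
    polyEval (baryPoly v F) x = MvPolynomial.eval (fun i => bary v i x) F := by
  induction F using MvPolynomial.induction_on with
  | C a => simp [baryPoly, polyEval, MvPolynomial.algebraMap_eq]
  | add p q hp hq => simp only [baryPoly, map_add, polyEval_add] at *; rw [hp, hq]
  | mul_X p i hp =>
    simp only [baryPoly, map_mul, polyEval_mul, MvPolynomial.aeval_X] at *
    rw [hp]
    simp [bary]

theorem pderiv_baryPoly (v : Fin 3 → Plane) (F : MvPolynomial (Fin 3) ℝ) (k : Fin 2) :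
    MvPolynomial.pderiv k (baryPoly v F) =
      ∑ j, MvPolynomial.C (baryGrad v j k) * baryPoly v (MvPolynomial.pderiv j F) := by
  induction F using MvPolynomial.induction_on with
  | C a => simp [baryPoly, MvPolynomial.algebraMap_eq]
  | add p q hp hq =>
    simp only [baryPoly, map_add, mul_add, Finset.sum_add_distrib] at *
    rw [hp, hq]
  | mul_X p i hp =>
    have hmul : ∀ q, baryPoly v (q * MvPolynomial.X i) = baryPoly v q * barycentric v i := fun q => by
      simp [baryPoly]
    have hj : ∀ j, baryPoly v (MvPolynomial.pderiv j (p * MvPolynomial.X i)) =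
        baryPoly v (MvPolynomial.pderiv j p) * barycentric v i +
          if j = i then baryPoly v p else 0 := by
      intro j
      rw [MvPolynomial.pderiv_mul]
      split_ifs with h
      · subst h
        rw [MvPolynomial.pderiv_X_self, mul_one, ← hmul]
        exact map_add (MvPolynomial.aeval (barycentric v)) _ _
      · rw [MvPolynomial.pderiv_X_of_ne (Ne.symm h), mul_zero, add_zero, add_zero, hmul]
    rw [hmul, MvPolynomial.pderiv_mul, pderiv_barycentric, hp]
    simp only [hj, mul_add, Finset.sum_add_distrib, Finset.sum_mul]
    have h2 : ∑ j, MvPolynomial.C (baryGrad v j k) * (if j = i then baryPoly v p else 0) =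
        baryPoly v p * MvPolynomial.C (baryGrad v i k) := by
      rw [Finset.sum_eq_single i (fun j _ h => by rw [if_neg h, mul_zero])
        (fun h => absurd (Finset.mem_univ i) h), if_pos rfl, mul_comm]
    rw [h2]
    simp only [mul_assoc]

theorem polyD_sum {ι : Type*} (α : MultiIndex) (s : Finset ι) (p : ι → Poly) :
    polyD α (∑ i ∈ s, p i) = ∑ i ∈ s, polyD α (p i) := by
  classical
  have h0 : polyD α 0 = 0 := by simpa using polyD_C_mul α 0 0
  induction s using Finset.induction_on with
  | empty => simpa using h0
  | insert a s ha ih => rw [Finset.sum_insert ha, Finset.sum_insert ha, polyD_add, ih]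

theorem exists_eval_bound (F : MvPolynomial (Fin 3) ℝ) :
    ∃ C, 0 ≤ C ∧ ∀ y : Fin 3 → ℝ, (∀ i, y i ∈ Set.Icc (0 : ℝ) 1) → |MvPolynomial.eval y F| ≤ C := by
  have hcomp : IsCompact (Set.univ.pi fun _ : Fin 3 => Set.Icc (0 : ℝ) 1) :=
    isCompact_univ_pi fun _ => isCompact_Icc
  obtain ⟨C, hC⟩ := hcomp.exists_bound_of_continuousOn
    (MvPolynomial.continuous_eval F).continuousOn
  refine ⟨max C 0, le_max_right _ _, fun y hy => ?_⟩
  exact (hC y (Set.mem_univ_pi.2 hy)).trans (le_max_left _ _)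

/-- Scaled bounds for the derivatives of `p` of order at most three on the triangle `v`. -/
def ScaledBound (v : Fin 3 → Plane) (p : Poly) (B : ℝ) : Prop :=
  ∀ α, order α ≤ 3 → ∀ x ∈ convexHull ℝ (Set.range v),
    |polyEval (polyD α p) x| * Metric.diam (convexHull ℝ (Set.range v)) ^ order α ≤ B

theorem ScaledBound.add {v : Fin 3 → Plane} {p q : Poly} {A B : ℝ} (hp : ScaledBound v p A)
    (hq : ScaledBound v q B) : ScaledBound v (p + q) (A + B) := by
  intro α hα x hx
  have h1 := hp α hα x hx
  have h2 := hq α hα x hx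
  rw [polyD_add, polyEval_add]
  refine le_trans ?_ (add_le_add h1 h2)
  rw [← add_mul]
  gcongr
  exact abs_add_le _ _

theorem ScaledBound.C_mul {v : Fin 3 → Plane} {p : Poly} {A B c : ℝ} (hp : ScaledBound v p A)
    (hc : |c| ≤ B) (hB : 0 ≤ B) : ScaledBound v (MvPolynomial.C c * p) (B * A) := by
  intro α hα x hx
  have h1 := hp α hα x hx
  rw [polyD_C_mul, polyEval_mul, polyEval_C, abs_mul, mul_assoc]
  exact mul_le_mul hc h1 (by positivity) hB

theorem ScaledBound.sum {v : Fin 3 → Plane} {p : Fin 3 → Poly} {A : ℝ}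
    (hp : ∀ j, ScaledBound v (p j) A) : ScaledBound v (∑ j, p j) (3 * A) := by
  rw [Fin.sum_univ_three]
  have := ((hp 0).add (hp 1)).add (hp 2)
  rwa [show A + A + A = 3 * A by ring] at this

theorem ScaledBound.mono {v : Fin 3 → Plane} {p : Poly} {A B : ℝ} (hp : ScaledBound v p A)
    (h : A ≤ B) : ScaledBound v p B := fun α hα x hx => (hp α hα x hx).trans h

/-- This takes the place of scaling to a reference triangle. By the chain rule each derivative
replaces `F` by some `∂_j F` with a factor `∂λ_j`, which times the diameter is at most `c₀`;
undifferentiated, `F` is only evaluated on `[0, 1]³`. -/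
theorem exists_bound_polyD_baryPoly {c₀ : ℝ} (hc₀ : 0 ≤ c₀) (n : ℕ) (F : MvPolynomial (Fin 3) ℝ) :
    ∃ C, 0 ≤ C ∧ ∀ v : Fin 3 → Plane, dblArea v ≠ 0 →
      (∀ i k, |baryGrad v i k| * Metric.diam (convexHull ℝ (Set.range v)) ≤ c₀) →
      ∀ α, order α = n → ∀ x ∈ convexHull ℝ (Set.range v),
        |polyEval (polyD α (baryPoly v F)) x| *
          Metric.diam (convexHull ℝ (Set.range v)) ^ n ≤ C := by
  induction n generalizing F with
  | zero =>
    obtain ⟨C, hC0, hC⟩ := exists_eval_bound F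
    refine ⟨C, hC0, fun v hD _ α hα x hx => ?_⟩
    rw [order_eq_zero hα, polyD_zero, polyEval_baryPoly, pow_zero, mul_one]
    exact hC _ fun i => ⟨(mem_triangle_iff hD).1 hx i, bary_le_one hD hx i⟩
  | succ n ih =>
    choose C hC0 hC using fun j => ih (MvPolynomial.pderiv j F)
    refine ⟨∑ j, c₀ * C j, Finset.sum_nonneg fun j _ => mul_nonneg hc₀ (hC0 j), ?_⟩
    intro v hD hb α hα x hx
    obtain ⟨β, i, rfl, hβ⟩ := exists_eq_add_single hα
    rw [polyD_add_single, pderiv_baryPoly, polyD_sum, polyEval_sum]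
    simp only [polyD_C_mul, polyEval_mul, polyEval_C]
    set h := Metric.diam (convexHull ℝ (Set.range v)) with hh
    have hh0 : 0 ≤ h := Metric.diam_nonneg
    calc _ ≤ (∑ j, |baryGrad v j i * polyEval (polyD β (baryPoly v (MvPolynomial.pderiv j F))) x|) *
          h ^ (n + 1) := by gcongr; exact Finset.abs_sum_le_sum_abs _ _
      _ = ∑ j, (|baryGrad v j i| * h) *
          (|polyEval (polyD β (baryPoly v (MvPolynomial.pderiv j F))) x| * h ^ n) := by
          rw [Finset.sum_mul]
          exact Finset.sum_congr rfl fun j _ => by rw [abs_mul]; ring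
      _ ≤ ∑ j, c₀ * C j := by
          gcongr with j
          · exact hb j i
          · exact hC j v hD hb β hβ x hx

theorem exists_scaledBound_baryPoly {c₀ : ℝ} (hc₀ : 0 ≤ c₀) (F : MvPolynomial (Fin 3) ℝ) :
    ∃ C, 0 ≤ C ∧ ∀ v : Fin 3 → Plane, dblArea v ≠ 0 →
      (∀ i k, |baryGrad v i k| * Metric.diam (convexHull ℝ (Set.range v)) ≤ c₀) →
      ScaledBound v (baryPoly v F) C := by
  choose C hC0 hC using fun n => exists_bound_polyD_baryPoly hc₀ n F
  refine ⟨∑ n ∈ Finset.range 4, C n, Finset.sum_nonneg fun n _ => hC0 n, ?_⟩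
  intro v hD hb α hα x hx
  exact (hC _ v hD hb α rfl x hx).trans
    (Finset.single_le_sum (f := C) (fun n _ => hC0 n) (Finset.mem_range.2 (by omega)))

theorem totalDegree_barycentric_le (v : Fin 3 → Plane) (i : Fin 3) :
    (barycentric v i).totalDegree ≤ 1 := by
  have h : barycentric v i = MvPolynomial.C ((dblArea v)⁻¹ *
      (v (i + 1) 0 * v (i + 2) 1 - v (i + 1) 1 * v (i + 2) 0)) +
      MvPolynomial.C (baryGrad v i 0) * MvPolynomial.X 0 +
      MvPolynomial.C (baryGrad v i 1) * MvPolynomial.X 1 := by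
    rw [barycentric_eq, baryGrad, baryGrad]
    simp only [Matrix.cons_val_zero, Matrix.cons_val_one, map_mul, map_sub]
    ring
  rw [h]
  refine (MvPolynomial.totalDegree_add _ _).trans (max_le ((MvPolynomial.totalDegree_add _ _).trans
    (max_le (by rw [MvPolynomial.totalDegree_C]; simp) ?_)) ?_) <;>
  · refine (MvPolynomial.totalDegree_mul _ _).trans ?_
    simp

/-! ### Shape functions with prescribed degrees of freedom -/

theorem dirD_mul (ν : Plane) (p q : Poly) : dirD ν (p * q) = dirD ν p * q + p * dirD ν q := by
  simp only [dirD_eq, MvPolynomial.pderiv_mul]; ring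

theorem integral_quintic (c₀ c₁ c₂ c₃ c₄ c₅ : ℝ) :
    ∫ s in (0 : ℝ)..1, (c₀ + c₁ * s + c₂ * s ^ 2 + c₃ * s ^ 3 + c₄ * s ^ 4 + c₅ * s ^ 5) =
      c₀ + c₁ / 2 + c₂ / 3 + c₃ / 4 + c₄ / 5 + c₅ / 6 := by
  have hd : ∀ s : ℝ, HasDerivAt (fun s : ℝ => c₀ * s + c₁ / 2 * s ^ 2 + c₂ / 3 * s ^ 3 +
      c₃ / 4 * s ^ 4 + c₄ / 5 * s ^ 5 + c₅ / 6 * s ^ 6)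
      (c₀ + c₁ * s + c₂ * s ^ 2 + c₃ * s ^ 3 + c₄ * s ^ 4 + c₅ * s ^ 5) s := by
    intro s
    have hp : ∀ (c : ℝ) (n : ℕ), HasDerivAt (fun s : ℝ => c * s ^ n) (c * (n * s ^ (n - 1))) s :=
      fun c n => (hasDerivAt_pow n s).const_mul c
    have h1 : HasDerivAt (fun s : ℝ => c₀ * s) c₀ s := by
      simpa using (hasDerivAt_id s).const_mul c₀
    refine (((((h1.add (hp (c₁ / 2) 2)).add (hp (c₂ / 3) 3)).add (hp (c₃ / 4) 4)).add
      (hp (c₄ / 5) 5)).add (hp (c₅ / 6) 6)).congr_deriv ?_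
    norm_num
    ring
  rw [intervalIntegral.integral_eq_sub_of_hasDerivAt (fun s _ => hd s)
    (Continuous.intervalIntegrable (by fun_prop) _ _)]
  norm_num

section
variable {v : Fin 3 → Plane}

/-- The normal derivative of a barycentric coordinate on the opposite edge. -/
def baryNormal (v : Fin 3 → Plane) (i : Fin 3) : ℝ :=
  unitNormal (v (i + 1)) (v (i + 2)) 0 * baryGrad v i 0 +
    unitNormal (v (i + 1)) (v (i + 2)) 1 * baryGrad v i 1

theorem dirD_barycentric (v : Fin 3 → Plane) (i : Fin 3) (ν : Plane) :
    dirD ν (barycentric v i) = MvPolynomial.C (ν 0 * baryGrad v i 0 + ν 1 * baryGrad v i 1) := by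
  simp only [dirD_eq, pderiv_barycentric, map_add, map_mul]

theorem bubble_rotate (v : Fin 3 → Plane) (i : Fin 3) : bubble v =
    barycentric v i * (barycentric v (i + 1) * barycentric v (i + 2)) := by
  rw [bubble, Fin.prod_univ_three]
  fin_cases i <;> simp <;> ring

theorem unitNormal_sq {a b : Plane} (hab : a ≠ b) :
    unitNormal a b 0 ^ 2 + unitNormal a b 1 ^ 2 = 1 := by
  have hd : dist a b ^ 2 = (b 0 - a 0) ^ 2 + (b 1 - a 1) ^ 2 := by
    rw [EuclideanSpace.dist_eq, Real.sq_sqrt (by positivity), Fin.sum_univ_two, Real.dist_eq,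
      Real.dist_eq, sq_abs, sq_abs]
    ring
  have hd0 : dist a b ≠ 0 := dist_ne_zero.2 hab
  simp only [unitNormal, PiLp.smul_apply, smul_eq_mul, Matrix.cons_val_zero, Matrix.cons_val_one]
  field_simp
  rw [hd]; ring

theorem abs_unitNormal_le {a b : Plane} (hab : a ≠ b) (k : Fin 2) : |unitNormal a b k| ≤ 1 := by
  have h := unitNormal_sq hab
  rw [← sq_le_one_iff_abs_le_one]
  fin_cases k
  · simp only [Fin.zero_eta]; nlinarith [sq_nonneg (unitNormal a b 1)]
  · simp only [Fin.mk_one]; nlinarith [sq_nonneg (unitNormal a b 0)]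

theorem edge_ne (hD : dblArea v ≠ 0) (i : Fin 3) : v (i + 1) ≠ v (i + 2) := by
  intro h
  have := vertex_injective hD h
  simp at this

/-- A barycentric coordinate is constant along the opposite edge, so its gradient is normal to that
edge. -/
theorem baryGrad_eq_baryNormal_mul (hD : dblArea v ≠ 0) (i : Fin 3) (k : Fin 2) :
    baryGrad v i k = baryNormal v i * unitNormal (v (i + 1)) (v (i + 2)) k := by
  have hν := unitNormal_sq (edge_ne hD i)
  have hd : dist (v (i + 1)) (v (i + 2)) ≠ 0 := dist_ne_zero.2 (edge_ne hD i)
  have hg : ∀ k, baryGrad v i k = (-(dblArea v)⁻¹ * dist (v (i + 1)) (v (i + 2))) *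
      unitNormal (v (i + 1)) (v (i + 2)) k := by
    intro k
    simp only [baryGrad, unitNormal, PiLp.smul_apply, smul_eq_mul]
    fin_cases k <;> simp <;> field_simp <;> ring
  rw [baryNormal, hg k, hg 0, hg 1]
  linear_combination (-(-(dblArea v)⁻¹ * dist (v (i + 1)) (v (i + 2))) *
      unitNormal (v (i + 1)) (v (i + 2)) k) * hν

/-- Between two vertices at distance at most the diameter the coordinate drops from one to zero. The
factor two comes from estimating the two components separately. This lower bound permits division by
`baryNormal`. -/
theorem one_le_abs_baryNormal_mul (hD : dblArea v ≠ 0) (i : Fin 3) :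
    1 ≤ |baryNormal v i| * (2 * Metric.diam (convexHull ℝ (Set.range v))) := by
  have h1 := bary_sub v i (v i) (v (i + 1))
  rw [bary_vertex hD, bary_vertex hD, Fin.sum_univ_two, baryGrad_eq_baryNormal_mul hD i 0,
    baryGrad_eq_baryNormal_mul hD i 1] at h1
  simp only [if_true, left_eq_add, Fin.isValue, one_ne_zero, if_false, sub_zero] at h1
  have hk : ∀ k, |unitNormal (v (i + 1)) (v (i + 2)) k * (v i k - v (i + 1) k)| ≤
      Metric.diam (convexHull ℝ (Set.range v)) := by
    intro k
    rw [abs_mul]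
    calc _ ≤ 1 * Metric.diam (convexHull ℝ (Set.range v)) := by
          gcongr
          · exact abs_unitNormal_le (edge_ne hD i) k
          · exact (abs_coord_sub_le _ _ _).trans
              (dist_le_diam_triangle (vertex_mem_triangle v _) (vertex_mem_triangle v _))
      _ = _ := one_mul _
  have h2 : (1 : ℝ) = baryNormal v i *
      (unitNormal (v (i + 1)) (v (i + 2)) 0 * (v i 0 - v (i + 1) 0) +
        unitNormal (v (i + 1)) (v (i + 2)) 1 * (v i 1 - v (i + 1) 1)) := by
    rw [h1]; ring
  calc (1 : ℝ) = |(1 : ℝ)| := by simp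
    _ = |baryNormal v i| * |unitNormal (v (i + 1)) (v (i + 2)) 0 * (v i 0 - v (i + 1) 0) +
        unitNormal (v (i + 1)) (v (i + 2)) 1 * (v i 1 - v (i + 1) 1)| := by
        rw [← abs_mul, ← h2]
    _ ≤ _ := by
        gcongr
        refine (abs_add_le _ _).trans ?_
        have := hk 0
        have := hk 1
        linarith

theorem baryNormal_ne_zero (hD : dblArea v ≠ 0) (i : Fin 3) : baryNormal v i ≠ 0 := by
  intro h
  have := one_le_abs_baryNormal_mul hD i
  rw [h] at this
  norm_num at this

theorem abs_div_baryNormal_le (hD : dblArea v ≠ 0) (i : Fin 3) (a : ℝ) :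
    |a / baryNormal v i| ≤ 2 * (|a| * Metric.diam (convexHull ℝ (Set.range v))) := by
  rw [abs_div, div_le_iff₀ (abs_pos.2 (baryNormal_ne_zero hD i))]
  have := mul_le_mul_of_nonneg_left (one_le_abs_baryNormal_mul hD i) (abs_nonneg a)
  linarith

theorem bary_edge (hD : dblArea v ≠ 0) (i : Fin 3) (s : ℝ) :
    bary v i (AffineMap.lineMap (v (i + 1)) (v (i + 2)) s) = 0 ∧
      bary v (i + 1) (AffineMap.lineMap (v (i + 1)) (v (i + 2)) s) = 1 - s ∧
      bary v (i + 2) (AffineMap.lineMap (v (i + 1)) (v (i + 2)) s) = s := by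
  simp [bary_lineMap, bary_vertex hD]

theorem bubble_edge (hD : dblArea v ≠ 0) (i : Fin 3) (s : ℝ) :
    polyEval (bubble v) (AffineMap.lineMap (v (i + 1)) (v (i + 2)) s) = 0 :=
  bubble_lineMap hD _ _ s

theorem dirD_bubble_edge (hD : dblArea v ≠ 0) (i : Fin 3) (s : ℝ) :
    polyEval (dirD (unitNormal (v (i + 1)) (v (i + 2))) (bubble v))
      (AffineMap.lineMap (v (i + 1)) (v (i + 2)) s) = baryNormal v i * (s - s ^ 2) := by
  obtain ⟨h0, h1, h2⟩ := bary_edge hD i s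
  rw [bubble_rotate v i, dirD_mul, dirD_barycentric]
  simp only [bary] at h0 h1 h2
  simp only [polyEval_add, polyEval_mul, polyEval_C, h0, h1, h2, baryNormal]
  ring

/-- On edge `i` the normal derivative of the bubble is a multiple of `s (1 - s)`, symmetric about
the midpoint. The factor `1 - 2 λ_j` is one there for `j = i` and `±(1 - 2 s)`, antisymmetric,
otherwise. These functions are therefore dual to the normal means up to scaling. -/
theorem edgeNormal_bubble_mul (hD : dblArea v ≠ 0) (i j : Fin 3) :
    edgeNormal (v (i + 1)) (v (i + 2)) (bubble v * (1 - MvPolynomial.C 2 * barycentric v j)) =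
      if j = i then baryNormal v i / 6 else 0 := by
  have hval : ∀ s : ℝ, polyEval (dirD (unitNormal (v (i + 1)) (v (i + 2)))
      (bubble v * (1 - MvPolynomial.C 2 * barycentric v j)))
        (AffineMap.lineMap (v (i + 1)) (v (i + 2)) s) = baryNormal v i * (s - s ^ 2) *
        (1 - 2 * bary v j (AffineMap.lineMap (v (i + 1)) (v (i + 2)) s)) := by
    intro s
    rw [dirD_mul]
    simp [dirD_bubble_edge hD, bubble_edge hD, bary]
  simp only [edgeNormal, edgeMean, hval]
  have h1 : i + 1 ≠ i := (by decide : ∀ l : Fin 3, l + 1 ≠ l) i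
  have h2 : i + 2 ≠ i := (by decide : ∀ l : Fin 3, l + 2 ≠ l) i
  rcases fin_three_cases i j with rfl | rfl | rfl
  · simp only [(bary_edge hD _ _).1, if_true]
    have := integral_quintic 0 (baryNormal v j) (-baryNormal v j) 0 0 0
    refine Eq.trans ?_ (this.trans (by ring))
    congr 1; ext s; ring
  · simp only [(bary_edge hD _ _).2.1, if_neg h1]
    have := integral_quintic 0 (-baryNormal v i) (3 * baryNormal v i) (-2 * baryNormal v i) 0 0
    refine Eq.trans ?_ (this.trans (by ring))
    congr 1; ext s; ring
  · simp only [(bary_edge hD _ _).2.2, if_neg h2]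
    have := integral_quintic 0 (baryNormal v i) (-3 * baryNormal v i) (2 * baryNormal v i) 0 0
    refine Eq.trans ?_ (this.trans (by ring))
    congr 1; ext s; ring

/-- The squared bubble vanishes to second order on the edges, so corrections by it leave the first
normal means alone. -/
theorem edgeNormal_bubble_sq_mul (hD : dblArea v ≠ 0) (i : Fin 3) (p : Poly) :
    edgeNormal (v (i + 1)) (v (i + 2)) (bubble v ^ 2 * p) = 0 := by
  have hval : ∀ s : ℝ, polyEval (dirD (unitNormal (v (i + 1)) (v (i + 2))) (bubble v ^ 2 * p))
        (AffineMap.lineMap (v (i + 1)) (v (i + 2)) s) = 0 := by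
    intro s
    rw [pow_two, dirD_mul, dirD_mul]
    simp [bubble_edge hD]
  simp [edgeNormal, edgeMean, hval]

/-- On the edge only `2 (∂_ν q)² (1 - 2 λ_j)` survives, and the same symmetry makes the means
diagonal; the value is `2 ∫ s² (1 - s)² = 1 / 15` times the squared normal derivative of `λ_i`. -/
theorem edgeNormalTwo_bubble_sq_mul (hD : dblArea v ≠ 0) (i j : Fin 3) :
    edgeNormalTwo (v (i + 1)) (v (i + 2))
      (bubble v ^ 2 * (1 - MvPolynomial.C 2 * barycentric v j)) =
      if j = i then baryNormal v i ^ 2 / 15 else 0 := by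
  have hval : ∀ s : ℝ, polyEval (dirD (unitNormal (v (i + 1)) (v (i + 2)))
      (dirD (unitNormal (v (i + 1)) (v (i + 2)))
        (bubble v ^ 2 * (1 - MvPolynomial.C 2 * barycentric v j))))
        (AffineMap.lineMap (v (i + 1)) (v (i + 2)) s) = 2 * (baryNormal v i * (s - s ^ 2)) ^ 2 *
        (1 - 2 * bary v j (AffineMap.lineMap (v (i + 1)) (v (i + 2)) s)) := by
    intro s
    rw [pow_two]
    simp only [dirD_mul, dirD_add, polyEval_add, polyEval_mul, dirD_bubble_edge hD, bubble_edge hD]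
    simp only [polyEval_sub, polyEval_one, polyEval_mul, polyEval_C, bary]
    ring
  simp only [edgeNormalTwo, edgeMean, hval]
  have h1 : i + 1 ≠ i := (by decide : ∀ l : Fin 3, l + 1 ≠ l) i
  have h2 : i + 2 ≠ i := (by decide : ∀ l : Fin 3, l + 2 ≠ l) i
  set N := baryNormal v i with hN
  rcases fin_three_cases i j with rfl | rfl | rfl
  · simp only [(bary_edge hD _ _).1, if_true]
    have := integral_quintic 0 0 (2 * N ^ 2) (-4 * N ^ 2) (2 * N ^ 2) 0
    refine Eq.trans ?_ (this.trans (by ring))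
    congr 1; ext s; ring
  · simp only [(bary_edge hD _ _).2.1, if_neg h1]
    have := integral_quintic 0 0 (-2 * N ^ 2) (8 * N ^ 2) (-10 * N ^ 2) (4 * N ^ 2)
    refine Eq.trans ?_ (this.trans (by ring))
    congr 1; ext s; ring
  · simp only [(bary_edge hD _ _).2.2, if_neg h2]
    have := integral_quintic 0 0 (2 * N ^ 2) (-8 * N ^ 2) (10 * N ^ 2) (-4 * N ^ 2)
    refine Eq.trans ?_ (this.trans (by ring))
    congr 1; ext s; ring

/-- Two of the three factors of the bubble vanish at each vertex. -/
theorem bubble_vertex (hD : dblArea v ≠ 0) (i : Fin 3) (p : Poly) :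
    polyEval (bubble v * p) (v i) = 0 ∧
      ∀ k, polyEval (MvPolynomial.pderiv k (bubble v * p)) (v i) = 0 := by
  have h1 : polyEval (barycentric v (i + 1)) (v i) = 0 := by
    have := bary_vertex hD (i + 1) i
    rwa [if_neg ((by decide : ∀ l : Fin 3, l + 1 ≠ l) i)] at this
  have h2 : polyEval (barycentric v (i + 2)) (v i) = 0 := by
    have := bary_vertex hD (i + 2) i
    rwa [if_neg ((by decide : ∀ l : Fin 3, l + 2 ≠ l) i)] at this
  rw [bubble_rotate v i]
  refine ⟨by simp [h1], fun k => ?_⟩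
  simp [h1, h2]

/-- The cubic with prescribed values and gradients at the vertices, up to bubble functions. -/
def hermite (v : Fin 3 → Plane) (d : Fin 3 → ℝ) (e : Fin 3 → Fin 2 → ℝ) : Poly :=
  ∑ j, MvPolynomial.C (d j) * (barycentric v j ^ 2 * (MvPolynomial.C 3 -
      MvPolynomial.C 2 * barycentric v j)) +
    (∑ j, MvPolynomial.C (∑ k, e j k * (v (j + 1) k - v j k)) *
      (barycentric v j ^ 2 * barycentric v (j + 1)) +
    ∑ j, MvPolynomial.C (∑ k, e j k * (v (j + 2) k - v j k)) *
      (barycentric v j ^ 2 * barycentric v (j + 2)))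

theorem polyEval_barycentric_vertex (hD : dblArea v ≠ 0) (i j : Fin 3) :
    polyEval (barycentric v i) (v j) = if i = j then 1 else 0 := bary_vertex hD i j

theorem hermite_vertex (hD : dblArea v ≠ 0) (d : Fin 3 → ℝ) (e : Fin 3 → Fin 2 → ℝ) (i : Fin 3) :
    polyEval (hermite v d e) (v i) = d i := by
  simp only [hermite, Fin.sum_univ_three, polyEval_add, polyEval_mul, polyEval_C, polyEval_pow,
    polyEval_sub, polyEval_barycentric_vertex hD]
  fin_cases i <;> simp <;> ring

theorem pderiv_hermite_vertex (hD : dblArea v ≠ 0) (d : Fin 3 → ℝ) (e : Fin 3 → Fin 2 → ℝ)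
    (i : Fin 3) (k : Fin 2) :
    polyEval (MvPolynomial.pderiv k (hermite v d e)) (v i) = e i k := by
  have hs := sum_baryGrad v k
  have h0 := sum_baryGrad_mul hD k 0
  have h1 := sum_baryGrad_mul hD k 1
  have hV : ∀ j, polyEval (MvPolynomial.pderiv k (barycentric v j ^ 2 * (MvPolynomial.C 3 -
      MvPolynomial.C 2 * barycentric v j))) (v i) = 0 := by
    intro j
    simp only [MvPolynomial.pderiv_mul, MvPolynomial.pderiv_pow, map_sub, MvPolynomial.pderiv_C,
      pderiv_barycentric, polyEval_add, polyEval_mul, polyEval_sub, polyEval_C, polyEval_pow,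
      polyEval_barycentric_vertex hD]
    split_ifs <;> simp [polyEval]
    ring
  have hG : ∀ j m, j ≠ m → polyEval (MvPolynomial.pderiv k (barycentric v j ^ 2 * barycentric v m))
      (v i) = if j = i then baryGrad v m k else 0 := by
    intro j m hjm
    simp only [MvPolynomial.pderiv_mul, MvPolynomial.pderiv_pow,
      pderiv_barycentric, polyEval_add, polyEval_mul, polyEval_C, polyEval_pow,
      polyEval_barycentric_vertex hD]
    by_cases hj : j = i
    · subst hj; simp [hjm.symm]
    · simp [hj]
  have n1 : ∀ j : Fin 3, j ≠ j + 1 := by decide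
  have n2 : ∀ j : Fin 3, j ≠ j + 2 := by decide
  rw [hermite, map_add, map_add, map_sum, map_sum, map_sum]
  simp only [MvPolynomial.pderiv_C_mul, polyEval_add, polyEval_sum, polyEval_mul, polyEval_C, hV,
    hG _ _ (n1 _), hG _ _ (n2 _), mul_zero, Finset.sum_const_zero, mul_ite, Finset.sum_ite_eq',
    Finset.mem_univ, if_true, zero_add]
  rw [sum_fin_three_rotate _ i] at hs h0 h1
  have he : e i k = e i 0 * (if k = 0 then 1 else 0) + e i 1 * (if k = 1 then 1 else 0) := by
    fin_cases k <;> simp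
  rw [he]
  simp only [Fin.sum_univ_two]
  -- The directional data along the two edges at `v i` recombine to the gradient, because `∑ ∂_k λ_m
  -- (v m - v i)_l = δ_kl`.
  linear_combination e i 0 * h0 + e i 1 * h1 - (e i 0 * v i 0 + e i 1 * v i 1) * hs

theorem totalDegree_hermite_le (v : Fin 3 → Plane) (d : Fin 3 → ℝ) (e : Fin 3 → Fin 2 → ℝ) :
    (hermite v d e).totalDegree ≤ 3 := by
  have hb := totalDegree_barycentric_le v
  have hC : ∀ (c : ℝ) (p : Poly), p.totalDegree ≤ 3 →
      (MvPolynomial.C c * p).totalDegree ≤ 3 := by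
    intro c p hp
    refine (MvPolynomial.totalDegree_mul _ _).trans ?_
    rw [MvPolynomial.totalDegree_C]; omega
  have h3 : ∀ (j : Fin 3) (p : Poly), p.totalDegree ≤ 1 →
      (barycentric v j ^ 2 * p).totalDegree ≤ 3 := by
    intro j p hp
    refine (MvPolynomial.totalDegree_mul _ _).trans ?_
    have := (MvPolynomial.totalDegree_pow (barycentric v j) 2)
    have := hb j
    omega
  have hsum : ∀ (f : Fin 3 → Poly), (∀ j, (f j).totalDegree ≤ 3) → (∑ j, f j).totalDegree ≤ 3 :=
    fun f hf => (MvPolynomial.totalDegree_finsetSum _ _).trans (Finset.sup_le fun j _ => hf j)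
  refine (MvPolynomial.totalDegree_add _ _).trans (max_le (hsum _ fun j => hC _ _ (h3 _ _ ?_))
    ((MvPolynomial.totalDegree_add _ _).trans (max_le (hsum _ fun j => hC _ _ (h3 _ _ (hb _)))
      (hsum _ fun j => hC _ _ (h3 _ _ (hb _))))))
  refine (MvPolynomial.totalDegree_sub _ _).trans (max_le (by rw [MvPolynomial.totalDegree_C]; simp) ?_)
  refine (MvPolynomial.totalDegree_mul _ _).trans ?_
  rw [MvPolynomial.totalDegree_C]
  have := hb j
  omega

theorem totalDegree_one_sub_le (v : Fin 3 → Plane) (j : Fin 3) :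
    (1 - MvPolynomial.C 2 * barycentric v j).totalDegree ≤ 1 := by
  refine (MvPolynomial.totalDegree_sub _ _).trans (max_le (by simp) ?_)
  refine (MvPolynomial.totalDegree_mul _ _).trans ?_
  rw [MvPolynomial.totalDegree_C]
  have := totalDegree_barycentric_le v j
  omega

end

/-! ### Local interpolation -/

/-- The mean of the normal derivative of `f` over the segment from `a` to `b`. -/
def normalMean (a b : Plane) (f : Plane → ℝ) : ℝ :=
  ∫ s in (0 : ℝ)..1, ∑ k, unitNormal a b k * partialD k f (AffineMap.lineMap a b s)

/-- The mean of the second normal derivative of `f` over the segment from `a` to `b`. -/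
def normalTwoMean (a b : Plane) (f : Plane → ℝ) : ℝ :=
  ∫ s in (0 : ℝ)..1, ∑ k, ∑ l, unitNormal a b k * (unitNormal a b l *
    partialD k (partialD l f) (AffineMap.lineMap a b s))

theorem edgeNormal_eq_normalMean (a b : Plane) (p : Poly) :
    edgeNormal a b p = normalMean a b (polyEval p) := by
  simp only [edgeNormal, edgeMean, normalMean, dirD, polyEval_sum, polyEval_mul, polyEval_C,
    partialD_polyEval]

theorem edgeNormalTwo_eq_normalTwoMean (a b : Plane) (p : Poly) :
    edgeNormalTwo a b p = normalTwoMean a b (polyEval p) := by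
  simp only [edgeNormalTwo, edgeMean, normalTwoMean, dirD, polyEval_sum, polyEval_mul, polyEval_C,
    partialD_polyEval, map_sum, MvPolynomial.pderiv_C_mul, Finset.mul_sum]

theorem abs_integral_le_of_segment {a b : Plane} {g : Plane → ℝ} {A : ℝ}
    (h : ∀ x ∈ segment ℝ a b, |g x| ≤ A) :
    |∫ s in (0 : ℝ)..1, g (AffineMap.lineMap a b s)| ≤ A := by
  have := intervalIntegral.norm_integral_le_of_norm_le_const (a := (0 : ℝ)) (b := 1) (C := A)
    (f := fun s => g (AffineMap.lineMap a b s)) (fun s hs => ?_)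
  · simpa using this
  · rw [Set.uIoc_of_le zero_le_one] at hs
    refine h _ ?_
    rw [segment_eq_image_lineMap]
    exact ⟨s, ⟨hs.1.le, hs.2⟩, rfl⟩

theorem abs_normalMean_le {a b : Plane} (hab : a ≠ b) {f : Plane → ℝ} {A : ℝ}
    (h : ∀ k, ∀ x ∈ segment ℝ a b, |partialD k f x| ≤ A) : |normalMean a b f| ≤ 2 * A := by
  refine abs_integral_le_of_segment (g := fun x => ∑ k, unitNormal a b k * partialD k f x)
    fun x hx => ?_
  have hk : ∀ k, |unitNormal a b k * partialD k f x| ≤ A := fun k => by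
    rw [abs_mul]
    exact (mul_le_of_le_one_left (abs_nonneg _) (abs_unitNormal_le hab k)).trans (h k x hx)
  rw [Fin.sum_univ_two, two_mul]
  exact (abs_add_le _ _).trans (add_le_add (hk 0) (hk 1))

theorem abs_normalTwoMean_le {a b : Plane} (hab : a ≠ b) {f : Plane → ℝ} {A : ℝ}
    (h : ∀ k l, ∀ x ∈ segment ℝ a b, |partialD k (partialD l f) x| ≤ A) :
    |normalTwoMean a b f| ≤ 4 * A := by
  refine abs_integral_le_of_segment (g := fun x => ∑ k, ∑ l, unitNormal a b k *
    (unitNormal a b l * partialD k (partialD l f) x)) fun x hx => ?_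
  have hk : ∀ k l, |unitNormal a b k * (unitNormal a b l * partialD k (partialD l f) x)| ≤ A :=
    fun k l => by
      rw [abs_mul, abs_mul]
      exact (mul_le_of_le_one_left (by positivity) (abs_unitNormal_le hab k)).trans
        ((mul_le_of_le_one_left (abs_nonneg _) (abs_unitNormal_le hab l)).trans (h k l x hx))
  simp only [Fin.sum_univ_two]
  calc _ ≤ A + A + (A + A) := (abs_add_le _ _).trans (add_le_add
        ((abs_add_le _ _).trans (add_le_add (hk 0 0) (hk 0 1)))
        ((abs_add_le _ _).trans (add_le_add (hk 1 0) (hk 1 1))))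
    _ = 4 * A := by ring

theorem segment_subset_triangle (v : Fin 3 → Plane) (i j : Fin 3) :
    segment ℝ (v i) (v j) ⊆ convexHull ℝ (Set.range v) :=
  (convex_convexHull ℝ _).segment_subset (vertex_mem_triangle v i) (vertex_mem_triangle v j)

theorem order_single (k : Fin 2) : order (Pi.single k 1) = 1 := by
  rw [← zero_add (Pi.single k 1), order_add_single]; simp [order]

theorem polyD_single (k : Fin 2) (p : Poly) :
    polyD (Pi.single k 1) p = MvPolynomial.pderiv k p := by
  rw [← zero_add (Pi.single k 1), polyD_add_single, polyD_zero]

theorem polyD_single_add_single (k l : Fin 2) (p : Poly) :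
    polyD (Pi.single k 1 + Pi.single l 1) p =
      MvPolynomial.pderiv k (MvPolynomial.pderiv l p) := by
  rw [polyD_add_single, polyD_single]

section
variable {v : Fin 3 → Plane}

theorem ScaledBound.abs_edgeNormal_le (hD : dblArea v ≠ 0) {p : Poly} {A : ℝ}
    (hp : ScaledBound v p A) (i : Fin 3) : |edgeNormal (v (i + 1)) (v (i + 2)) p| *
      Metric.diam (convexHull ℝ (Set.range v)) ≤ 2 * A := by
  have hh := diam_triangle_pos hD
  rw [← le_div_iff₀ hh, mul_div_assoc, edgeNormal_eq_normalMean]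
  refine abs_normalMean_le (edge_ne hD i) fun k x hx => ?_
  rw [partialD_polyEval, le_div_iff₀ hh]
  have := hp (Pi.single k 1) (by rw [order_single]; simp) x (segment_subset_triangle v _ _ hx)
  rwa [order_single, pow_one, polyD_single] at this

theorem ScaledBound.abs_edgeNormalTwo_le (hD : dblArea v ≠ 0) {p : Poly} {A : ℝ}
    (hp : ScaledBound v p A) (i : Fin 3) : |edgeNormalTwo (v (i + 1)) (v (i + 2)) p| *
      Metric.diam (convexHull ℝ (Set.range v)) ^ 2 ≤ 4 * A := by
  have hh := diam_triangle_pos hD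
  rw [← le_div_iff₀ (by positivity), mul_div_assoc, edgeNormalTwo_eq_normalTwoMean]
  refine abs_normalTwoMean_le (edge_ne hD i) fun k l x hx => ?_
  rw [partialD_polyEval, partialD_polyEval, le_div_iff₀ (by positivity)]
  have ho : order (Pi.single k 1 + Pi.single l 1) = 2 := by
    rw [order_add_single, order_single]
  have := hp (Pi.single k 1 + Pi.single l 1) (by omega) x (segment_subset_triangle v _ _ hx)
  rwa [ho, polyD_single_add_single] at this

theorem edgeNormal_C_mul (a b : Plane) (c : ℝ) (p : Poly) :
    edgeNormal a b (MvPolynomial.C c * p) = c * edgeNormal a b p := by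
  rw [edgeNormal, dirD_C_mul, edgeMean_C_mul]; rfl

theorem edgeNormalTwo_C_mul (a b : Plane) (c : ℝ) (p : Poly) :
    edgeNormalTwo a b (MvPolynomial.C c * p) = c * edgeNormalTwo a b p := by
  rw [edgeNormalTwo, dirD_C_mul, dirD_C_mul, edgeMean_C_mul]; rfl

theorem edgeNormal_sum_bubble (hD : dblArea v ≠ 0) (a : Fin 3 → ℝ) (i : Fin 3) :
    edgeNormal (v (i + 1)) (v (i + 2)) (∑ j, MvPolynomial.C (a j) *
      (bubble v * (1 - MvPolynomial.C 2 * barycentric v j))) = a i * (baryNormal v i / 6) := by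
  rw [Fin.sum_univ_three]
  simp only [edgeNormal_add, edgeNormal_C_mul, edgeNormal_bubble_mul hD]
  fin_cases i <;> simp

theorem edgeNormal_sum_bubble_sq (hD : dblArea v ≠ 0) (a : Fin 3 → ℝ) (i : Fin 3) :
    edgeNormal (v (i + 1)) (v (i + 2)) (∑ j, MvPolynomial.C (a j) *
      (bubble v ^ 2 * (1 - MvPolynomial.C 2 * barycentric v j))) = 0 := by
  rw [Fin.sum_univ_three]
  simp only [edgeNormal_add, edgeNormal_C_mul, edgeNormal_bubble_sq_mul hD]
  simp

theorem edgeNormalTwo_sum_bubble_sq (hD : dblArea v ≠ 0) (a : Fin 3 → ℝ) (i : Fin 3) :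
    edgeNormalTwo (v (i + 1)) (v (i + 2)) (∑ j, MvPolynomial.C (a j) *
      (bubble v ^ 2 * (1 - MvPolynomial.C 2 * barycentric v j))) =
        a i * (baryNormal v i ^ 2 / 15) := by
  rw [Fin.sum_univ_three]
  simp only [edgeNormalTwo_add, edgeNormalTwo_C_mul, edgeNormalTwo_bubble_sq_mul hD]
  fin_cases i <;> simp

theorem sum_C_mul_bubble (a : Fin 3 → ℝ) (v : Fin 3 → Plane) (q : Poly) :
    ∑ j, MvPolynomial.C (a j) * (q * (1 - MvPolynomial.C 2 * barycentric v j)) =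
      q * ∑ j, MvPolynomial.C (a j) * (1 - MvPolynomial.C 2 * barycentric v j) := by
  rw [Finset.mul_sum]
  exact Finset.sum_congr rfl fun j _ => by ring

theorem totalDegree_sum_one_sub_le (a : Fin 3 → ℝ) (v : Fin 3 → Plane) :
    (∑ j, MvPolynomial.C (a j) * (1 - MvPolynomial.C 2 * barycentric v j)).totalDegree ≤ 1 := by
  refine (MvPolynomial.totalDegree_finsetSum _ _).trans (Finset.sup_le fun j _ => ?_)
  refine (MvPolynomial.totalDegree_mul _ _).trans ?_
  rw [MvPolynomial.totalDegree_C, zero_add]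
  exact totalDegree_one_sub_le v j

/-- On shape-regular triangles there is a uniform constant bounding all basis functions. -/
theorem exists_scaledBound_basis {c₀ : ℝ} (hc₀ : 0 ≤ c₀) :
    ∃ C, 0 ≤ C ∧ ∀ v : Fin 3 → Plane, dblArea v ≠ 0 →
      (∀ i k, |baryGrad v i k| * Metric.diam (convexHull ℝ (Set.range v)) ≤ c₀) → ∀ j,
      ScaledBound v (barycentric v j ^ 2 * (MvPolynomial.C 3 -
        MvPolynomial.C 2 * barycentric v j)) C ∧
      ScaledBound v (barycentric v j ^ 2 * barycentric v (j + 1)) C ∧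
      ScaledBound v (barycentric v j ^ 2 * barycentric v (j + 2)) C ∧
      ScaledBound v (bubble v * (1 - MvPolynomial.C 2 * barycentric v j)) C ∧
      ScaledBound v (bubble v ^ 2 * (1 - MvPolynomial.C 2 * barycentric v j)) C := by
  let F : Fin 5 → Fin 3 → MvPolynomial (Fin 3) ℝ := fun m j => ![
    MvPolynomial.X j ^ 2 * (MvPolynomial.C 3 - MvPolynomial.C 2 * MvPolynomial.X j),
    MvPolynomial.X j ^ 2 * MvPolynomial.X (j + 1),
    MvPolynomial.X j ^ 2 * MvPolynomial.X (j + 2),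
    (∏ i, MvPolynomial.X i) * (1 - MvPolynomial.C 2 * MvPolynomial.X j),
    (∏ i, MvPolynomial.X i) ^ 2 * (1 - MvPolynomial.C 2 * MvPolynomial.X j)] m
  choose C hC0 hC using fun m j => exists_scaledBound_baryPoly hc₀ (F m j)
  have hle : ∀ m j, C m j ≤ ∑ m, ∑ j, C m j := fun m j =>
    (Finset.single_le_sum (f := C m) (fun j _ => hC0 m j) (Finset.mem_univ j)).trans
      (Finset.single_le_sum (f := fun m => ∑ j, C m j)
        (fun m _ => Finset.sum_nonneg fun j _ => hC0 m j) (Finset.mem_univ m))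
  refine ⟨∑ m, ∑ j, C m j, Finset.sum_nonneg fun m _ => Finset.sum_nonneg fun j _ => hC0 m j, ?_⟩
  intro v hD hb j
  have h : ∀ m, ScaledBound v (baryPoly v (F m j)) (∑ m, ∑ j, C m j) := fun m =>
    (hC m j v hD hb).mono (hle m j)
  refine ⟨?_, ?_, ?_, ?_, ?_⟩
  · simpa [F, baryPoly, MvPolynomial.algebraMap_eq] using h 0
  · simpa [F, baryPoly, MvPolynomial.algebraMap_eq] using h 1
  · simpa [F, baryPoly, MvPolynomial.algebraMap_eq] using h 2
  · simpa [F, baryPoly, MvPolynomial.algebraMap_eq, bubble] using h 3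
  · simpa [F, baryPoly, MvPolynomial.algebraMap_eq, bubble] using h 4

theorem scaledBound_hermite {C B : ℝ} (hB : 0 ≤ B)
    (hC : ∀ j, ScaledBound v (barycentric v j ^ 2 * (MvPolynomial.C 3 -
        MvPolynomial.C 2 * barycentric v j)) C ∧
      ScaledBound v (barycentric v j ^ 2 * barycentric v (j + 1)) C ∧
      ScaledBound v (barycentric v j ^ 2 * barycentric v (j + 2)) C)
    {d : Fin 3 → ℝ} {e : Fin 3 → Fin 2 → ℝ} (hd : ∀ j, |d j| ≤ B)
    (he : ∀ j k, |e j k| * Metric.diam (convexHull ℝ (Set.range v)) ≤ B) :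
    ScaledBound v (hermite v d e) (15 * (B * C)) := by
  have hs : ∀ j m, |∑ k, e j k * (v m k - v j k)| ≤ 2 * B := by
    intro j m
    have hk : ∀ k, |e j k * (v m k - v j k)| ≤ B := fun k => by
      rw [abs_mul]
      refine le_trans ?_ (he j k)
      gcongr
      exact (abs_coord_sub_le _ _ _).trans
        (dist_le_diam_triangle (vertex_mem_triangle v _) (vertex_mem_triangle v _))
    rw [Fin.sum_univ_two, two_mul]
    exact (abs_add_le _ _).trans (add_le_add (hk 0) (hk 1))
  -- The value terms contribute `3 B C`; each of the two gradient sums contributes `6 B C`, its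
  -- coefficients being bounded by `2 B`.
  have h := (ScaledBound.sum fun j => (hC j).1.C_mul (hd j) hB).add
    ((ScaledBound.sum fun j => (hC j).2.1.C_mul (hs j (j + 1)) (by positivity)).add
      (ScaledBound.sum fun j => (hC j).2.2.C_mul (hs j (j + 2)) (by positivity)))
  exact h.mono (le_of_eq (by ring))

/-- Existence of a shape function with prescribed degrees of freedom, with a scaled bound. -/
theorem exists_shape_interpolant {c₀ : ℝ} (hc₀ : 0 ≤ c₀) :
    ∃ C, 0 ≤ C ∧ ∀ v : Fin 3 → Plane, dblArea v ≠ 0 →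
      (∀ i k, |baryGrad v i k| * Metric.diam (convexHull ℝ (Set.range v)) ≤ c₀) →
      ∀ (d : Fin 3 → ℝ) (e : Fin 3 → Fin 2 → ℝ) (n₁ n₂ : Fin 3 → ℝ) (B : ℝ), 0 ≤ B →
      (∀ j, |d j| ≤ B) →
      (∀ j k, |e j k| * Metric.diam (convexHull ℝ (Set.range v)) ≤ B) →
      (∀ j, |n₁ j| * Metric.diam (convexHull ℝ (Set.range v)) ≤ B) →
      (∀ j, |n₂ j| * Metric.diam (convexHull ℝ (Set.range v)) ^ 2 ≤ B) →
      ∃ p ∈ shapeSpace v, (∀ j, polyEval p (v j) = d j) ∧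
        (∀ j k, polyEval (MvPolynomial.pderiv k p) (v j) = e j k) ∧
        (∀ j, edgeNormal (v (j + 1)) (v (j + 2)) p = n₁ j) ∧
        (∀ j, edgeNormalTwo (v (j + 1)) (v (j + 2)) p = n₂ j) ∧ ScaledBound v p (C * B) := by
  obtain ⟨C, hC0, hC⟩ := exists_scaledBound_basis hc₀
  -- In units of `B`, `D₁` bounds the Hermite part and `D₂` its sum with the first correction. The
  -- coefficients are bounded by `A₁ = 6 · 2 · (1 + 2 D₁)` and `A₂ = 15 · 2² · (1 + 4 D₂)`: 6 and 15
  -- invert the diagonal values, each division by `baryNormal` costs twice the diameter, and the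
  -- brackets bound data minus current edge mean.
  obtain ⟨D₁, hD₁⟩ : ∃ D₁, D₁ = 15 * C := ⟨_, rfl⟩
  obtain ⟨A₁, hA₁⟩ : ∃ A₁, A₁ = 12 * (1 + 2 * D₁) := ⟨_, rfl⟩
  obtain ⟨D₂, hD₂⟩ : ∃ D₂, D₂ = D₁ + 3 * (A₁ * C) := ⟨_, rfl⟩
  obtain ⟨A₂, hA₂⟩ : ∃ A₂, A₂ = 60 * (1 + 4 * D₂) := ⟨_, rfl⟩
  have hD₁0 : 0 ≤ D₁ := by rw [hD₁]; positivity
  have hA₁0 : 0 ≤ A₁ := by rw [hA₁]; positivity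
  have hD₂0 : 0 ≤ D₂ := by rw [hD₂]; positivity
  have hA₂0 : 0 ≤ A₂ := by rw [hA₂]; positivity
  refine ⟨D₂ + 3 * (A₂ * C), by positivity, ?_⟩
  intro v hD hb d e n₁ n₂ B hB hd he hn₁ hn₂
  have hbasis := hC v hD hb
  set h := Metric.diam (convexHull ℝ (Set.range v)) with hh
  have hh0 : 0 ≤ h := Metric.diam_nonneg
  have hp₁ : ScaledBound v (hermite v d e) (D₁ * B) :=
    (scaledBound_hermite hB (fun j => ⟨(hbasis j).1, (hbasis j).2.1, (hbasis j).2.2.1⟩)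
      hd he).mono (le_of_eq (by rw [hD₁]; ring))
  set p₁ := hermite v d e
  set a : Fin 3 → ℝ := fun j =>
    6 * (n₁ j - edgeNormal (v (j + 1)) (v (j + 2)) p₁) / baryNormal v j with ha
  have ha_le : ∀ j, |a j| ≤ A₁ * B := by
    intro j
    refine (abs_div_baryNormal_le hD j _).trans ?_
    rw [abs_mul, abs_of_pos (by norm_num : (0 : ℝ) < 6)]
    have h1 := hp₁.abs_edgeNormal_le hD j
    have h2 := mul_le_mul_of_nonneg_right (abs_sub (n₁ j)
      (edgeNormal (v (j + 1)) (v (j + 2)) p₁)) hh0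
    have h3 := hn₁ j
    rw [add_mul] at h2
    rw [hA₁]
    nlinarith
  set p₂ : Poly := ∑ j, MvPolynomial.C (a j) *
    (bubble v * (1 - MvPolynomial.C 2 * barycentric v j)) with hp₂
  have hp₁₂ : ScaledBound v (p₁ + p₂) (D₂ * B) :=
    (hp₁.add (ScaledBound.sum fun j => (hbasis j).2.2.2.1.C_mul (ha_le j)
      (by positivity))).mono (le_of_eq (by rw [hD₂]; ring))
  -- The system is triangular: the first correction alters the second normal means, so these are
  -- corrected last, relative to `p₁ + p₂`.
  set b : Fin 3 → ℝ := fun j =>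
    15 * (n₂ j - edgeNormalTwo (v (j + 1)) (v (j + 2)) (p₁ + p₂)) / baryNormal v j /
      baryNormal v j with hb'
  have hb_le : ∀ j, |b j| ≤ A₂ * B := by
    intro j
    refine (abs_div_baryNormal_le hD j _).trans ?_
    have h0 := mul_le_mul_of_nonneg_right (abs_div_baryNormal_le hD j
      (15 * (n₂ j - edgeNormalTwo (v (j + 1)) (v (j + 2)) (p₁ + p₂)))) hh0
    rw [abs_mul, abs_of_pos (by norm_num : (0 : ℝ) < 15)] at h0
    have h1 := hp₁₂.abs_edgeNormalTwo_le hD j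
    have h2 := mul_le_mul_of_nonneg_right (abs_sub (n₂ j)
      (edgeNormalTwo (v (j + 1)) (v (j + 2)) (p₁ + p₂))) (sq_nonneg h)
    have h3 := hn₂ j
    rw [add_mul] at h2
    rw [hA₂]
    nlinarith
  set p₃ : Poly := ∑ j, MvPolynomial.C (b j) *
    (bubble v ^ 2 * (1 - MvPolynomial.C 2 * barycentric v j)) with hp₃
  have hp₂' : p₂ = bubble v * ∑ j, MvPolynomial.C (a j) *
      (1 - MvPolynomial.C 2 * barycentric v j) := sum_C_mul_bubble a v _
  have hp₃' : p₃ = bubble v ^ 2 * ∑ j, MvPolynomial.C (b j) *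
      (1 - MvPolynomial.C 2 * barycentric v j) := sum_C_mul_bubble b v _
  have hp₃'' : p₃ = bubble v * (bubble v * ∑ j, MvPolynomial.C (b j) *
      (1 - MvPolynomial.C 2 * barycentric v j)) := by rw [hp₃']; ring
  refine ⟨p₁ + p₂ + p₃, ?_, ?_, ?_, ?_, ?_, ?_⟩
  · exact mem_shapeSpace.2 ⟨p₁, _, _, totalDegree_hermite_le v d e, totalDegree_sum_one_sub_le a v,
      totalDegree_sum_one_sub_le b v, by rw [hp₂', hp₃']⟩
  · intro j
    rw [polyEval_add, polyEval_add, hermite_vertex hD, hp₂', hp₃'', (bubble_vertex hD j _).1,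
      (bubble_vertex hD j _).1, add_zero, add_zero]
  · intro j k
    rw [map_add, map_add, polyEval_add, polyEval_add, pderiv_hermite_vertex hD, hp₂', hp₃'',
      (bubble_vertex hD j _).2, (bubble_vertex hD j _).2, add_zero, add_zero]
  · intro j
    have := baryNormal_ne_zero hD j
    rw [edgeNormal_add, edgeNormal_add, hp₂, hp₃, edgeNormal_sum_bubble hD,
      edgeNormal_sum_bubble_sq hD, ha]
    field_simp
    ring
  · intro j
    have := baryNormal_ne_zero hD j
    rw [edgeNormalTwo_add, hp₃, edgeNormalTwo_sum_bubble_sq hD, hb']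
    field_simp
    ring
  · exact (hp₁₂.add (ScaledBound.sum fun j => (hbasis j).2.2.2.2.C_mul (hb_le j)
      (by positivity))).mono (le_of_eq (by ring))

end

/-! ### Taylor polynomials -/

theorem partialD_sub {f g : Plane → ℝ} (hf : ContDiff ℝ ∞ f) (hg : ContDiff ℝ ∞ g) (i : Fin 2) :
    partialD i (fun x => f x - g x) = fun x => partialD i f x - partialD i g x := by
  ext x
  have h1 := (hf.differentiable (by simp)).differentiableAt (x := x)
  have h2 := (hg.differentiable (by simp)).differentiableAt (x := x)
  simp only [partialD, fderiv_fun_sub h1 h2, sub_apply]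

theorem multiD_sub (α : MultiIndex) {f g : Plane → ℝ} (hf : ContDiff ℝ ∞ f)
    (hg : ContDiff ℝ ∞ g) :
    multiD α (fun x => f x - g x) = fun x => multiD α f x - multiD α g x := by
  induction h : order α generalizing α f g with
  | zero => simp only [order_eq_zero h, multiD_zero]
  | succ n ih =>
    obtain ⟨β, i, rfl, hβ⟩ := exists_eq_add_single h
    rw [multiD_add_single β i (hf.sub hg), multiD_add_single β i hf, multiD_add_single β i hg,
      partialD_sub hf hg, ih β (contDiff_partialD i hf) (contDiff_partialD i hg) hβ]

/-- The truncated subtraction in `m - k` is harmless: for `k > m` the descending factorial is zero.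
-/
theorem iterate_pderiv_shift (i : Fin 2) (a : ℝ) (m k : ℕ) {q : Poly}
    (hq : MvPolynomial.pderiv i q = 0) :
    (fun r : Poly => MvPolynomial.pderiv i r)^[k]
        ((MvPolynomial.X i - MvPolynomial.C a) ^ m * q) =
      MvPolynomial.C (m.descFactorial k : ℝ) *
        ((MvPolynomial.X i - MvPolynomial.C a) ^ (m - k) * q) := by
  induction k with
  | zero => simp
  | succ k ih =>
    rw [Function.iterate_succ_apply', ih]
    simp only [MvPolynomial.pderiv_mul, MvPolynomial.pderiv_pow, hq,
      map_sub, MvPolynomial.pderiv_X_self, MvPolynomial.pderiv_C]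
    rw [Nat.descFactorial_succ, Nat.sub_sub, Nat.cast_mul, map_mul]
    have : ((m - k : ℕ) : Poly) = MvPolynomial.C ((m - k : ℕ) : ℝ) := by simp
    rw [this]
    ring

theorem polyD_shift (x₀ : Plane) (m n : ℕ) (β : MultiIndex) :
    polyD β ((MvPolynomial.X 0 - MvPolynomial.C (x₀ 0)) ^ m *
      (MvPolynomial.X 1 - MvPolynomial.C (x₀ 1)) ^ n) =
    MvPolynomial.C ((n.descFactorial (β 1) : ℝ) * (m.descFactorial (β 0) : ℝ)) *
      ((MvPolynomial.X 0 - MvPolynomial.C (x₀ 0)) ^ (m - β 0) *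
        (MvPolynomial.X 1 - MvPolynomial.C (x₀ 1)) ^ (n - β 1)) := by
  have h01 : ∀ m, MvPolynomial.pderiv (1 : Fin 2)
      ((MvPolynomial.X 0 - MvPolynomial.C (x₀ 0)) ^ m : Poly) = 0 := fun m => by
    rw [MvPolynomial.pderiv_pow, map_sub, MvPolynomial.pderiv_X_of_ne (by decide),
      MvPolynomial.pderiv_C]
    simp
  have h10 : ∀ c n, MvPolynomial.pderiv (0 : Fin 2)
      (MvPolynomial.C c * (MvPolynomial.X 1 - MvPolynomial.C (x₀ 1)) ^ n : Poly) = 0 :=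
    fun c n => by
      rw [MvPolynomial.pderiv_C_mul, MvPolynomial.pderiv_pow, map_sub,
        MvPolynomial.pderiv_X_of_ne (by decide), MvPolynomial.pderiv_C]
      simp
  rw [polyD, mul_comm, iterate_pderiv_shift 1 _ n _ (h01 m)]
  rw [show MvPolynomial.C (n.descFactorial (β 1) : ℝ) *
      ((MvPolynomial.X 1 - MvPolynomial.C (x₀ 1)) ^ (n - β 1) *
        (MvPolynomial.X 0 - MvPolynomial.C (x₀ 0)) ^ m) =
      ((MvPolynomial.X 0 - MvPolynomial.C (x₀ 0)) ^ m *
        (MvPolynomial.C (n.descFactorial (β 1) : ℝ) *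
          (MvPolynomial.X 1 - MvPolynomial.C (x₀ 1)) ^ (n - β 1)) : Poly) by ring,
    iterate_pderiv_shift 0 _ m _ (h10 _ _), map_mul]
  ring

theorem polyEval_polyD_shift (x₀ : Plane) (α β : MultiIndex) :
    polyEval (polyD β ((MvPolynomial.X 0 - MvPolynomial.C (x₀ 0)) ^ α 0 *
      (MvPolynomial.X 1 - MvPolynomial.C (x₀ 1)) ^ α 1)) x₀ =
        if α = β then ((α 0).factorial * (α 1).factorial : ℝ) else 0 := by
  rw [polyD_shift]
  simp only [polyEval_mul, polyEval_C, polyEval_pow, polyEval_sub, polyEval_X, sub_self]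
  split_ifs with h
  · subst h; simp [Nat.descFactorial_self, mul_comm]
  · have h' : ∃ i, α i ≠ β i := by
      by_contra hc
      push Not at hc
      exact h (funext hc)
    have key : ∀ a b : ℕ, a ≠ b → (a.descFactorial b : ℝ) * (0 : ℝ) ^ (a - b) = 0 := by
      intro a b hab
      rcases lt_or_gt_of_ne hab with h | h
      · simp [Nat.descFactorial_of_lt h]
      · rw [zero_pow (by omega), mul_zero]
    obtain ⟨i, hi⟩ := h'
    have := key _ _ hi
    fin_cases i
    · simp only [Fin.zero_eta] at this; linear_combination
        (((α 1).descFactorial (β 1) : ℝ) * 0 ^ (α 1 - β 1)) * this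
    · simp only [Fin.mk_one] at this; linear_combination
        (((α 0).descFactorial (β 0) : ℝ) * 0 ^ (α 0 - β 0)) * this

/-- The cubic with prescribed derivatives at a point. -/
theorem exists_taylor_poly (x₀ : Plane) (c : MultiIndex → ℝ) :
    ∃ P : Poly, P.totalDegree ≤ 3 ∧
      (∀ β, order β ≤ 3 → polyEval (polyD β P) x₀ = c β) ∧
      ∀ β, order β = 4 → polyD β P = 0 := by
  refine ⟨∑ α ∈ multiIndices 3, MvPolynomial.C (c α / ((α 0).factorial * (α 1).factorial)) *
    ((MvPolynomial.X 0 - MvPolynomial.C (x₀ 0)) ^ α 0 *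
      (MvPolynomial.X 1 - MvPolynomial.C (x₀ 1)) ^ α 1), ?_, ?_, ?_⟩
  · refine (MvPolynomial.totalDegree_finsetSum _ _).trans (Finset.sup_le fun α hα => ?_)
    have hα' : order α ≤ 3 := mem_multiIndices.1 hα
    rw [order_eq] at hα'
    have hl : ∀ i : Fin 2, (MvPolynomial.X i - MvPolynomial.C (x₀ i) : Poly).totalDegree ≤ 1 :=
      fun i => (MvPolynomial.totalDegree_sub _ _).trans (by simp)
    have hp : ∀ (i : Fin 2) n,
        ((MvPolynomial.X i - MvPolynomial.C (x₀ i) : Poly) ^ n).totalDegree ≤ n := fun i n =>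
      (MvPolynomial.totalDegree_pow _ _).trans (by nlinarith [hl i])
    refine (MvPolynomial.totalDegree_mul _ _).trans ?_
    rw [MvPolynomial.totalDegree_C, zero_add]
    refine (MvPolynomial.totalDegree_mul _ _).trans ?_
    have := hp 0 (α 0)
    have := hp 1 (α 1)
    omega
  · intro β hβ
    rw [polyD_sum, polyEval_sum]
    simp only [polyD_C_mul, polyEval_mul (MvPolynomial.C _), polyEval_C, polyEval_polyD_shift,
      mul_ite, mul_zero]
    rw [Finset.sum_ite_eq', if_pos (mem_multiIndices.2 hβ)]
    have h0 := Nat.factorial_ne_zero (β 0)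
    have h1 := Nat.factorial_ne_zero (β 1)
    field_simp
  · intro β hβ
    rw [polyD_sum]
    refine Finset.sum_eq_zero fun α hα => ?_
    have hα' : order α ≤ 3 := mem_multiIndices.1 hα
    rw [order_eq] at hα' hβ
    rw [polyD_C_mul, polyD_shift]
    -- Since `|α| ≤ 3 < |β|`, some component of `β` exceeds that of `α` and the monomial is
    -- differentiated away.
    rcases lt_or_ge (α 0) (β 0) with h | h
    · simp [Nat.descFactorial_of_lt h]
    · simp [Nat.descFactorial_of_lt (show α 1 < β 1 by omega)]

theorem abs_sub_le_of_partialD_le {K : Set Plane} (hK : Convex ℝ K) {g : Plane → ℝ}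
    (hg : ContDiff ℝ ∞ g) {A : ℝ} (h : ∀ i, ∀ x ∈ K, |partialD i g x| ≤ A) {x y : Plane}
    (hx : x ∈ K) (hy : y ∈ K) : |g y - g x| ≤ 2 * A * dist x y := by
  have hA : 0 ≤ A := (abs_nonneg _).trans (h 0 x hx)
  have := hK.norm_image_sub_le_of_norm_fderiv_le (𝕜 := ℝ) (f := g) (C := 2 * A)
    (fun z _ => (hg.differentiable (by simp)).differentiableAt) (fun z hz => ?_) hx hy
  · rwa [Real.norm_eq_abs, ← dist_eq_norm, dist_comm y x] at this
  · refine ContinuousLinearMap.opNorm_le_bound _ (by positivity) fun u => ?_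
    rw [fderiv_apply_eq_sum, Real.norm_eq_abs, Fin.sum_univ_two]
    have hu : ∀ i, |u i| ≤ ‖u‖ := fun i => by
      simpa using PiLp.norm_apply_le u i
    have hk : ∀ i, |partialD i g z * u i| ≤ A * ‖u‖ := fun i => by
      rw [abs_mul]
      exact mul_le_mul (h i z hz) (hu i) (abs_nonneg _) hA
    exact (abs_add_le _ _).trans ((add_le_add (hk 0) (hk 1)).trans (le_of_eq (by ring)))

/-- Downward induction from order four: a derivative vanishing at `x₀` is controlled by its two
partial derivatives along the segment from `x₀`, which gains a factor `2 h` per order. -/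
theorem abs_multiD_le_of_vanishing {K : Set Plane} (hK : Convex ℝ K) {F : Plane → ℝ}
    (hF : ContDiff ℝ ∞ F) {x₀ : Plane} (hx₀ : x₀ ∈ K) {h M : ℝ} (hM : 0 ≤ M)
    (hh : ∀ x ∈ K, dist x₀ x ≤ h) (h0 : ∀ α, order α ≤ 3 → multiD α F x₀ = 0)
    (h4 : ∀ α, order α = 4 → ∀ x ∈ K, |multiD α F x| ≤ M) (m : ℕ) :
    ∀ α, order α + m = 4 → ∀ x ∈ K, |multiD α F x| ≤ M * (2 * h) ^ m := by
  have hh0 : 0 ≤ h := dist_nonneg.trans (hh x₀ hx₀)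
  induction m with
  | zero => intro α hα x hx; simpa using h4 α hα x hx
  | succ m ih =>
    intro α hα x hx
    have := abs_sub_le_of_partialD_le hK (contDiff_multiD α hF) (A := M * (2 * h) ^ m)
      (fun i y hy => by
        rw [partialD_multiD α i hF]
        exact ih _ (by rw [order_add_single]; omega) y hy) hx₀ hx
    rw [h0 α (by omega), sub_zero] at this
    calc _ ≤ _ := this
      _ ≤ 2 * (M * (2 * h) ^ m) * h := by gcongr; exact hh x hx
      _ = _ := by ring

theorem exists_bound_multiD {K : Set Plane} (hK : IsCompact K) {φ : Plane → ℝ}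
    (hφ : ContDiff ℝ ∞ φ) (n : ℕ) :
    ∃ M, 0 ≤ M ∧ ∀ α, order α ≤ n → ∀ x ∈ K, |multiD α φ x| ≤ M := by
  choose C hC using fun α => hK.exists_bound_of_continuousOn
    (contDiff_multiD α hφ).continuous.continuousOn
  refine ⟨∑ α ∈ multiIndices n, |C α|, Finset.sum_nonneg fun _ _ => abs_nonneg _, ?_⟩
  intro α hα x hx
  exact (hC α x hx).trans ((le_abs_self _).trans (Finset.single_le_sum (f := fun α => |C α|)
    (fun _ _ => abs_nonneg _) (mem_multiIndices.2 hα)))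

/-! ### Interpolation of smooth functions -/

theorem unitNormal_symm (a b : Plane) (k : Fin 2) : unitNormal b a k = -unitNormal a b k := by
  simp only [unitNormal, PiLp.smul_apply, smul_eq_mul, dist_comm b a]
  fin_cases k <;> simp <;> ring

theorem integral_lineMap_symm (a b : Plane) (g : Plane → ℝ) :
    ∫ s in (0 : ℝ)..1, g (AffineMap.lineMap b a s) =
      ∫ s in (0 : ℝ)..1, g (AffineMap.lineMap a b s) := by
  have h := intervalIntegral.integral_comp_sub_left (a := 0) (b := 1)
    (fun s => g (AffineMap.lineMap a b s)) (1 : ℝ)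
  simp only [sub_self, sub_zero] at h
  rw [← h]
  simp only [AffineMap.lineMap_apply_one_sub]

theorem normalMean_symm (a b : Plane) (f : Plane → ℝ) :
    normalMean b a f = -normalMean a b f := by
  have := integral_lineMap_symm a b (fun x => ∑ k, unitNormal b a k * partialD k f x)
  rw [normalMean, this, normalMean, ← intervalIntegral.integral_neg]
  simp only [unitNormal_symm a b, neg_mul, Finset.sum_neg_distrib]

theorem normalTwoMean_symm (a b : Plane) (f : Plane → ℝ) :
    normalTwoMean b a f = normalTwoMean a b f := by
  have := integral_lineMap_symm a b (fun x => ∑ k, ∑ l, unitNormal b a k * (unitNormal b a l *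
    partialD k (partialD l f) x))
  rw [normalTwoMean, this, normalTwoMean]
  simp only [unitNormal_symm a b, neg_mul, mul_neg, neg_neg]

theorem normalMean_sub (a b : Plane) {f g : Plane → ℝ} (hf : ContDiff ℝ ∞ f)
    (hg : ContDiff ℝ ∞ g) :
    normalMean a b (fun x => f x - g x) = normalMean a b f - normalMean a b g := by
  have hc : ∀ {f : Plane → ℝ}, ContDiff ℝ ∞ f → IntervalIntegrable (fun s : ℝ =>
      ∑ k, unitNormal a b k * partialD k f (AffineMap.lineMap a b s)) volume 0 1 := fun hf =>
    (continuous_finsetSum _ fun k _ => continuous_const.mul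
      ((contDiff_partialD k hf).continuous.comp AffineMap.lineMap_continuous)).intervalIntegrable _ _
  simp only [normalMean]
  rw [← intervalIntegral.integral_sub (hc hf) (hc hg)]
  simp only [partialD_sub hf hg, mul_sub, Finset.sum_sub_distrib]

theorem normalTwoMean_sub (a b : Plane) {f g : Plane → ℝ} (hf : ContDiff ℝ ∞ f)
    (hg : ContDiff ℝ ∞ g) :
    normalTwoMean a b (fun x => f x - g x) = normalTwoMean a b f - normalTwoMean a b g := by
  have hc : ∀ {f : Plane → ℝ}, ContDiff ℝ ∞ f → IntervalIntegrable (fun s : ℝ =>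
      ∑ k, ∑ l, unitNormal a b k * (unitNormal a b l *
        partialD k (partialD l f) (AffineMap.lineMap a b s))) volume 0 1 := fun hf =>
    (continuous_finsetSum _ fun k _ => continuous_finsetSum _ fun l _ => continuous_const.mul
      (continuous_const.mul ((contDiff_partialD k (contDiff_partialD l hf)).continuous.comp
        AffineMap.lineMap_continuous))).intervalIntegrable _ _
  simp only [normalTwoMean]
  rw [← intervalIntegral.integral_sub (hc hf) (hc hg)]
  simp only [partialD_sub hf hg, partialD_sub (contDiff_partialD _ hf) (contDiff_partialD _ hg),
    mul_sub, Finset.sum_sub_distrib]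

theorem multiD_single (k : Fin 2) {f : Plane → ℝ} (hf : ContDiff ℝ ∞ f) :
    multiD (Pi.single k 1) f = partialD k f := by
  rw [← zero_add (Pi.single k 1), multiD_add_single _ _ hf, multiD_zero]

theorem multiD_single_add_single (k l : Fin 2) {f : Plane → ℝ} (hf : ContDiff ℝ ∞ f) :
    multiD (Pi.single k 1 + Pi.single l 1) f = partialD k (partialD l f) := by
  rw [multiD_add_single _ _ hf, multiD_single _ (contDiff_partialD l hf)]

/-- The shape function `p` on the triangle `v` has the degrees of freedom of `φ`. -/
structure LocalInterpolant (v : Fin 3 → Plane) (φ : Plane → ℝ) (p : Poly) : Prop where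
  mem_shapeSpace : p ∈ shapeSpace v
  value : ∀ a ∈ Set.range v, polyEval p a = φ a
  gradient : ∀ a ∈ Set.range v, ∀ k, polyEval (MvPolynomial.pderiv k p) a = partialD k φ a
  normal : ∀ a ∈ Set.range v, ∀ b ∈ Set.range v, a ≠ b → edgeNormal a b p = normalMean a b φ
  normalTwo : ∀ a ∈ Set.range v, ∀ b ∈ Set.range v, a ≠ b →
    edgeNormalTwo a b p = normalTwoMean a b φ

/-- The cyclic list of opposite edges contains each edge in one orientation only, hence the symmetry
hypothesis. -/
theorem forall_edge {v : Fin 3 → Plane} {P : Plane → Plane → Prop}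
    (hs : ∀ a b, P a b → P b a) (h : ∀ j : Fin 3, P (v (j + 1)) (v (j + 2))) :
    ∀ a ∈ Set.range v, ∀ b ∈ Set.range v, a ≠ b → P a b := by
  rintro _ ⟨i, rfl⟩ _ ⟨j, rfl⟩ hij
  have h0 := h 0
  have h1 := h 1
  have h2 := h 2
  simp only [zero_add, show (1 : Fin 3) + 1 = 2 from rfl, show (1 : Fin 3) + 2 = 0 from rfl,
    show (2 : Fin 3) + 1 = 0 from rfl, show (2 : Fin 3) + 2 = 1 from rfl] at h0 h1 h2
  fin_cases i <;> fin_cases j <;> simp at hij ⊢ <;>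
    first | assumption | exact hs _ _ (by assumption)

/-- The cubic Taylor polynomial `P` is itself a shape function, so it suffices to interpolate the
remainder `F = φ - P`, all of whose scaled derivatives up to order three are bounded by `16 M h⁴`.
-/
theorem exists_localInterpolant {c₀ : ℝ} (hc₀ : 0 ≤ c₀) :
    ∃ C, 0 ≤ C ∧ ∀ v : Fin 3 → Plane, dblArea v ≠ 0 →
      (∀ i k, |baryGrad v i k| * Metric.diam (convexHull ℝ (Set.range v)) ≤ c₀) →
      ∀ (φ : Plane → ℝ) (M : ℝ), ContDiff ℝ ∞ φ → 0 ≤ M →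
      (∀ α, order α = 4 → ∀ x ∈ convexHull ℝ (Set.range v), |multiD α φ x| ≤ M) →
      ∃ p, LocalInterpolant v φ p ∧ ∀ α, order α ≤ 3 → ∀ x ∈ convexHull ℝ (Set.range v),
        |multiD α φ x - polyEval (polyD α p) x| ≤
          C * M * Metric.diam (convexHull ℝ (Set.range v)) ^ (4 - order α) := by
  obtain ⟨C, hC0, hC⟩ := exists_shape_interpolant hc₀
  refine ⟨16 + 64 * C, by positivity, ?_⟩
  intro v hD hb φ M hφ hM h4
  obtain ⟨P, hPdeg, hP3, hP4⟩ := exists_taylor_poly (v 0) (fun α => multiD α φ (v 0))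
  have hPs := contDiff_polyEval P
  set F : Plane → ℝ := fun x => φ x - polyEval P x with hFdef
  have hF : ContDiff ℝ ∞ F := hφ.sub hPs
  have hFD : ∀ α x, multiD α F x = multiD α φ x - polyEval (polyD α P) x := by
    intro α x
    rw [hFdef, multiD_sub α hφ hPs, multiD_polyEval]
  have hh := diam_triangle_pos hD
  set h := Metric.diam (convexHull ℝ (Set.range v)) with hhdef
  set B : ℝ := 16 * M * h ^ 4 with hB
  have hB0 : 0 ≤ B := by positivity
  have hFb : ∀ α, order α ≤ 3 → ∀ x ∈ convexHull ℝ (Set.range v),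
      |multiD α F x| * h ^ order α ≤ B := by
    intro α hα x hx
    have h1 := abs_multiD_le_of_vanishing (convex_convexHull ℝ (Set.range v)) hF
      (vertex_mem_triangle v 0) hM
      (fun y hy => dist_le_diam_triangle (vertex_mem_triangle v 0) hy)
      (fun α hα => by rw [hFD, hP3 α hα, sub_self])
      (fun α hα y hy => by
        rw [hFD, hP4 α hα, polyEval_zero, sub_zero]
        exact h4 α hα y hy) (4 - order α) α (by omega) x hx
    have h2 : (2 : ℝ) ^ (4 - order α) ≤ 2 ^ 4 :=
      pow_le_pow_right₀ (by norm_num) (by omega)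
    calc |multiD α F x| * h ^ order α ≤ M * (2 * h) ^ (4 - order α) * h ^ order α := by gcongr
      _ = 2 ^ (4 - order α) * M * (h ^ (4 - order α) * h ^ order α) := by rw [mul_pow]; ring
      _ = 2 ^ (4 - order α) * M * h ^ 4 := by rw [← pow_add, Nat.sub_add_cancel (by omega)]
      _ ≤ 2 ^ 4 * M * h ^ 4 := by gcongr
      _ = B := by rw [hB]; norm_num
  have hF0 : ∀ x ∈ convexHull ℝ (Set.range v), |F x| ≤ B := by
    intro x hx
    simpa [order, multiD_zero] using hFb 0 (by simp [order]) x hx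
  have hF1 : ∀ k, ∀ x ∈ convexHull ℝ (Set.range v), |partialD k F x| ≤ B / h := by
    intro k x hx
    rw [le_div_iff₀ hh]
    simpa [order_single, multiD_single k hF] using hFb (Pi.single k 1) (by simp [order_single]) x hx
  have hF2 : ∀ k l, ∀ x ∈ convexHull ℝ (Set.range v),
      |partialD k (partialD l F) x| ≤ B / h ^ 2 := by
    intro k l x hx
    rw [le_div_iff₀ (by positivity)]
    have ho : order (Pi.single k 1 + Pi.single l 1) = 2 := by rw [order_add_single, order_single]
    have := hFb (Pi.single k 1 + Pi.single l 1) (by omega) x hx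
    rwa [ho, multiD_single_add_single k l hF] at this
  -- The bound `4 B` covers all the data: factors 1 for values and gradients, 2 for first normal
  -- means and 4 for second ones.
  obtain ⟨q, hq, hq0, hq1, hqn, hqn2, hqb⟩ := hC v hD hb (fun j => F (v j))
    (fun j k => partialD k F (v j)) (fun j => normalMean (v (j + 1)) (v (j + 2)) F)
    (fun j => normalTwoMean (v (j + 1)) (v (j + 2)) F) (4 * B) (by positivity)
    (fun j => (hF0 _ (vertex_mem_triangle v j)).trans (by linarith))
    (fun j k => by
      rw [← le_div_iff₀ hh]
      refine (hF1 k _ (vertex_mem_triangle v j)).trans ?_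
      gcongr
      linarith)
    (fun j => by
      rw [← le_div_iff₀ hh]
      refine (abs_normalMean_le (edge_ne hD j) fun k x hx =>
        hF1 k x (segment_subset_triangle v _ _ hx)).trans ?_
      rw [← mul_div_assoc]
      gcongr
      linarith)
    (fun j => by
      rw [← le_div_iff₀ (by positivity), mul_div_assoc]
      exact abs_normalTwoMean_le (edge_ne hD j) fun k l x hx =>
        hF2 k l x (segment_subset_triangle v _ _ hx))
  have hPmem : P ∈ shapeSpace v := mem_shapeSpace.2 ⟨P, 0, 0, hPdeg, by simp, by simp, by simp⟩
  refine ⟨P + q, ⟨Submodule.add_mem _ hPmem hq, ?_, ?_, ?_, ?_⟩, ?_⟩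
  · rintro _ ⟨j, rfl⟩
    rw [polyEval_add, hq0, hFdef]
    ring
  · rintro _ ⟨j, rfl⟩ k
    rw [map_add, polyEval_add, hq1, hFdef, partialD_sub hφ hPs, partialD_polyEval]
    ring
  · refine forall_edge (P := fun a b => edgeNormal a b (P + q) = normalMean a b φ) ?_ fun j => ?_
    · intro a b hab
      rw [edgeNormal_eq_normalMean] at hab ⊢
      rw [normalMean_symm a b, normalMean_symm a b, hab]
    · rw [edgeNormal_add, hqn, hFdef, normalMean_sub _ _ hφ hPs, edgeNormal_eq_normalMean]
      ring
  · refine forall_edge (P := fun a b => edgeNormalTwo a b (P + q) = normalTwoMean a b φ) ?_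
      fun j => ?_
    · intro a b hab
      rw [edgeNormalTwo_eq_normalTwoMean] at hab ⊢
      rw [normalTwoMean_symm a b, normalTwoMean_symm a b, hab]
    · rw [edgeNormalTwo_add, hqn2, hFdef, normalTwoMean_sub _ _ hφ hPs,
        edgeNormalTwo_eq_normalTwoMean]
      ring
  · intro α hα x hx
    have h1 := hFb α hα x hx
    have h2 := hqb α hα x hx
    have h3 : multiD α φ x - polyEval (polyD α (P + q)) x =
        multiD α F x - polyEval (polyD α q) x := by
      rw [hFD, polyD_add, polyEval_add]; ring
    have hpow : 0 < h ^ order α := by positivity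
    rw [h3, ← mul_le_mul_iff_left₀ hpow]
    calc |multiD α F x - polyEval (polyD α q) x| * h ^ order α
        ≤ (|multiD α F x| + |polyEval (polyD α q) x|) * h ^ order α := by
          gcongr; exact abs_sub _ _
      _ ≤ B + C * (4 * B) := by rw [add_mul]; exact add_le_add h1 h2
      _ = (16 + 64 * C) * M * (h ^ (4 - order α) * h ^ order α) := by
          rw [← pow_add, Nat.sub_add_cancel (by omega), hB]; ring
      _ = _ := by ring

/-- The piecewise polynomial `w` has the degrees of freedom of `φ`. -/
def Interpolates {Ω : Set Plane} (T : Triangulation Ω) (φ : Plane → ℝ) (w : T.PiecewisePoly) :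
    Prop := ∀ K, LocalInterpolant (T.vertex K) φ (w K)

/-- The degrees of freedom are functionals of `φ` that do not depend on the cell. -/
theorem Interpolates.mem_feSpace {Ω : Set Plane} {T : Triangulation Ω} {φ : Plane → ℝ}
    {w : T.PiecewisePoly} (h : Interpolates T φ w) : w ∈ feSpace T := by
  refine ⟨fun K => (h K).mem_shapeSpace, fun K L a ha => ⟨?_, fun i => ?_⟩,
    fun K L a ha b hb hab => ⟨?_, ?_⟩⟩
  · rw [(h K).value a ha.1, (h L).value a ha.2]
  · rw [(h K).gradient a ha.1, (h L).gradient a ha.2]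
  · rw [(h K).normal a ha.1 b hb.1 hab, (h L).normal a ha.2 b hb.2 hab]
  · rw [(h K).normalTwo a ha.1 b hb.1 hab, (h L).normalTwo a ha.2 b hb.2 hab]

theorem IsTestFunction.eq_zero {φ : Plane → ℝ} (hφ : IsTestFunction unitSquare φ) {x : Plane}
    (hx : x ∈ frontier unitSquare) : φ x = 0 := by
  rw [frontier_unitSquare] at hx
  exact image_eq_zero_of_notMem_tsupport fun h => hx.2 (hφ.2.2 h)

theorem Interpolates.mem_feSpaceZero {T : Triangulation unitSquare} {φ : Plane → ℝ}
    {w : T.PiecewisePoly} (h : Interpolates T φ w) (hφ : IsTestFunction unitSquare φ) :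
    w ∈ feSpaceZero T := by
  refine ⟨h.mem_feSpace, fun K a ha haf => ⟨?_, fun i => ?_⟩,
    fun K a ha b hb hab hs => ⟨?_, ?_⟩⟩
  · rw [(h K).value a ha, hφ.eq_zero haf]
  · rw [(h K).gradient a ha, (hφ.partialD i).eq_zero haf]
  · rw [(h K).normal a ha b hb hab, ← abs_nonpos_iff]
    refine (abs_normalMean_le hab (A := 0) fun k x hx => ?_).trans (by simp)
    rw [(hφ.partialD k).eq_zero (hs hx), abs_zero]
  · rw [(h K).normalTwo a ha b hb hab, ← abs_nonpos_iff]
    refine (abs_normalTwoMean_le hab (A := 0) fun k l x hx => ?_).trans (by simp)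
    rw [((hφ.partialD l).partialD k).eq_zero (hs hx), abs_zero]

/-! ### The approximation property -/

theorem sum_lintegral_cell_le (T : Triangulation unitSquare) (g : Plane → ℝ≥0∞) :
    ∑ K, ∫⁻ x in T.cell K, g x ≤ ∫⁻ x in unitSquare, g x := by
  have h1 : ∀ K, ∫⁻ x in T.cell K, g x = ∫⁻ x in interior (T.cell K), g x := fun K =>
    (setLIntegral_congr (interior_triangle_ae_eq (T.vertex K))).symm
  simp only [h1]
  rw [← lintegral_biUnion_finset (fun K _ L _ hKL => T.disjoint_interior hKL)
    (fun K _ => isOpen_interior.measurableSet)]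
  exact lintegral_mono_set (Set.iUnion₂_subset fun K _ => interior_cell_subset K)

/-- From `(a + b)² ≤ 2 a² + 2 b²`, the disjointness of the cell interiors, and the area of the
square being at most one. -/
theorem sum_eLpNorm_cell_le (T : Triangulation unitSquare) {f ψ : Plane → ℝ}
    {p : Fin T.numCells → Plane → ℝ} {ε : ℝ}
    (hf : eLpNorm (fun x => f x - ψ x) 2 (volume.restrict unitSquare) ≤ ENNReal.ofReal ε)
    (hp : ∀ K, ∀ x ∈ T.cell K, |ψ x - p K x| ≤ ε) :
    ∑ K, eLpNorm (fun x => f x - p K x) 2 (volume.restrict (T.cell K)) ^ 2 ≤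
      4 * ENNReal.ofReal ε ^ 2 := by
  have hpt : ∀ a b : ℝ≥0∞, (a + b) ^ 2 ≤ 2 * a ^ 2 + 2 * b ^ 2 := by
    intro a b
    have := ENNReal.rpow_add_le_mul_rpow_add_rpow a b (p := 2) (by norm_num)
    norm_num at this
    rwa [mul_add] at this
  calc ∑ K, eLpNorm (fun x => f x - p K x) 2 (volume.restrict (T.cell K)) ^ 2
      ≤ ∑ K, ∫⁻ x in T.cell K, (2 * ‖f x - ψ x‖ₑ ^ 2 + 2 * ENNReal.ofReal ε ^ 2) := by
        refine Finset.sum_le_sum fun K _ => ?_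
        rw [eLpNorm_two_sq]
        refine setLIntegral_mono' (isCompact_triangle (T.vertex K)).measurableSet fun x hx => ?_
        have h1 : ‖ψ x - p K x‖ₑ ≤ ENNReal.ofReal ε := by
          rw [← ofReal_norm]
          exact ENNReal.ofReal_le_ofReal (hp K x hx)
        calc ‖f x - p K x‖ₑ ^ 2 ≤ (‖f x - ψ x‖ₑ + ‖ψ x - p K x‖ₑ) ^ 2 := by
              gcongr
              rw [← sub_add_sub_cancel (f x) (ψ x) (p K x)]
              exact enorm_add_le _ _
          _ ≤ (‖f x - ψ x‖ₑ + ENNReal.ofReal ε) ^ 2 := by gcongr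
          _ ≤ _ := hpt _ _
    _ ≤ ∫⁻ x in unitSquare, (2 * ‖f x - ψ x‖ₑ ^ 2 + 2 * ENNReal.ofReal ε ^ 2) :=
        sum_lintegral_cell_le T _
    _ = 2 * eLpNorm (fun x => f x - ψ x) 2 (volume.restrict unitSquare) ^ 2 +
        2 * ENNReal.ofReal ε ^ 2 * volume unitSquare := by
        rw [lintegral_add_right _ measurable_const, lintegral_const_mul' _ _ (by simp),
          eLpNorm_two_sq, lintegral_const, Measure.restrict_apply_univ]
    _ ≤ 2 * ENNReal.ofReal ε ^ 2 + 2 * ENNReal.ofReal ε ^ 2 * 1 := by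
        gcongr
        exact volume_unitSquare_le
    _ = 4 * ENNReal.ofReal ε ^ 2 := by rw [mul_one, ← add_mul]; norm_num

theorem exists_interpolates {ι : Type*} {T : ι → Triangulation unitSquare}
    (hreg : ShapeRegular T) {φ : Plane → ℝ} (hφ : ContDiff ℝ ∞ φ) :
    ∃ A, 0 ≤ A ∧ ∀ i, (T i).meshSize ≤ 1 → ∃ w, Interpolates (T i) φ w ∧
      ∀ α, order α ≤ 3 → ∀ K, ∀ x ∈ (T i).cell K,
        |multiD α φ x - polyEval (polyD α (w K)) x| ≤ A * (T i).meshSize := by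
  obtain ⟨c₀, hc₀, hc⟩ := hreg
  obtain ⟨C, hC0, hC⟩ := exists_localInterpolant hc₀.le
  obtain ⟨M, hM0, hM⟩ := exists_bound_multiD isCompact_closure_unitSquare hφ 4
  refine ⟨C * M, by positivity, fun i hi => ?_⟩
  choose w hw hwb using fun K => hC ((T i).vertex K) ((T i).dblArea_ne K)
    (abs_baryGrad_mul_diam_le ((T i).dblArea_ne K) (hc i K)) φ M hφ hM0
    (fun α hα x hx => hM α hα.le x ((T i).cell_subset_closure K hx))
  refine ⟨w, hw, fun α hα K x hx => (hwb K α hα x hx).trans ?_⟩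
  have h0 : 0 ≤ (T i).cellDiam K := Metric.diam_nonneg
  have h1 := cellDiam_le_meshSize (T i) K
  gcongr
  -- The exponent is at least one, and the mesh size is at most one.
  calc _ = (T i).cellDiam K ^ (4 - order α) := rfl
    _ ≤ (T i).cellDiam K ^ 1 := pow_le_pow_of_le_one h0 (h1.trans hi) (by omega)
    _ ≤ _ := by rwa [pow_one]

/-- A density argument: choose smooth approximants within a tolerance, then a mesh so fine that
interpolation stays within the same tolerance. The class `A` and the spaces `V` are left open to
serve both pairs of spaces. -/
theorem tendsto_iInf_brokenDist {ι : Type*} {T : ι → Triangulation unitSquare}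
    (hreg : ShapeRegular T) {V : ∀ i, Set (T i).PiecewisePoly} {A : (Plane → ℝ) → Prop}
    (hA : ∀ φ, A φ → ContDiff ℝ ∞ φ)
    (hV : ∀ i φ w, A φ → Interpolates (T i) φ w → w ∈ V i) {v : Fin 2 → Plane → ℝ}
    (hv : ∀ j, ∀ ε : ℝ, 0 < ε → ∃ φ, A φ ∧ ∀ α, order α ≤ 3 →
      eLpNorm (fun x => weakDeriv unitSquare α (v j) x - multiD α φ x) 2
        (volume.restrict unitSquare) ≤ ENNReal.ofReal ε) :
    Tendsto (fun i => ⨅ w ∈ {w : Fin 2 → (T i).PiecewisePoly | ∀ j, w j ∈ V i},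
      brokenDist (T i) 3 v w) (comap (fun i => (T i).meshSize) (𝓝 0)) (𝓝 0) := by
  rw [ENNReal.tendsto_nhds_zero]
  intro η hη
  obtain ⟨r, hr0, hrη⟩ := ENNReal.lt_iff_exists_nnreal_btwn.1 hη
  have hr : (0 : ℝ) < r := by exact_mod_cast hr0
  -- Two components, `card` multi-indices and the factor 4 of `sum_eLpNorm_cell_le`. With tolerance
  -- `r / N` the squared distance is at most `N (r / N)² ≤ r²`.
  set N : ℕ := 8 * (multiIndices 3).card with hN
  have hN1 : 1 ≤ N := by
    have : 0 < (multiIndices 3).card :=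
      Finset.card_pos.2 ⟨0, mem_multiIndices.2 (by simp [order])⟩
    omega
  have hN0 : (0 : ℝ) < N := by exact_mod_cast hN1
  have hε : 0 < (r : ℝ) / N := by positivity
  choose φ hφ hφv using fun j => hv j _ hε
  choose B hB0 hB using fun j => exists_interpolates hreg (hA _ (hφ j))
  have hev : ∀ᶠ h in 𝓝 (0 : ℝ), h ≤ 1 ∧ ∀ j, B j * h ≤ r / N := by
    refine (eventually_le_nhds zero_lt_one).and (eventually_all.2 fun j => ?_)
    refine Tendsto.eventually_le_const hε ?_
    have : Tendsto (fun h : ℝ => B j * h) (𝓝 0) (𝓝 (B j * 0)) := tendsto_id.const_mul _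
    simpa using this
  filter_upwards [hev.comap fun i => (T i).meshSize] with i hi
  obtain ⟨hi1, hi2⟩ := hi
  choose w hw hwb using fun j => hB j i hi1
  refine (iInf₂_le w fun j => hV i _ _ (hφ j) (hw j)).trans (le_trans ?_ hrη.le)
  rw [brokenDist]
  have hsum : ∑ j, ∑ K, ∑ α ∈ multiIndices 3,
      eLpNorm (fun x => weakDeriv unitSquare α (v j) x - polyEval (polyD α (w j K)) x) 2
        (volume.restrict ((T i).cell K)) ^ 2 ≤ N * ENNReal.ofReal (r / N) ^ 2 := by
    calc _ ≤ ∑ j : Fin 2, ∑ α ∈ multiIndices 3, 4 * ENNReal.ofReal (r / N) ^ 2 := by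
          refine Finset.sum_le_sum fun j _ => ?_
          rw [Finset.sum_comm]
          refine Finset.sum_le_sum fun α hα => ?_
          have hα' := mem_multiIndices.1 hα
          exact sum_eLpNorm_cell_le (T i) (hφv j α hα')
            fun K x hx => (hwb j α hα' K x hx).trans (hi2 j)
      _ = N * ENNReal.ofReal (r / N) ^ 2 := by
          simp only [Finset.sum_const, Finset.card_univ, Fintype.card_fin, nsmul_eq_mul, hN]
          push_cast
          ring
  have hle : (N : ℝ≥0∞) * ENNReal.ofReal (r / N) ^ 2 ≤ (r : ℝ≥0∞) ^ 2 := by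
    rw [← ENNReal.ofReal_natCast, ← ENNReal.ofReal_pow hε.le, ← ENNReal.ofReal_mul hN0.le,
      ← ENNReal.ofReal_coe_nnreal, ← ENNReal.ofReal_pow hr.le]
    refine ENNReal.ofReal_le_ofReal ?_
    have hN1' : (1 : ℝ) ≤ N := by exact_mod_cast hN1
    rw [div_pow, ← mul_div_assoc, div_le_iff₀ (by positivity)]
    nlinarith [mul_nonneg (sq_nonneg (r : ℝ)) (mul_nonneg hN0.le (sub_nonneg.2 hN1'))]
  calc _ ≤ ((r : ℝ≥0∞) ^ 2) ^ (1 / 2 : ℝ) := ENNReal.rpow_le_rpow (hsum.trans hle) (by norm_num)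
    _ = r := by
      rw [← ENNReal.rpow_natCast, ← ENNReal.rpow_mul]
      norm_num

/-! ### Assembly of approximation and consistency -/

theorem isConsistentApproximation_vectorFE {ι : Type*} {T : ι → Triangulation unitSquare}
    (hreg : ShapeRegular T) :
    IsConsistentApproximation 3 T (fun i => vectorFE (T i)) (vectorSobolev 3 unitSquare) where
  approximation v hv := tendsto_iInf_brokenDist hreg (A := fun φ => ContDiff ℝ ∞ φ)
    (fun _ h => h) (fun _ _ _ _ h => h.mem_feSpace) fun j _ hε => (hv j).exists_smooth_approx hε
  consistency n w g hmesh hw hg := by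
    have h := fun j => consistency_feSpace (w := fun k => w k j) (g := fun α => g α j) hreg hmesh
      (fun k => hw k j) fun α hα => hg α hα j
    exact ⟨fun j => (h j).1, fun α hα j => (h j).2 α hα⟩

theorem isConsistentApproximation_vectorFEZero {ι : Type*} {T : ι → Triangulation unitSquare}
    (hreg : ShapeRegular T) :
    IsConsistentApproximation 3 T (fun i => vectorFEZero (T i))
      (vectorSobolevZero 3 unitSquare) where
  approximation v hv := tendsto_iInf_brokenDist hreg (A := IsTestFunction unitSquare)
    (fun _ h => h.1) (fun _ _ _ hφ h => h.mem_feSpaceZero hφ) fun j ε hε => by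
      obtain ⟨φ, hφ, h⟩ := (hv j).2 (ENNReal.ofReal ε) (ENNReal.ofReal_pos.2 hε)
      exact ⟨φ, hφ, fun α hα => (h α hα).le⟩
  consistency n w g hmesh hw hg :=
    ⟨fun j => consistency_feSpaceZero (w := fun k => w k j) (g := fun α => g α j) hreg hmesh
      (fun k => hw k j) fun α hα => hg α hα j,
    ((isConsistentApproximation_vectorFE hreg).consistency n w g hmesh
      (fun k j => (hw k j).1) hg).2⟩

end WuXu

end

theorem mainTheorem3 {ι : Type*} (T : ι → WuXu.Triangulation WuXu.unitSquare)
    (hreg : WuXu.ShapeRegular T) (hqu : WuXu.QuasiUniform T) :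
    WuXu.IsConsistentApproximation 3 T (fun i => WuXu.vectorFEZero (T i))
        (WuXu.vectorSobolevZero 3 WuXu.unitSquare) ∧
      WuXu.IsConsistentApproximation 3 T (fun i => WuXu.vectorFE (T i))
        (WuXu.vectorSobolev 3 WuXu.unitSquare) := by
  exact ⟨WuXu.isConsistentApproximation_vectorFEZero hreg,
    WuXu.isConsistentApproximation_vectorFE hreg⟩
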